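/- **Setting.** Let $G$ be a countable discrete group, $(X,\mu)$ a standard probability space (possibly with atoms), and $G\curvearrowright (X,\mu)$ a measure-preserving action. Write $\alpha_s(f)(x)=f(s^{-1}x)$ for the induced action on $L^\infty(X,\mu)$. A set $S\subseteq L^\infty(X,\mu)$ is *dynamically generating* if $\{\alpha_s(a): s\in G, a\in S\}$ generates $L^\infty(X,\mu)$ as a von Neumann algebra. On $M_d=M_d(\mathbb C)$ let $\mathrm{tr}$ be the normalized trace and $\|a\|_2=\mathrm{tr}(a^*a)^{1/2}$; let $S_d$ and $I_d$ be the sets of permutation matrices and of partial permutation matrices in $M_d$, and identify $\mathbb C^d$ with the diagonal matrices. We put $\log 0=-\infty$ and $\log\infty=\infty$; $n$ and $d$ denote positive integers. **Sofic dimension.** Let $\mathscr G=G\times X$ be the groupoid of the action, where $(g,x)$ has source $x$ and range $gx$, $(g,hx)(h,x)=(gh,x)$, and units $(e,x)$; it carries the product of counting measure and $\mu$. Let $I_{G,X}$ be the inverse semigroup of Borel sets $B\subseteq\mathscr G$ on which source and range are injective, modulo null sets, with product $BC=\{\beta\gamma\}$ (over composable pairs) and $B^*=B^{-1}$. Let $[I_{G,X}]$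 be the linear span of $I_{G,X}$, its elements being viewed as characteristic functions on $\mathscr G$ modulo null sets, and let $\tau(a)$ be the integral of $a$ over the unit space. For a finite $F\subseteq I_{G,X}$ and $\delta>0$ let $\mathrm{SA}(F,n,\delta,d)$ be the set of linear maps $\varphi:[I_{G,X}]\to M_d$ such that for all $1\le k\le n$ and $s_1,\dots,s_k\in F\cup F^*$ one has $\|\varphi(s_1\cdots s_k)-\varphi(s_1)\cdots\varphi(s_k)\|_2<\delta$, $\varphi(s_1\cdots s_k)\in I_d$ and $|\mathrm{tr}(\varphi(s_1\cdots s_k))-\tau(s_1\cdots s_k)|<\delta$. Let $|\mathrm{SA}(F,n,\delta,d)|_E$ be the number of restrictions to $E$ of elements of $\mathrm{SA}(F,n,\delta,d)$. Define $$s(G,X)=\sup_E\inf_F\inf_{n}\inf_{\delta>0}\limsup_{d\to\infty}\frac{\log|\mathrm{SA}(F,n,\delta,d)|_E}{d\log d},$$ with $E,F$ running over the finite subsets of $I_{G,X}$, and $\underline s(G,X)$ likewise with $\liminf$ in place of $\limsup$. **Separating group and space.** For a finite $F\subseteq G$ put $F_n=(F\cup F^{-1}\cup\{e\})^n$ (the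 set of $n$-fold products). Let $\mathrm{GA}(F,n,\delta,d)$ be the set of maps $\sigma:G\to S_d$ with $\sigma_e=1$, with $\|\sigma_{s_1\cdots s_n}-\sigma_{s_1}\cdots\sigma_{s_n}\|_2<\delta$ for all $s_1,\dots,s_n\in F\cup F^{-1}\cup\{e\}$, and with $\mathrm{tr}(\sigma_s)<\delta$ for all $s\in F_n\setminus\{e\}$. For a finite partition of unity $P\subseteq L^\infty(X,\mu)$ consisting of projections let $P_{F_n}$ be the set of all $\prod_{s\in F_n}\alpha_s(p_s)$ with $p_s\in P$. Let $\mathrm{HA}(F,P,n,\delta,d)$ be the set of pairs $(\sigma,\varphi)$ with $\sigma\in\mathrm{GA}(F,n,\delta,d)$ and $\varphi:\mathrm{span}(P_{F_n})\to\mathbb C^d$ a unital homomorphism such that $|\mathrm{tr}(\varphi(p))-\mu(p)|<\delta$ for $p\in P_{F_n}$ and $\|\varphi(\alpha_s(p))-\sigma_s\varphi(p)\sigma_s^{*}\|_2<\delta$ for $p\in P$ and $s\in F_n$. For a finite $E\subseteq G$ and a finite set $Q$ of projections in $L^\infty(X,\mu)$ let $|\mathrm{HA}(F,P,n,\delta,d)|_{E,Q}$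 be the number of pairs $(\sigma|_E,\varphi|_{Q\cap\mathrm{span}(P_{F_n})})$ with $(\sigma,\varphi)\in\mathrm{HA}(F,P,n,\delta,d)$, and set $$s_{E,Q}(F,P)=\inf_n\inf_{\delta>0}\limsup_{d\to\infty}\frac{\log|\mathrm{HA}(F,P,n,\delta,d)|_{E,Q}}{d\log d},$$ and let $\underline s_{E,Q}(F,P)$ be defined in the same way with $\liminf$. **Proposition.** Let $\Omega$ be a generating subset of $G$ and let $M$ be a unital $*$-subalgebra of $L^\infty(X,\mu)$ whose projections form a dynamically generating set. Then $$s(G,X)=\sup_E\sup_Q\inf_F\inf_P s_{E,Q}(F,P),\qquad \underline s(G,X)=\sup_E\sup_Q\inf_F\inf_P\underline s_{E,Q}(F,P),$$ where $E$ and $F$ run over the finite subsets of $\Omega$ and $P$ and $Q$ over the finite partitions of unity in $M$ consisting of projections. In particular, if $F$ is a finite generating subset of $G$ and $P$ is a dynamically generating finite partition of unity in $L^\infty(X,\mu)$ consisting of projections, then $$s(G,X)=s_{F,P}(F,P)\quad\text{and}\quad \underline s(G,X)=\underline s_{F,P}(F,P).$$ -/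

import Mathlib

open MeasureTheory Filter
open scoped ENNReal Pointwise

/-! ## The algebra `L^∞(X, μ)` and the induced action -/

namespace SoficDim

section Linfty

variable {X : Type*} [MeasurableSpace X] {μ : Measure X}

noncomputable instance instCommRingAEEqFun : CommRing (X →ₘ[μ] ℂ) :=
  { (inferInstance : AddCommGroup (X →ₘ[μ] ℂ)), (inferInstance : CommMonoid (X →ₘ[μ] ℂ)) with
    left_distrib := fun a b c => AEEqFun.toGerm_injective (by
      simp only [AEEqFun.mul_toGerm, AEEqFun.add_toGerm, mul_add])
    right_distrib := fun a b c => AEEqFun.toGerm_injective (by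
      simp only [AEEqFun.mul_toGerm, AEEqFun.add_toGerm, add_mul])
    zero_mul := fun a => AEEqFun.toGerm_injective (by
      simp only [AEEqFun.mul_toGerm, AEEqFun.zero_toGerm, zero_mul])
    mul_zero := fun a => AEEqFun.toGerm_injective (by
      simp only [AEEqFun.mul_toGerm, AEEqFun.zero_toGerm, mul_zero]) }

noncomputable instance instAlgebraAEEqFun : Algebra ℂ (X →ₘ[μ] ℂ) :=
  Algebra.ofModule
    (fun r a b => by
      apply AEEqFun.ext
      filter_upwards [AEEqFun.coeFn_mul (r • a) b, AEEqFun.coeFn_smul r a,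
        AEEqFun.coeFn_smul r (a * b), AEEqFun.coeFn_mul a b] with x h1 h2 h3 h4
      rw [h1, Pi.mul_apply, h2, h3, Pi.smul_apply, Pi.smul_apply, h4, Pi.mul_apply, smul_mul_assoc])
    (fun r a b => by
      apply AEEqFun.ext
      filter_upwards [AEEqFun.coeFn_mul a (r • b), AEEqFun.coeFn_smul r b,
        AEEqFun.coeFn_smul r (a * b), AEEqFun.coeFn_mul a b] with x h1 h2 h3 h4
      rw [h1, Pi.mul_apply, h2, h3, Pi.smul_apply, Pi.smul_apply, h4, Pi.mul_apply, mul_smul_comm])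

noncomputable instance instStarRingAEEqFun : StarRing (X →ₘ[μ] ℂ) where
  star_mul a b := by
    apply AEEqFun.ext
    filter_upwards [AEEqFun.coeFn_star (a * b), AEEqFun.coeFn_mul a b,
      AEEqFun.coeFn_mul (star b) (star a), AEEqFun.coeFn_star a, AEEqFun.coeFn_star b]
      with x h1 h2 h3 h4 h5
    rw [h1, h3, Pi.star_apply, h2, Pi.mul_apply, Pi.mul_apply, h4, h5, Pi.star_apply,
      Pi.star_apply, star_mul]
  star_add a b := by
    apply AEEqFun.ext
    filter_upwards [AEEqFun.coeFn_star (a + b), AEEqFun.coeFn_add a b,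
      AEEqFun.coeFn_add (star a) (star b), AEEqFun.coeFn_star a, AEEqFun.coeFn_star b]
      with x h1 h2 h3 h4 h5
    simp [h1, h2, h3, h4, h5]

instance instStarModuleAEEqFun : StarModule ℂ (X →ₘ[μ] ℂ) where
  star_smul r a := by
    apply AEEqFun.ext
    filter_upwards [AEEqFun.coeFn_star (r • a), AEEqFun.coeFn_smul r a,
      AEEqFun.coeFn_smul (star r) (star a), AEEqFun.coeFn_star a] with x h1 h2 h3 h4
    rw [h1, h3, Pi.star_apply, h2, Pi.smul_apply, Pi.smul_apply, h4, Pi.star_apply, star_smul]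

/-- `L^∞(X, μ)`: the essentially bounded elements of the `*`-algebra of complex measurable
functions modulo almost everywhere equality. -/
def Linfty (μ : Measure X) : StarSubalgebra ℂ (X →ₘ[μ] ℂ) where
  carrier := {f | MemLp f ∞ μ}
  mul_mem' {a b} ha hb :=
    (MemLp.mul (p := ∞) (q := ∞) (r := ∞) hb ha).ae_eq (AEEqFun.coeFn_mul a b).symm
  add_mem' {a b} ha hb := (MemLp.add ha hb).ae_eq (AEEqFun.coeFn_add a b).symm
  algebraMap_mem' r := by
    have h : MemLp (fun _ : X => r) ∞ μ := memLp_top_const r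
    refine h.ae_eq ?_
    rw [Algebra.algebraMap_eq_smul_one]
    filter_upwards [AEEqFun.coeFn_smul r (1 : X →ₘ[μ] ℂ),
      AEEqFun.coeFn_one (α := X) (β := ℂ) (μ := μ)] with x h1 h2
    simp [h1, h2]
  star_mem' {a} ha := (MemLp.star ha).ae_eq (AEEqFun.coeFn_star a).symm

/-- The weak-`*` topology on `L^∞(X, μ) = L^1(X, μ)^*`: the coarsest topology for which all the
functionals `f ↦ ∫ f g dμ` with `g ∈ L^1(X, μ)` are continuous. -/
@[reducible]
noncomputable def weakStar (μ : Measure X) : TopologicalSpace (Linfty μ) :=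
  TopologicalSpace.induced
    (fun (f : Linfty μ) (g : X →₁[μ] ℂ) => ∫ x, (f : X →ₘ[μ] ℂ) x * g x ∂μ)
    Pi.topologicalSpace

/-- `S` generates `L^∞(X, μ)` as a von Neumann algebra: the only weak-`*` closed unital
`*`-subalgebra of `L^∞(X, μ)` containing `S` is `L^∞(X, μ)` itself. -/
def GeneratesVN (S : Set (Linfty μ)) : Prop :=
  ∀ N : StarSubalgebra ℂ (Linfty μ), S ⊆ N → @IsClosed _ (weakStar μ) (N : Set (Linfty μ)) → N = ⊤

/-- A finite partition of unity in `L^∞(X, μ)` consisting of projections. -/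
def IsProjPartition (P : Finset (Linfty μ)) : Prop :=
  (∀ p ∈ P, IsStarProjection p) ∧ (∀ p ∈ P, ∀ q ∈ P, p ≠ q → p * q = 0) ∧ ∑ p ∈ P, p = 1

variable {G : Type*} [Group G] [MulAction G X] [MeasurableConstSMul G X]
  [SMulInvariantMeasure G X μ]

/-- The induced action on `L^∞(X, μ)`: `(α_s f)(x) = f (s⁻¹ x)`. -/
noncomputable def act (s : G) (f : Linfty μ) : Linfty μ :=
  ⟨(f : X →ₘ[μ] ℂ).compMeasurePreserving (fun x => s⁻¹ • x) (measurePreserving_smul s⁻¹ μ), by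
    have h : MemLp (f : X →ₘ[μ] ℂ) ∞ μ := f.2
    exact (h.comp_measurePreserving (measurePreserving_smul s⁻¹ μ)).ae_eq
      ((f : X →ₘ[μ] ℂ).coeFn_compMeasurePreserving (measurePreserving_smul s⁻¹ μ)).symm⟩

variable (G) in
/-- `S` is dynamically generating: its translates generate `L^∞(X, μ)` as a von Neumann algebra. -/
def DynGenerating (S : Set (Linfty μ)) : Prop :=
  GeneratesVN {f : Linfty μ | ∃ s : G, ∃ a ∈ S, f = act s a}

/-- `P_F`: the set of all projections `∏_{s ∈ F} α_s(p_s)` with `p_s ∈ P`. -/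
def translates (P : Finset (Linfty μ)) (F : Finset G) : Set (Linfty μ) :=
  {f | ∃ p : G → Linfty μ, (∀ s ∈ F, p s ∈ P) ∧ f = ∏ s ∈ F, act s (p s)}

end Linfty

/-! ## Matrices -/

section Matrices

variable {d : ℕ}

/-- The normalized trace on `M_d`. -/
noncomputable def tr (A : Matrix (Fin d) (Fin d) ℂ) : ℂ := A.trace / d

/-- The normalized `2`-norm `A ↦ tr(A^* A)^{1/2}` on `M_d`. -/
noncomputable def norm2 (A : Matrix (Fin d) (Fin d) ℂ) : ℝ :=
  Real.sqrt (tr (A.conjTranspose * A)).re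

/-- The permutation matrix of `σ`, which sends the basis vector `ξ_j` to `ξ_{σ j}`. (The matrix
`Equiv.Perm.permMatrix` sends `ξ_{σ j}` to `ξ_j`.) -/
def permMat (σ : Equiv.Perm (Fin d)) : Matrix (Fin d) (Fin d) ℂ := (σ⁻¹).permMatrix ℂ

/-- `I_d`: the set of all partial permutation matrices. -/
def partialPerms (d : ℕ) : Set (Matrix (Fin d) (Fin d) ℂ) :=
  {A | ∃ f : Fin d ≃. Fin d, A = f.toMatrix}

/-- The sequence `(log c_d) / (d log d)`, for cardinalities `c_d`, with `log 0 = -∞` and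
`log ∞ = ∞`. -/
noncomputable def rate (c : ℕ → ℕ∞) (d : ℕ) : EReal :=
  ENNReal.log (c d : ℝ≥0∞) / ((d * Real.log d : ℝ) : EReal)

/-- Limit superior along `d → ∞`. -/
noncomputable def upperLim (u : ℕ → EReal) : EReal := limsup u atTop

/-- Limit inferior along `d → ∞`. -/
noncomputable def lowerLim (u : ℕ → EReal) : EReal := liminf u atTop

end Matrices

/-! ## The p.m.p. groupoid of an action

The groupoid associated to `G ↷ (X, μ)` is `G × X`. The arrow `(g, x)` has source `x` and
range `g x`, the product is `(g, h x) (h, x) = (g h, x)`, the inverse of `(g, x)` is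
`(g⁻¹, g x)`, and the units are the arrows `(1, x)`, identified with `X`. -/

section Groupoid

variable {G X : Type*} [Group G] [MulAction G X]

/-- The source of an arrow. -/
def src (γ : G × X) : X := γ.2

/-- The range of an arrow. -/
def rng (γ : G × X) : X := γ.1 • γ.2

/-- The product of arrows, meaningful when `src β = rng γ`. -/
def arrowMul (β γ : G × X) : G × X := (β.1 * γ.1, γ.2)

/-- The inverse of an arrow. -/
def arrowInv (γ : G × X) : G × X := (γ.1⁻¹, γ.1 • γ.2)

variable [MeasurableSpace X] [MeasurableSpace G]

/-- The measure of the p.m.p. groupoid: `B ↦ ∫ |src⁻¹(x) ∩ B| dμ(x)`. -/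
noncomputable def gdMeasure (G : Type*) [MeasurableSpace G] (μ : Measure X) : Measure (G × X) :=
  Measure.count.prod μ

variable (G X) in
/-- A Borel subset of the groupoid on which the source and range maps are injective. -/
structure Bisection where
  /-- the underlying set of arrows -/
  carrier : Set (G × X)
  measurable : MeasurableSet carrier
  src_inj : Set.InjOn src carrier
  rng_inj : Set.InjOn rng carrier

variable [Countable G] [DiscreteMeasurableSpace G] [MeasurableConstSMul G X]

theorem measurable_arrowInv : Measurable (arrowInv : G × X → G × X) := by
  refine Measurable.prodMk ?_ ?_
  · exact (Measurable.of_discrete (f := fun g : G => g⁻¹)).comp measurable_fst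
  · exact measurable_from_prod_countable_right (fun g => measurable_const_smul g)

/-- The product `B C = {β γ : β ∈ B, γ ∈ C composable}`. -/
def Bisection.mul (B C : Bisection G X) : Bisection G X where
  carrier := {γ | ∃ β ∈ B.carrier, ∃ c ∈ C.carrier, src β = rng c ∧ γ = arrowMul β c}
  measurable := by
    have h : {γ : G × X | ∃ β ∈ B.carrier, ∃ c ∈ C.carrier, src β = rng c ∧ γ = arrowMul β c} =
        ⋃ h : G, ((fun γ : G × X => (h, γ.2)) ⁻¹' C.carrier ∩
          (fun γ : G × X => (γ.1 * h⁻¹, h • γ.2)) ⁻¹' B.carrier) := by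
      ext ⟨g, x⟩
      simp only [Set.mem_ofPred_eq, Set.mem_iUnion, Set.mem_inter_iff, Set.mem_preimage]
      constructor
      · rintro ⟨⟨b, y⟩, hb, ⟨c, z⟩, hc, h1, h2⟩
        simp only [src, rng, arrowMul, Prod.mk.injEq] at h1 h2
        obtain ⟨rfl, rfl⟩ := h2
        subst h1
        exact ⟨c, hc, by simpa using hb⟩
      · rintro ⟨h, hc, hb⟩
        exact ⟨_, hb, _, hc, rfl, by simp [arrowMul]⟩
    rw [h]
    refine MeasurableSet.iUnion fun h => (C.measurable.preimage ?_).inter (B.measurable.preimage ?_)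
    · exact measurable_const.prodMk measurable_snd
    · exact ((Measurable.of_discrete (f := fun g : G => g * h⁻¹)).comp measurable_fst).prodMk
        ((measurable_const_smul h).comp measurable_snd)
  src_inj := by
    rintro _ ⟨β, hβ, c, hc, h, rfl⟩ _ ⟨β', hβ', c', hc', h', rfl⟩ hs
    have e : c = c' := C.src_inj hc hc' hs
    subst e
    have e' : β = β' := B.src_inj hβ hβ' (h.trans h'.symm)
    rw [e']
  rng_inj := by
    rintro _ ⟨β, hβ, c, hc, h, rfl⟩ _ ⟨β', hβ', c', hc', h', rfl⟩ hs
    have key : ∀ b a : G × X, src b = rng a → rng (arrowMul b a) = rng b := by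
      intro b a hba
      simp only [src, rng] at hba
      simp only [rng, arrowMul, hba, mul_smul]
    rw [key _ _ h, key _ _ h'] at hs
    have e : β = β' := B.rng_inj hβ hβ' hs
    subst e
    have e' : c = c' := C.rng_inj hc hc' (h.symm.trans h')
    rw [e']

/-- The inverse `B⁻¹ = {γ⁻¹ : γ ∈ B}`. -/
def Bisection.inv (B : Bisection G X) : Bisection G X where
  carrier := {γ | arrowInv γ ∈ B.carrier}
  measurable := B.measurable.preimage measurable_arrowInv
  src_inj := by
    rintro ⟨g, x⟩ h ⟨g', x'⟩ h' hs
    have e := B.rng_inj h h' (by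
      simp only [src] at hs
      simpa [rng, arrowInv] using hs)
    simp only [arrowInv, Prod.mk.injEq, inv_inj] at e
    simp only [src] at hs
    simp [e.1, hs]
  rng_inj := by
    rintro ⟨g, x⟩ h ⟨g', x'⟩ h' hs
    have e := B.src_inj h h' hs
    simp only [arrowInv, Prod.mk.injEq, inv_inj] at e
    obtain ⟨rfl, e2⟩ := e
    simpa using e2

/-- The set of units. -/
def Bisection.one : Bisection G X where
  carrier := {γ | γ.1 = 1}
  measurable := measurable_fst (MeasurableSet.of_discrete (s := {(1 : G)}))
  src_inj := by
    rintro ⟨g, x⟩ h ⟨g', x'⟩ h' hs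
    simp only [Set.mem_ofPred_eq] at h h'
    simp only [src] at hs
    simp [h, h', hs]
  rng_inj := by
    rintro ⟨g, x⟩ h ⟨g', x'⟩ h' hs
    simp only [Set.mem_ofPred_eq] at h h'
    subst h h'
    simpa [rng] using hs

variable (μ : Measure X) [IsProbabilityMeasure μ]

theorem ae_gdMeasure_iff {P : G × X → Prop} (hP : MeasurableSet {γ | P γ}) :
    (∀ᵐ γ ∂(gdMeasure G μ), P γ) ↔ ∀ᵐ x ∂μ, ∀ g, P (g, x) := by
  rw [ae_all_iff, gdMeasure, Measure.ae_prod_iff_ae_ae hP]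
  constructor
  · intro h g
    by_contra hg
    have := (ae_iff (μ := (Measure.count : Measure G))).1 h
    rw [Measure.count_eq_zero_iff] at this
    exact (Set.eq_empty_iff_forall_notMem.1 this g) hg
  · intro h
    exact Eventually.of_forall h

variable (G) in
/-- Two Borel bisections are identified when they agree almost everywhere. -/
def bisectionSetoid : Setoid (Bisection G X) where
  r B C := ∀ᵐ γ ∂(gdMeasure G μ), γ ∈ B.carrier ↔ γ ∈ C.carrier
  iseqv :=
    ⟨fun _ => Eventually.of_forall fun _ => Iff.rfl,
      fun h => h.mono fun _ h => h.symm,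
      fun h h' => by filter_upwards [h, h'] with γ a b using a.trans b⟩

theorem bisection_rel_iff {B C : Bisection G X} :
    (bisectionSetoid G μ).r B C ↔
      ∀ᵐ x ∂μ, ∀ g, ((g, x) ∈ B.carrier ↔ (g, x) ∈ C.carrier) :=
  ae_gdMeasure_iff μ (B.measurable.iff C.measurable)

variable (G) in
/-- `I_{G,X}`: the inverse semigroup of the groupoid of the action, whose elements are the Borel
bisections modulo almost everywhere equality. -/
def InvSemigroup : Type _ := Quotient (bisectionSetoid (X := X) G μ)

/-- The function on the groupoid, modulo almost everywhere equality, that corresponds to an element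
of `I_{G,X}`: the characteristic function of the bisection. -/
noncomputable def charFun (s : InvSemigroup G μ) : (G × X) →ₘ[gdMeasure G μ] ℂ :=
  Quotient.lift (s := bisectionSetoid G μ)
    (fun B : Bisection G X => AEEqFun.mk (B.carrier.indicator fun _ => (1 : ℂ))
      ((stronglyMeasurable_const.indicator B.measurable).aestronglyMeasurable))
    (fun B C h => by
      rw [AEEqFun.mk_eq_mk]
      filter_upwards [(h : ∀ᵐ γ ∂(gdMeasure G μ), γ ∈ B.carrier ↔ γ ∈ C.carrier)] with γ hγ
      by_cases hB : γ ∈ B.carrier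
      · rw [Set.indicator_of_mem hB, Set.indicator_of_mem (hγ.1 hB)]
      · rw [Set.indicator_of_notMem hB, Set.indicator_of_notMem (fun hC => hB (hγ.2 hC))]) s

variable [SMulInvariantMeasure G X μ]

theorem ae_smul_all {P : G × X → Prop} (h : ∀ᵐ x ∂μ, ∀ g, P (g, x)) :
    ∀ᵐ x ∂μ, ∀ k g : G, P (g, k • x) := by
  rw [ae_all_iff]
  intro k
  exact (measurePreserving_smul k μ).quasiMeasurePreserving.ae h

noncomputable instance instMulInvSemigroup : Mul (InvSemigroup G μ) where
  mul := Quotient.map₂ (sa := bisectionSetoid G μ) (sb := bisectionSetoid G μ)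
    (sc := bisectionSetoid G μ) Bisection.mul (by
      intro B B' hB C C' hC
      refine (bisection_rel_iff μ).2 ?_
      filter_upwards [ae_smul_all (P := fun γ => γ ∈ B.carrier ↔ γ ∈ B'.carrier) μ
        ((bisection_rel_iff μ).1 hB), (bisection_rel_iff μ).1 hC]
        with x h1 h2 g
      simp only [Bisection.mul, Set.mem_ofPred_eq]
      constructor
      · rintro ⟨⟨b, y⟩, hb, ⟨c, z⟩, hc, e1, e2⟩
        simp only [src, rng, arrowMul, Prod.mk.injEq] at e1 e2
        obtain ⟨rfl, rfl⟩ := e2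
        subst e1
        exact ⟨_, (h1 c b).1 hb, _, (h2 c).1 hc, rfl, rfl⟩
      · rintro ⟨⟨b, y⟩, hb, ⟨c, z⟩, hc, e1, e2⟩
        simp only [src, rng, arrowMul, Prod.mk.injEq] at e1 e2
        obtain ⟨rfl, rfl⟩ := e2
        subst e1
        exact ⟨_, (h1 c b).2 hb, _, (h2 c).2 hc, rfl, rfl⟩)

noncomputable instance instStarInvSemigroup : Star (InvSemigroup G μ) where
  star := Quotient.map (sa := bisectionSetoid G μ) (sb := bisectionSetoid G μ) Bisection.inv (by
      intro B B' hB
      refine (bisection_rel_iff μ).2 ?_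
      filter_upwards [ae_smul_all (P := fun γ => γ ∈ B.carrier ↔ γ ∈ B'.carrier) μ
        ((bisection_rel_iff μ).1 hB)] with x h1 g
      exact h1 g g⁻¹)

noncomputable instance instOneInvSemigroup : One (InvSemigroup G μ) where
  one := Quotient.mk (bisectionSetoid G μ) Bisection.one

variable (G) in
/-- The linear span `[I_{G,X}]`, as a space of functions on the groupoid. -/
noncomputable def spanI : Submodule ℂ ((G × X) →ₘ[gdMeasure G μ] ℂ) :=
  Submodule.span ℂ (Set.range (charFun (G := G) μ))

/-- The elements of `I_{G,X}` as elements of `[I_{G,X}]`. -/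
noncomputable def toSpan (s : InvSemigroup G μ) : spanI G μ :=
  ⟨charFun μ s, Submodule.subset_span ⟨s, rfl⟩⟩

/-- The trace `τ(a) = ∫ a dμ`, the integral being over the unit space. -/
noncomputable def tau (a : spanI G μ) : ℂ :=
  ∫ γ in {γ : G × X | γ.1 = 1}, (a : (G × X) →ₘ[gdMeasure G μ] ℂ) γ ∂(gdMeasure G μ)

/-- `SA(F, n, δ, d)`: the linear maps `φ : [I_{G,X}] → M_d` which are
`(F ∪ F^*, n, δ)`-approximately multiplicative, send `(F ∪ F^*)^{≤ n}` into `I_d`, and satisfy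
`|tr (φ(s)) - τ(s)| < δ` for `s ∈ (F ∪ F^*)^{≤ n}`. The list `l` runs over the tuples
`(s_1, …, s_k) ∈ (F ∪ F^*)^{× k}` for `1 ≤ k ≤ n`. -/
def SA (F : Finset (InvSemigroup G μ)) (n : ℕ) (δ : ℝ) (d : ℕ) :
    Set (spanI G μ →ₗ[ℂ] Matrix (Fin d) (Fin d) ℂ) :=
  {φ | ∀ l : List (InvSemigroup G μ), 1 ≤ l.length → l.length ≤ n →
    (∀ s ∈ l, s ∈ F ∨ ∃ t ∈ F, s = star t) →
      norm2 (φ (toSpan μ l.prod) - (l.map fun s => φ (toSpan μ s)).prod) < δ ∧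
      φ (toSpan μ l.prod) ∈ partialPerms d ∧
      ‖tr (φ (toSpan μ l.prod)) - tau μ (toSpan μ l.prod)‖ < δ}

/-- `|SA(F, n, δ, d)|_E`: the number of restrictions to `E` of elements of `SA(F, n, δ, d)`. -/
noncomputable def cardSA (E F : Finset (InvSemigroup G μ)) (n : ℕ) (δ : ℝ) (d : ℕ) : ℕ∞ :=
  ((fun (φ : spanI G μ →ₗ[ℂ] Matrix (Fin d) (Fin d) ℂ) (s : E) => φ (toSpan μ (s : InvSemigroup G μ)))
    '' SA μ F n δ d).encard

/-- `s_E(F)`, or its lower variant, according to the choice of `lim`. -/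
noncomputable def sLocal (lim : (ℕ → EReal) → EReal) (E F : Finset (InvSemigroup G μ)) : EReal :=
  ⨅ (n : ℕ) (_ : 1 ≤ n), ⨅ (δ : ℝ) (_ : 0 < δ), lim (rate (cardSA μ E F n δ))

/-- `s(Ω) = sup_E inf_F s_E(F)`, with `E` and `F` running over the finite subsets of `Ω`. -/
noncomputable def sSet (lim : (ℕ → EReal) → EReal) (Ω : Set (InvSemigroup G μ)) : EReal :=
  ⨆ (E : Finset (InvSemigroup G μ)) (_ : (E : Set (InvSemigroup G μ)) ⊆ Ω),
    ⨅ (F : Finset (InvSemigroup G μ)) (_ : (F : Set (InvSemigroup G μ)) ⊆ Ω), sLocal μ lim E F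

variable (G) in
/-- The sofic dimension `s(G, X)`. -/
noncomputable def soficDim : EReal := sSet (G := G) μ upperLim Set.univ

variable (G) in
/-- The lower sofic dimension of the action. -/
noncomputable def lowerSoficDim : EReal := sSet (G := G) μ lowerLim Set.univ

end Groupoid

/-! ## Separate models for the group and the space -/

section Actions

variable {G X : Type*} [Group G] [MulAction G X]

open Classical in
/-- The symmetric set `F ∪ F^* ∪ {e}`. -/
noncomputable def symmSet (F : Finset G) : Finset G := F ∪ F⁻¹ ∪ {1}

open Classical in
/-- The set `(F ∪ F^* ∪ {e})^n` of `n`-fold products. -/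
noncomputable def window (F : Finset G) (n : ℕ) : Finset G := symmSet F ^ n

/-- `GA(F, n, δ, d)`: the identity-preserving maps `σ : G → S_d` such that
`‖σ_{s_1 ⋯ s_n} - σ_{s_1} ⋯ σ_{s_n}‖_2 < δ` for `(s_1, …, s_n) ∈ (F ∪ F^* ∪ {e})^{× n}` and
`tr(σ_s) < δ` for `s ∈ (F ∪ F^* ∪ {e})^n ∖ {e}`. -/
def GA (F : Finset G) (n : ℕ) (δ : ℝ) (d : ℕ) : Set (G → Equiv.Perm (Fin d)) :=
  {σ | σ 1 = 1 ∧
    (∀ l : List G, l.length = n → (∀ s ∈ l, s ∈ symmSet F) →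
      norm2 (permMat (σ l.prod) - permMat (l.map σ).prod) < δ) ∧
    (∀ s ∈ window F n, s ≠ 1 → (tr (permMat (σ s))).re < δ)}

variable [MeasurableSpace X] {μ : Measure X} [MeasurableConstSMul G X] [SMulInvariantMeasure G X μ]

/-- The linear span of `P_{(F ∪ F^* ∪ {e})^n}`; when `P` is a partition of unity consisting of
projections this is a finite-dimensional unital `*`-subalgebra of `L^∞(X, μ)`. -/
noncomputable def domHA (F : Finset G) (P : Finset (Linfty μ)) (n : ℕ) :
    Submodule ℂ (Linfty μ) :=
  Submodule.span ℂ (translates P (window F n))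

/-- A linear map to `ℂ^d` is a unital homomorphism: it preserves the unit and products. -/
def IsUnitalHom {A : Submodule ℂ (Linfty μ)} {d : ℕ} (φ : A →ₗ[ℂ] (Fin d → ℂ)) : Prop :=
  (∀ a : A, (a : Linfty μ) = 1 → φ a = 1) ∧
    ∀ a b c : A, (c : Linfty μ) = a * b → φ c = φ a * φ b

/-- `HA(F, P, n, δ, d)`: the pairs `(σ, φ)` with `σ ∈ GA(F, n, δ, d)` and `φ` a unital homomorphism
from the span of `P_{(F ∪ F^* ∪ {e})^n}` to `ℂ^d = diag(M_d)` such that `|tr (φ(p)) - μ(p)| < δ` for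
`p ∈ P_{(F ∪ F^* ∪ {e})^n}` and `‖φ(α_s(p)) - Ad σ_s (φ(p))‖_2 < δ` for `p ∈ P` and
`s ∈ (F ∪ F^* ∪ {e})^n`. In the last condition `a` stands for `p` and `b` for `α_s(p)`. -/
def HA (F : Finset G) (P : Finset (Linfty μ)) (n : ℕ) (δ : ℝ) (d : ℕ) :
    Set ((G → Equiv.Perm (Fin d)) × (domHA F P n →ₗ[ℂ] (Fin d → ℂ))) :=
  {x | x.1 ∈ GA F n δ d ∧ IsUnitalHom x.2 ∧
    (∀ a : domHA F P n, (a : Linfty μ) ∈ translates P (window F n) →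
      ‖tr (Matrix.diagonal (x.2 a)) - ∫ y, ((a : Linfty μ) : X →ₘ[μ] ℂ) y ∂μ‖ < δ) ∧
    (∀ s ∈ window F n, ∀ a b : domHA F P n, (a : Linfty μ) ∈ P →
      (b : Linfty μ) = act s (a : Linfty μ) →
      norm2 (Matrix.diagonal (x.2 b) -
        permMat (x.1 s) * Matrix.diagonal (x.2 a) * (permMat (x.1 s)).conjTranspose) < δ)}

/-- `|HA(F, P, n, δ, d)|_{E,Q}`: the number of pairs of restrictions of `σ` to `E` and of `φ` to the
members of `Q` in its domain, where `(σ, φ) ∈ HA(F, P, n, δ, d)`. -/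
noncomputable def cardHA (E : Finset G) (Q : Finset (Linfty μ)) (F : Finset G)
    (P : Finset (Linfty μ)) (n : ℕ) (δ : ℝ) (d : ℕ) : ℕ∞ :=
  ((fun x : (G → Equiv.Perm (Fin d)) × (domHA F P n →ₗ[ℂ] (Fin d → ℂ)) =>
      ((fun s : E => x.1 s), (fun a : {a : domHA F P n // (a : Linfty μ) ∈ Q} => x.2 a)))
    '' HA F P n δ d).encard

/-- `s_{E,Q}(F, P)`, or its lower variant, according to the choice of `lim`. -/
noncomputable def sAct (lim : (ℕ → EReal) → EReal) (E : Finset G) (Q : Finset (Linfty μ))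
    (F : Finset G) (P : Finset (Linfty μ)) : EReal :=
  ⨅ (n : ℕ) (_ : 1 ≤ n), ⨅ (δ : ℝ) (_ : 0 < δ), lim (rate (cardHA E Q F P n δ))

/-- `sup_E sup_Q inf_F inf_P s_{E,Q}(F, P)`, with `E` and `F` running over the finite subsets of `Ω`
and `Q` and `P` over the finite partitions of unity in `M` consisting of projections. -/
noncomputable def supInf (lim : (ℕ → EReal) → EReal) (Ω : Set G)
    (M : StarSubalgebra ℂ (Linfty μ)) : EReal :=
  ⨆ (E : Finset G) (_ : (E : Set G) ⊆ Ω),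
    ⨆ (Q : Finset (Linfty μ)) (_ : IsProjPartition Q ∧ ∀ q ∈ Q, q ∈ M),
      ⨅ (F : Finset G) (_ : (F : Set G) ⊆ Ω),
        ⨅ (P : Finset (Linfty μ)) (_ : IsProjPartition P ∧ ∀ p ∈ P, p ∈ M),
          sAct lim E Q F P

end Actions

end SoficDim

/-! Both sides of each formula are growth rates on the scale `d log d`. On this scale a factor `C ^
d` is invisible, and a free choice of values at `κ d` vertices costs about `κ`. So it is enough to
pass between the two kinds of approximations in such a way that the object obtained determines the
relevant restriction of the original one, away from few vertices, up to a bounded number of choices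
per vertex.

The passage goes through a third object, `IsModel`: permutations `σ g` of `d` vertices which are
almost multiplicative and almost free, together with sample points `x v` of `X` which are almost
equidistributed and almost equivariant, as tested by finitely many group elements and measurable
sets.

A model gives a homomorphism to `ℂ^d` by evaluating functions at the sample points
(`exists_mem_HA_of_isModel`), and a linear map on `[I_{G,X}]` by letting the arrow `(g, x v)` move
`v` to `σ g v` (`exists_mem_SA_of_isModel`). Sample points are kept in a prescribed conull set, so
that almost everywhere identities hold exactly at them. Conversely, a pair in `HA` labels each
vertex by an atom of a finite-dimensional algebra, and a point chosen in that atom serves as sample,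
provided that the tests are approximable by sets determined by translates of the partition
(`exists_isModel_of_mem_HA`). That is where dynamical generation enters, through
`exists_approximable`. An element of `SA` gives `σ` through the images of the group elements and `x`
through the diagonals of the images of unit bisections (`exists_isModel_of_mem_SA`).

For the counts, going from `HA` to `SA` keeps `σ`, so `σ` on `E` can be recovered from the images of
the group elements in `E` up to few vertices, and the values on `Q` are zero or one
(`exists_sAct_le`). In the other direction, all arrows of a given `w` outside a set of small measure
lie over a finite set `K₁`, so the image of `w` kills almost every vertex `v` or moves it to some `σ
g v` with `g ∈ K₁`, and `σ g` is nearly a word in the permutations of a generating set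
(`exists_cardSA_rate_le`). Each comparison loses an arbitrarily small `κ`. The limit superior and
inferior are treated together by means of `IsLimLike`. -/

namespace SoficDim

set_option linter.unusedSectionVars false

/-! ## Counting bad vertices -/

section Counting

open Classical in
/-- The number of elements with property `p`, as a real number. -/
noncomputable def cnt {α : Type*} [Fintype α] (p : α → Prop) : ℝ :=
  ((Finset.univ.filter p).card : ℝ)

variable {α : Type*} [Fintype α]

theorem cnt_nonneg (p : α → Prop) : 0 ≤ cnt p := by unfold cnt; positivity

theorem cnt_mono {p q : α → Prop} (h : ∀ v, p v → q v) : cnt p ≤ cnt q := by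
  classical
  unfold cnt
  exact_mod_cast Finset.card_le_card (Finset.monotone_filter_right _ (fun v _ => h v))

theorem cnt_congr {p q : α → Prop} (h : ∀ v, p v ↔ q v) : cnt p = cnt q :=
  le_antisymm (cnt_mono fun v => (h v).1) (cnt_mono fun v => (h v).2)

theorem cnt_or_le (p q : α → Prop) : cnt (fun v => p v ∨ q v) ≤ cnt p + cnt q := by
  classical
  unfold cnt
  rw [← Nat.cast_add, Nat.cast_le]
  refine le_trans (Finset.card_le_card ?_) (Finset.card_union_le _ _)
  intro v
  simp

theorem cnt_le_of_or {p q r : α → Prop} (h : ∀ v, p v → q v ∨ r v) : cnt p ≤ cnt q + cnt r :=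
  (cnt_mono h).trans (cnt_or_le q r)

theorem cnt_eq_zero {p : α → Prop} (h : ∀ v, ¬ p v) : cnt p = 0 := by
  classical
  unfold cnt
  rw [Finset.filter_eq_empty_iff.2 (fun v _ => h v)]
  simp

theorem cnt_exists_le {ι : Type*} (I : Finset ι) (p : ι → α → Prop) :
    cnt (fun v => ∃ i ∈ I, p i v) ≤ ∑ i ∈ I, cnt (p i) := by
  classical
  induction I using Finset.induction_on with
  | empty => simp [cnt]
  | insert a s ha ih =>
    rw [Finset.sum_insert ha]
    refine (cnt_le_of_or (q := p a) (r := fun v => ∃ i ∈ s, p i v) ?_).trans (by gcongr)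
    rintro v ⟨i, hi, hv⟩
    rcases Finset.mem_insert.1 hi with rfl | hi
    · exact Or.inl hv
    · exact Or.inr ⟨i, hi, hv⟩

theorem cnt_exists_le_mul {ι : Type*} (I : Finset ι) (p : ι → α → Prop) {c : ℝ}
    (h : ∀ i ∈ I, cnt (p i) ≤ c) : cnt (fun v => ∃ i ∈ I, p i v) ≤ I.card * c := by
  refine (cnt_exists_le I p).trans ((Finset.sum_le_sum h).trans ?_)
  simp

theorem cnt_perm (σ : Equiv.Perm α) (p : α → Prop) : cnt (fun v => p (σ v)) = cnt p := by
  classical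
  unfold cnt
  congr 1
  refine Finset.card_bij (fun v _ => σ v) (by simp) (fun a _ b _ h => σ.injective h) ?_
  intro b hb
  exact ⟨σ.symm b, by simpa using hb, by simp⟩

/-- A partial bijection is injective where it is defined, so pulling a bad set back along it cannot
enlarge the set. With `cnt_perm` this moves error estimates from the image of a vertex to the
vertex. -/
theorem cnt_pequiv_le (f : α ≃. α) (p : α → Prop) :
    cnt (fun v => ∃ u, f v = some u ∧ p u) ≤ cnt p := by
  classical
  unfold cnt
  norm_cast
  have hf : ∀ v ∈ Finset.univ.filter (fun v => ∃ u, f v = some u ∧ p u),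
      ∃ u, f v = some u ∧ p u := fun v hv => (Finset.mem_filter.1 hv).2
  refine Finset.card_le_card_of_injOn (fun v => if h : ∃ u, f v = some u ∧ p u then h.choose else v)
    ?_ ?_
  · intro v hv
    have h := hf v (by simpa using hv)
    simp only [dif_pos h]
    simpa using h.choose_spec.2
  · intro v hv w hw hvw
    have h := hf v (by simpa using hv)
    have h' := hf w (by simpa using hw)
    simp only [dif_pos h, dif_pos h'] at hvw
    have e := h.choose_spec.1
    have e' := h'.choose_spec.1
    rw [hvw] at e
    exact PEquiv.inj f e e'

theorem cnt_not_add (p : α → Prop) : cnt (fun v => ¬ p v) + cnt p = Fintype.card α := by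
  classical
  unfold cnt
  have := Finset.card_filter_add_card_filter_not (s := (Finset.univ : Finset α)) p
  rw [Finset.card_univ] at this
  rw [← this]
  push_cast
  rw [add_comm]
  congr!

theorem sum_ite_cnt (p : α → Prop) [DecidablePred p] :
    ∑ v, (if p v then (1 : ℝ) else 0) = cnt p := by
  classical
  unfold cnt
  rw [Finset.sum_boole]
  congr!

theorem abs_cnt_sub_le {p q r : α → Prop} (h : ∀ v, ¬ r v → (p v ↔ q v)) :
    |cnt p - cnt q| ≤ cnt r := by
  have h1 : cnt p ≤ cnt q + cnt r := cnt_le_of_or fun v hv => by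
    by_cases hr : r v
    · exact Or.inr hr
    · exact Or.inl ((h v hr).1 hv)
  have h2 : cnt q ≤ cnt p + cnt r := cnt_le_of_or fun v hv => by
    by_cases hr : r v
    · exact Or.inr hr
    · exact Or.inl ((h v hr).2 hv)
  rw [abs_le]
  constructor <;> linarith

/-- An upper bound for the number of maps on `d` points that take their values in prescribed sets
of size `L`, except on at most `κ d` points. -/
noncomputable def hamBound (L : ℕ) (κ : ℝ) (d : ℕ) : ℕ :=
  2 ^ d * (L ^ d * (d + 1) ^ ⌊κ * d⌋₊)

/-- Choose the exceptional set first, in at most `2 ^ d` ways. Off it each value has at most `L`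
possibilities, on it at most `d + 1`. The bound `d + 1` covers values in `Fin d` and in `Option (Fin
d)`. -/
theorem encard_near_le {β : Type*} [Fintype β] {d L : ℕ} (hL : 1 ≤ L) (κ : ℝ)
    (hβ : Fintype.card β ≤ d + 1) (S : Fin d → Finset β) (hS : ∀ v, (S v).card ≤ L) :
    {f : Fin d → β | cnt (fun v => f v ∉ S v) ≤ κ * d}.encard ≤ hamBound L κ d := by
  classical
  let I : Finset (Finset (Fin d)) :=
    (Finset.univ : Finset (Finset (Fin d))).filter (fun B => (B.card : ℝ) ≤ κ * d)
  let U : Finset (Fin d → β) := I.biUnion fun B =>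
    Fintype.piFinset fun v => if v ∈ B then Finset.univ else S v
  have hsub : {f : Fin d → β | cnt (fun v => f v ∉ S v) ≤ κ * d} ⊆ (U : Set (Fin d → β)) := by
    intro f hf
    have hf' : cnt (fun v => f v ∉ S v) ≤ κ * d := hf
    simp only [U, Finset.coe_biUnion, Set.mem_iUnion]
    refine ⟨Finset.univ.filter (fun v => f v ∉ S v), ?_, ?_⟩
    · refine Finset.mem_coe.2 (Finset.mem_filter.2 ⟨Finset.mem_univ _, ?_⟩)
      unfold cnt at hf'
      convert hf'
    · simp only [Finset.mem_coe, Fintype.mem_piFinset]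
      intro v
      by_cases h : f v ∈ S v <;> simp [h]
  refine (Set.encard_le_encard hsub).trans ?_
  rw [Set.encard_coe_eq_coe_finsetCard]
  have h1 : U.card ≤ hamBound L κ d := by
    refine Finset.card_biUnion_le.trans ?_
    have h2 : ∀ B ∈ I, (Fintype.piFinset fun v => if v ∈ B then Finset.univ else S v).card ≤
        L ^ d * (d + 1) ^ ⌊κ * d⌋₊ := by
      intro B hB
      rw [Fintype.card_piFinset]
      have h3 : ∀ v : Fin d, (if v ∈ B then (Finset.univ : Finset β) else S v).card ≤
          L * (if v ∈ B then d + 1 else 1) := by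
        intro v
        by_cases h : v ∈ B
        · simp only [h, if_true, Finset.card_univ]
          nlinarith
        · simpa [h] using hS v
      refine (Finset.prod_le_prod' fun v _ => h3 v).trans ?_
      rw [Finset.prod_mul_distrib, Finset.prod_ite]
      simp only [Finset.prod_const, Finset.card_univ, Fintype.card_fin, one_pow, mul_one]
      gcongr
      · omega
      · have hB' : (B.card : ℝ) ≤ κ * d := by simpa [I] using hB
        simpa using Nat.le_floor hB'
    refine (Finset.sum_le_card_nsmul _ _ _ h2).trans ?_
    unfold hamBound
    rw [smul_eq_mul]
    gcongr
    refine (Finset.card_le_univ _).trans ?_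
    simp
  exact_mod_cast h1

/-- The common scheme of both count comparisons: every `s` is close to some `t`, and few `s` are
close to a given `t`. The relation need not be a map. If `T` is infinite, `N ≠ 0` makes the right
side infinite. -/
theorem encard_le_mul_of_rel {A B : Type*} {S : Set A} {T : Set B} (R : B → A → Prop) {N : ℕ}
    (hN : N ≠ 0) (h1 : ∀ s ∈ S, ∃ t ∈ T, R t s) (h2 : ∀ t ∈ T, {s | R t s}.encard ≤ N) :
    S.encard ≤ T.encard * N := by
  by_cases hT : T.Finite
  · lift T to Finset B using hT
    have hsub : S ⊆ ⋃ t ∈ T, {s | R t s} := by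
      intro s hs
      obtain ⟨t, ht, hR⟩ := h1 s hs
      exact Set.mem_iUnion₂.2 ⟨t, ht, hR⟩
    refine (Set.encard_le_encard hsub).trans ?_
    clear hsub h1
    classical
    induction T using Finset.induction_on with
    | empty => simp
    | insert a s ha ih =>
      rw [Finset.set_biUnion_insert]
      refine (Set.encard_union_le _ _).trans ?_
      rw [Finset.coe_insert, Set.encard_insert_of_notMem (by simpa using ha), add_mul, one_mul,
        add_comm]
      gcongr
      · exact ih fun t ht => h2 t (by simp only [Finset.coe_insert]; exact Or.inr ht)
      · exact h2 a (by simp)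
  · rw [Set.not_finite.1 hT |>.encard_eq, ENat.top_mul (by exact_mod_cast hN)]
    exact le_top

theorem encard_pi_le {ι : Type*} [Fintype ι] {β : ι → Type*} (S : ∀ i, Set (β i)) {N : ℕ}
    (h : ∀ i, (S i).encard ≤ N) : (Set.univ.pi S).encard ≤ (N ^ Fintype.card ι : ℕ) := by
  classical
  have hfin : ∀ i, (S i).Finite := fun i => Set.finite_of_encard_le_coe (h i)
  have e : Set.univ.pi S = (Fintype.piFinset fun i => (hfin i).toFinset : Finset _) := by
    ext f; simp
  rw [e, Set.encard_coe_eq_coe_finsetCard, Fintype.card_piFinset]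
  norm_cast
  calc ∏ i, (hfin i).toFinset.card ≤ ∏ _i : ι, N := by
        refine Finset.prod_le_prod' fun i _ => ?_
        have := h i
        rw [(hfin i).encard_eq_coe_toFinset_card] at this
        exact_mod_cast this
    _ = _ := by simp

end Counting

/-! ## Growth rates -/

section Rates

theorem hamBound_pos {L : ℕ} (hL : 1 ≤ L) (κ : ℝ) (d : ℕ) : 0 < hamBound L κ d := by
  unfold hamBound; positivity

/-- The factors `2 ^ d`, `L ^ d` and `2 ^ (d * j)` have logarithms linear in `d` and are eventually
absorbed by `κ / 2`. The exceptional vertices contribute `k κ' d log (d + 1)`, and `log (d + 1) ≤ 2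
log d` together with the factor `4` keeps this below the other half. -/
theorem eventually_log_hamBound_le {L : ℕ} (hL : 1 ≤ L) (k j : ℕ) {κ κ' : ℝ} (hκ : 0 < κ)
    (hκ' : 0 ≤ κ') (h : 4 * k * κ' ≤ κ) :
    ∀ᶠ d : ℕ in atTop, Real.log ((hamBound L κ' d ^ k * 2 ^ (d * j) : ℕ) : ℝ) ≤
      κ * (d * Real.log d) := by
  have hlog : Tendsto (fun d : ℕ => Real.log d) atTop atTop :=
    Real.tendsto_log_atTop.comp tendsto_natCast_atTop_atTop
  filter_upwards [hlog.eventually_ge_atTop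
    ((k * (Real.log 2 + Real.log L) + j * Real.log 2) / (κ / 2)), eventually_ge_atTop 2]
    with d hd hd2
  have hd2' : (2 : ℝ) ≤ d := by exact_mod_cast hd2
  have hL' : (1 : ℝ) ≤ L := by exact_mod_cast hL
  rw [div_le_iff₀ (by positivity)] at hd
  have e : Real.log ((hamBound L κ' d ^ k * 2 ^ (d * j) : ℕ) : ℝ) =
      k * (d * Real.log 2 + (d * Real.log L + ⌊κ' * d⌋₊ * Real.log (d + 1))) +
        d * j * Real.log 2 := by
    unfold hamBound
    push_cast
    rw [Real.log_mul (by positivity) (by positivity), Real.log_pow, Real.log_mul (by positivity)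
      (by positivity), Real.log_mul (by positivity) (by positivity), Real.log_pow, Real.log_pow,
      Real.log_pow, Real.log_pow]
    push_cast
    ring
  rw [e]
  have h1 : Real.log (d + 1) ≤ 2 * Real.log d := by
    rw [← Real.log_rpow (by positivity)]
    apply Real.log_le_log (by positivity)
    norm_num
    nlinarith
  have h0 : 0 ≤ Real.log d := Real.log_nonneg (by linarith)
  have h2 : (⌊κ' * d⌋₊ : ℝ) * Real.log (d + 1) ≤ κ' * d * (2 * Real.log d) :=
    mul_le_mul (Nat.floor_le (by positivity)) h1 (Real.log_nonneg (by linarith)) (by positivity)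
  have h3 : k * (⌊κ' * d⌋₊ * Real.log (d + 1)) ≤ κ / 2 * (d * Real.log d) := by
    calc k * (⌊κ' * d⌋₊ * Real.log (d + 1)) ≤ k * (κ' * d * (2 * Real.log d)) := by gcongr
      _ = (4 * k * κ') / 2 * (d * Real.log d) := by ring
      _ ≤ _ := by gcongr
  have h4 : d * (k * (Real.log 2 + Real.log L) + j * Real.log 2) ≤ d * (Real.log d * (κ / 2)) := by
    gcongr
  linarith

/-- Turns a multiplicative comparison of counts into an additive comparison of rates. Only `N` is
required to be finite and nonzero; the counts themselves may be zero or infinite. -/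
theorem rate_le_rate_add {N : ℕ → ℕ} {c₁ c₂ : ℕ → ℕ∞} {κ : ℝ}
    (h : ∀ᶠ d in atTop, c₁ d ≤ c₂ d * N d) (hN0 : ∀ᶠ d in atTop, N d ≠ 0)
    (hN : ∀ᶠ d : ℕ in atTop, Real.log (N d) ≤ κ * (d * Real.log d)) :
    ∀ᶠ d in atTop, rate c₁ d ≤ rate c₂ d + (κ : ℝ) := by
  filter_upwards [h, hN0, hN, eventually_ge_atTop 2] with d h1 h2 h3 h4
  have hd : (2 : ℝ) ≤ d := by exact_mod_cast h4
  have hlog : 0 < Real.log d := Real.log_pos (by linarith)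
  have hpos : 0 < (d : ℝ) * Real.log d := by positivity
  unfold rate
  have hc : (c₁ d : ℝ≥0∞) ≤ (c₂ d : ℝ≥0∞) * (N d : ℝ≥0∞) := by
    have := ENat.toENNReal_le.2 h1
    simpa using this
  have hlogc := ENNReal.log_monotone hc
  rw [ENNReal.log_mul_add] at hlogc
  have hNlog : ENNReal.log (N d : ℝ≥0∞) = (Real.log (N d) : ℝ) := by
    have hN' : (0 : ℝ) < N d := by exact_mod_cast Nat.pos_of_ne_zero h2
    rw [← ENNReal.log_ofReal_of_pos hN', ENNReal.ofReal_natCast]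
  rw [hNlog] at hlogc
  have hpos' : (0 : EReal) ≤ ((d * Real.log d : ℝ) : EReal) := by exact_mod_cast hpos.le
  refine (EReal.div_le_div_right_of_nonneg hpos' hlogc).trans ?_
  rw [EReal.add_div_of_nonneg_right hpos']
  gcongr
  rw [← EReal.coe_div, EReal.coe_le_coe_iff, div_le_iff₀ hpos]
  exact h3

/-- Functionals on sequences that behave like a limit for comparison up to small constants. -/
def IsLimLike (lim : (ℕ → EReal) → EReal) : Prop :=
  ∀ (u v : ℕ → EReal) (κ : ℝ), (∀ᶠ d in atTop, u d ≤ v d + (κ : ℝ)) → lim u ≤ lim v + (κ : ℝ)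

theorem isLimLike_upperLim : IsLimLike upperLim := by
  intro u v κ h
  refine (limsup_le_limsup h).trans ?_
  refine (EReal.limsup_add_le (Or.inr ?_) (Or.inr ?_)).trans ?_ <;> simp [upperLim]

/-- A lower limit of a sum is at most the upper limit of one summand plus the lower limit of the
other; here the former is the constant `κ`. -/
theorem isLimLike_lowerLim : IsLimLike lowerLim := by
  intro u v κ h
  refine (liminf_le_liminf h).trans ?_
  have := EReal.liminf_add_le (f := atTop) (u := fun _ : ℕ => ((κ : ℝ) : EReal)) (v := v)
    (Or.inl (by simp)) (Or.inl (by simp))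
  rw [limsup_const] at this
  rw [lowerLim, add_comm]
  refine le_trans (le_of_eq ?_) this
  congr 1
  ext d
  exact add_comm _ _

theorem le_of_forall_le_add_pos {a b : EReal} (h : ∀ κ : ℝ, 0 < κ → a ≤ b + (κ : ℝ)) : a ≤ b := by
  induction b with
  | bot => simpa using h 1 one_pos
  | top => exact le_top
  | coe b =>
    induction a with
    | bot => exact bot_le
    | top =>
      have := h 1 one_pos
      rw [← EReal.coe_add] at this
      exact absurd (top_le_iff.1 this) (EReal.coe_ne_top _)
    | coe a =>
      rw [EReal.coe_le_coe_iff]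
      refine le_of_forall_pos_le_add fun κ hκ => ?_
      have := h κ hκ
      rw [← EReal.coe_add, EReal.coe_le_coe_iff] at this
      exact this

end Rates

/-! ## Partial permutation matrices -/

section PartialPerm

variable {d : ℕ}

/-- The partial permutation matrix of `f`, sending `ξ_j` to `ξ_{f j}` when `f j` is defined. -/
def pmat (f : Fin d ≃. Fin d) : Matrix (Fin d) (Fin d) ℂ := f.symm.toMatrix

theorem pmat_apply (f : Fin d ≃. Fin d) (i j : Fin d) :
    pmat f i j = if f j = some i then 1 else 0 := by
  unfold pmat
  rw [PEquiv.toMatrix_apply]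
  congr 1
  rw [PEquiv.mem_iff_mem f]
  rfl

theorem pmat_mul (f g : Fin d ≃. Fin d) : pmat f * pmat g = pmat (g.trans f) := by
  unfold pmat
  rw [← PEquiv.toMatrix_trans, PEquiv.symm_trans_rev]

theorem mem_partialPerms {A : Matrix (Fin d) (Fin d) ℂ} :
    A ∈ partialPerms d ↔ ∃ f : Fin d ≃. Fin d, A = pmat f := by
  constructor
  · rintro ⟨f, rfl⟩
    exact ⟨f.symm, by simp [pmat]⟩
  · rintro ⟨f, rfl⟩
    exact ⟨f.symm, rfl⟩

theorem permMat_eq_pmat (σ : Equiv.Perm (Fin d)) : permMat σ = pmat σ.toPEquiv := by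
  unfold permMat pmat
  rfl

theorem norm2_sq (A : Matrix (Fin d) (Fin d) ℂ) :
    norm2 A ^ 2 = (∑ j, ∑ i, ‖A i j‖ ^ 2) / d := by
  have h : (tr (A.conjTranspose * A)).re = (∑ j, ∑ i, ‖A i j‖ ^ 2) / d := by
    unfold tr
    rw [Complex.div_natCast_re, Matrix.trace]
    congr 1
    rw [Complex.re_sum]
    refine Finset.sum_congr rfl fun j _ => ?_
    simp only [Matrix.diag, Matrix.mul_apply, Matrix.conjTranspose_apply]
    rw [Complex.re_sum]
    refine Finset.sum_congr rfl fun i _ => ?_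
    simp [Complex.mul_re, ← Complex.normSq_eq_norm_sq, Complex.normSq_apply]
  unfold norm2
  rw [Real.sq_sqrt, h]
  rw [h]
  positivity

theorem norm2_nonneg (A : Matrix (Fin d) (Fin d) ℂ) : 0 ≤ norm2 A := Real.sqrt_nonneg _

theorem norm2_lt_of_sq {A : Matrix (Fin d) (Fin d) ℂ} {δ : ℝ} (hδ : 0 < δ)
    (h : norm2 A ^ 2 < δ ^ 2) : norm2 A < δ :=
  lt_of_pow_lt_pow_left₀ 2 hδ.le h

theorem sum_pmat_sub_le (f g : Fin d ≃. Fin d) (j : Fin d) :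
    ∑ i, ‖(pmat f - pmat g) i j‖ ^ 2 ≤ if f j ≠ g j then 2 else 0 := by
  by_cases h : f j = g j
  · simp [pmat_apply, h]
  · simp only [h, ne_eq, not_false_eq_true, if_true, Matrix.sub_apply, pmat_apply]
    have : ∀ i, ‖(if f j = some i then (1 : ℂ) else 0) - (if g j = some i then 1 else 0)‖ ^ 2 ≤
        (if f j = some i then (1 : ℝ) else 0) + (if g j = some i then 1 else 0) := by
      intro i
      split_ifs <;> simp
    refine (Finset.sum_le_sum fun i _ => this i).trans ?_
    rw [Finset.sum_add_distrib]
    have h1 : ∀ o : Option (Fin d), ∑ i, (if o = some i then (1 : ℝ) else 0) ≤ 1 := by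
      intro o
      cases o <;> simp
    linarith [h1 (f j), h1 (g j)]

theorem le_sum_pmat_sub (f g : Fin d ≃. Fin d) (j : Fin d) :
    (if f j ≠ g j then 1 else 0) ≤ ∑ i, ‖(pmat f - pmat g) i j‖ ^ 2 := by
  by_cases h : f j = g j
  · simp only [h, ne_eq, not_true_eq_false, if_false]
    positivity
  · simp only [h, ne_eq, not_false_eq_true, if_true]
    obtain ⟨i, hi⟩ : ∃ i, ¬ (f j = some i ↔ g j = some i) := by
      by_contra hcon
      push Not at hcon
      exact h (Option.ext fun i => hcon i)
    refine le_trans ?_ (Finset.single_le_sum (f := fun i => ‖(pmat f - pmat g) i j‖ ^ 2)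
      (fun i _ => by positivity) (Finset.mem_univ i))
    simp only [Matrix.sub_apply, pmat_apply]
    by_cases h1 : f j = some i <;> by_cases h2 : g j = some i <;> simp_all

/-- A column where `f` and `g` disagree contributes one or two to the sum of squared entries of the
difference, any other column nothing. Thus the squared `2`-norm and the normalized Hamming distance
agree up to a factor of two, and norm conditions become counts of bad vertices. -/
theorem cnt_ne_le_norm2 (hd : 0 < d) (f g : Fin d ≃. Fin d) :
    cnt (fun v => f v ≠ g v) ≤ norm2 (pmat f - pmat g) ^ 2 * d := by
  classical
  have hd' : (0 : ℝ) < d := by exact_mod_cast hd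
  rw [norm2_sq, div_mul_cancel₀ _ hd'.ne', ← sum_ite_cnt]
  refine Finset.sum_le_sum fun j _ => ?_
  convert le_sum_pmat_sub f g j

theorem norm2_le_cnt_ne (f g : Fin d ≃. Fin d) :
    norm2 (pmat f - pmat g) ^ 2 ≤ 2 * cnt (fun v => f v ≠ g v) / d := by
  classical
  rw [norm2_sq]
  gcongr
  rw [← sum_ite_cnt, Finset.mul_sum]
  refine Finset.sum_le_sum fun j _ => ?_
  refine (sum_pmat_sub_le f g j).trans (le_of_eq ?_)
  by_cases h : f j = g j <;> simp [h]

theorem tr_pmat (f : Fin d ≃. Fin d) : tr (pmat f) = ((cnt (fun v => f v = some v) / d : ℝ) : ℂ) := by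
  classical
  unfold tr
  rw [Matrix.trace]
  simp only [Matrix.diag, pmat_apply]
  rw [← sum_ite_cnt]
  push_cast
  congr 1
  refine Finset.sum_congr rfl fun i _ => ?_
  split_ifs <;> simp

theorem perm_ne_iff (σ τ : Equiv.Perm (Fin d)) (v : Fin d) :
    σ.toPEquiv v ≠ τ.toPEquiv v ↔ σ v ≠ τ v := by
  simp [Equiv.toPEquiv_apply]

theorem norm2_diagonal_sub (a b : Fin d → ℂ) :
    norm2 (Matrix.diagonal a - Matrix.diagonal b) ^ 2 = (∑ v, ‖a v - b v‖ ^ 2) / d := by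
  rw [norm2_sq]
  congr 1
  refine Finset.sum_congr rfl fun j _ => ?_
  rw [Finset.sum_eq_single j]
  · simp
  · intro i _ hij
    simp [Matrix.diagonal_apply_ne _ hij]
  · simp

theorem permMat_conj_diagonal (σ : Equiv.Perm (Fin d)) (a : Fin d → ℂ) :
    permMat σ * Matrix.diagonal a * (permMat σ).conjTranspose =
      Matrix.diagonal (fun v => a (σ⁻¹ v)) := by
  ext i j
  rw [Matrix.mul_apply]
  simp only [Matrix.mul_diagonal, Matrix.conjTranspose_apply, permMat_eq_pmat, pmat_apply,
    Equiv.toPEquiv_apply, Option.some.injEq]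
  have : ∀ k, σ k = i ↔ σ⁻¹ i = k := fun k => by
    rw [Equiv.Perm.inv_eq_iff_eq, eq_comm]
  simp only [this]
  rw [Finset.sum_eq_single (σ⁻¹ i)]
  · by_cases h : i = j
    · subst h; simp
    · have : ¬ (σ (σ⁻¹ i) = j) := by simpa using h
      rw [Matrix.diagonal_apply_ne _ h]
      rw [if_pos rfl, if_neg this]
      simp
  · intro k _ hk
    rw [if_neg (Ne.symm hk)]
    simp
  · simp

theorem tr_diagonal (a : Fin d → ℂ) : tr (Matrix.diagonal a) = (∑ v, a v) / d := by
  unfold tr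
  rw [Matrix.trace_diagonal]

end PartialPerm


/-! ## Linear liftings -/

section Lifting

variable {α : Type*} [MeasurableSpace α]

/-- Fix representatives of the members of a Hamel basis and extend linearly. This allows linear
evaluation of classes of functions at individual sample points. The lift is not multiplicative, but
any countable family of algebraic relations holds pointwise on a conull set, and sample points are
taken from there. -/
theorem exists_linear_lift (ν : Measure α) :
    ∃ ℓ : (α →ₘ[ν] ℂ) →ₗ[ℂ] (α → ℂ), ∀ f : α →ₘ[ν] ℂ, ℓ f =ᵐ[ν] f := by
  let b := Module.Basis.ofVectorSpace ℂ (α →ₘ[ν] ℂ)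
  refine ⟨b.constr ℂ (fun i => ((b i : α →ₘ[ν] ℂ) : α → ℂ)), fun f => ?_⟩
  have hf : f ∈ Submodule.span ℂ (Set.range b) := by rw [b.span_eq]; trivial
  induction hf using Submodule.span_induction with
  | mem x hx =>
    obtain ⟨i, rfl⟩ := hx
    rw [b.constr_basis]
  | zero =>
    rw [map_zero]
    exact (AEEqFun.coeFn_zero (α := α) (β := ℂ) (μ := ν)).symm
  | add x y _ _ hx hy =>
    rw [map_add]
    filter_upwards [hx, hy, AEEqFun.coeFn_add x y] with a h1 h2 h3
    rw [h3, Pi.add_apply, Pi.add_apply, h1, h2]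
  | smul c x _ hx =>
    rw [map_smul]
    filter_upwards [hx, AEEqFun.coeFn_smul c x] with a h1 h2
    rw [h2, Pi.smul_apply, Pi.smul_apply, h1]

/-- A linear choice of representatives of classes of functions. -/
noncomputable def lift (ν : Measure α) : (α →ₘ[ν] ℂ) →ₗ[ℂ] (α → ℂ) := (exists_linear_lift ν).choose

theorem lift_ae (ν : Measure α) (f : α →ₘ[ν] ℂ) : lift ν f =ᵐ[ν] f := (exists_linear_lift ν).choose_spec f

end Lifting

/-! ## Projections in `L^∞` -/

section Projections

variable {X : Type*} [MeasurableSpace X] {μ : Measure X}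

/-- The set where a function takes the value one. -/
def pset (f : Linfty μ) : Set X := {x | (f : X →ₘ[μ] ℂ) x = 1}

theorem measurableSet_pset (f : Linfty μ) : MeasurableSet (pset f) :=
  (f : X →ₘ[μ] ℂ).stronglyMeasurable.measurable (measurableSet_singleton (1 : ℂ))

theorem coe_mul_ae (a b : Linfty μ) :
    ∀ᵐ x ∂μ, ((a * b : Linfty μ) : X →ₘ[μ] ℂ) x = (a : X →ₘ[μ] ℂ) x * (b : X →ₘ[μ] ℂ) x := by
  filter_upwards [AEEqFun.coeFn_mul (a : X →ₘ[μ] ℂ) (b : X →ₘ[μ] ℂ)] with x hx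
  exact hx

theorem coe_one_ae : ∀ᵐ x ∂μ, ((1 : Linfty μ) : X →ₘ[μ] ℂ) x = 1 := by
  filter_upwards [AEEqFun.coeFn_one (α := X) (β := ℂ) (μ := μ)] with x hx
  exact hx

theorem coe_sub_ae (a b : Linfty μ) :
    ∀ᵐ x ∂μ, ((a - b : Linfty μ) : X →ₘ[μ] ℂ) x = (a : X →ₘ[μ] ℂ) x - (b : X →ₘ[μ] ℂ) x := by
  filter_upwards [AEEqFun.coeFn_sub (a : X →ₘ[μ] ℂ) (b : X →ₘ[μ] ℂ)] with x hx
  exact hx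

theorem linfty_ext {a b : Linfty μ} (h : ∀ᵐ x ∂μ, (a : X →ₘ[μ] ℂ) x = (b : X →ₘ[μ] ℂ) x) : a = b :=
  Subtype.ext (AEEqFun.ext h)

theorem coe_prod_ae {ι : Type*} (I : Finset ι) (f : ι → Linfty μ) :
    ∀ᵐ x ∂μ, ((∏ i ∈ I, f i : Linfty μ) : X →ₘ[μ] ℂ) x = ∏ i ∈ I, (f i : X →ₘ[μ] ℂ) x := by
  classical
  induction I using Finset.induction_on with
  | empty => simpa using coe_one_ae
  | insert a s ha ih =>
    filter_upwards [ih, coe_mul_ae (f a) (∏ i ∈ s, f i)] with x h1 h2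
    rw [Finset.prod_insert ha, Finset.prod_insert ha, h2, h1]

theorem proj_ae {p : Linfty μ} (hp : p * p = p) :
    ∀ᵐ x ∂μ, (p : X →ₘ[μ] ℂ) x = (pset p).indicator (fun _ => (1 : ℂ)) x := by
  filter_upwards [coe_mul_ae p p] with x hx
  rw [hp] at hx
  by_cases h : x ∈ pset p
  · rw [Set.indicator_of_mem h]; exact h
  · rw [Set.indicator_of_notMem h]
    have h1 : (p : X →ₘ[μ] ℂ) x ≠ 1 := h
    have : (p : X →ₘ[μ] ℂ) x * ((p : X →ₘ[μ] ℂ) x - 1) = 0 := by rw [mul_sub, ← hx]; ring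
    rcases mul_eq_zero.1 this with h0 | h0
    · exact h0
    · exact absurd (sub_eq_zero.1 h0) h1

theorem integral_proj {p : Linfty μ} (hp : p * p = p) :
    ∫ x, (p : X →ₘ[μ] ℂ) x ∂μ = (μ.real (pset p) : ℂ) := by
  rw [integral_congr_ae (proj_ae hp), integral_indicator (measurableSet_pset p)]
  simp

/-- The characteristic function of a measurable set. -/
noncomputable def ind (μ : Measure X) {A : Set X} (hA : MeasurableSet A) : Linfty μ :=
  ⟨AEEqFun.mk (A.indicator fun _ => (1 : ℂ))
    (stronglyMeasurable_const.indicator hA).aestronglyMeasurable, by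
    have h : MemLp (fun _ : X => (1 : ℂ)) ∞ μ := memLp_top_const 1
    exact (h.indicator hA).ae_eq (AEEqFun.coeFn_mk _ _).symm⟩

theorem ind_ae {A : Set X} (hA : MeasurableSet A) :
    ∀ᵐ x ∂μ, (ind μ hA : X →ₘ[μ] ℂ) x = A.indicator (fun _ => (1 : ℂ)) x :=
  AEEqFun.coeFn_mk _ _

variable {G : Type*} [Group G] [MulAction G X] [MeasurableConstSMul G X]
  [SMulInvariantMeasure G X μ]

theorem act_ae (s : G) (f : Linfty μ) :
    ∀ᵐ x ∂μ, (act s f : X →ₘ[μ] ℂ) x = (f : X →ₘ[μ] ℂ) (s⁻¹ • x) :=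
  (f : X →ₘ[μ] ℂ).coeFn_compMeasurePreserving (measurePreserving_smul s⁻¹ μ)

theorem ae_smul {P : X → Prop} (h : ∀ᵐ x ∂μ, P x) (s : G) : ∀ᵐ x ∂μ, P (s • x) :=
  (measurePreserving_smul s μ).quasiMeasurePreserving.ae h

theorem act_mul (s : G) (a b : Linfty μ) : act s (a * b) = act s a * act s b := by
  apply linfty_ext
  filter_upwards [act_ae s (a * b), coe_mul_ae (act s a) (act s b), act_ae s a, act_ae s b,
    ae_smul (coe_mul_ae a b) s⁻¹] with x h1 h2 h3 h4 h5
  rw [h1, h2, h3, h4, h5]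

theorem act_one (s : G) : act s (1 : Linfty μ) = 1 := by
  apply linfty_ext
  filter_upwards [act_ae s (1 : Linfty μ), coe_one_ae (μ := μ), ae_smul coe_one_ae s⁻¹]
    with x h1 h2 h3
  rw [h1, h2, h3]

theorem act_add (s : G) (a b : Linfty μ) : act s (a + b) = act s a + act s b := by
  apply linfty_ext
  filter_upwards [act_ae s (a + b), AEEqFun.coeFn_add (act s a : X →ₘ[μ] ℂ) (act s b : X →ₘ[μ] ℂ),
    act_ae s a, act_ae s b,
    ae_smul (AEEqFun.coeFn_add (a : X →ₘ[μ] ℂ) (b : X →ₘ[μ] ℂ)) s⁻¹] with x h1 h2 h3 h4 h5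
  change _ = ((act s a : X →ₘ[μ] ℂ) + (act s b : X →ₘ[μ] ℂ)) x
  rw [h1, h2, Pi.add_apply, h3, h4]
  exact h5

theorem act_zero (s : G) : act s (0 : Linfty μ) = 0 := by
  have h := act_add s (0 : Linfty μ) 0
  rwa [add_zero, left_eq_add] at h

theorem act_one_left (f : Linfty μ) : act (1 : G) f = f := by
  apply linfty_ext
  filter_upwards [act_ae (1 : G) f] with x h
  rw [h, inv_one, one_smul]

theorem act_sum (s : G) {ι : Type*} (I : Finset ι) (f : ι → Linfty μ) :
    act s (∑ i ∈ I, f i) = ∑ i ∈ I, act s (f i) := by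
  classical
  induction I using Finset.induction_on with
  | empty => simpa using act_zero s
  | insert a t ha ih => rw [Finset.sum_insert ha, Finset.sum_insert ha, act_add, ih]

end Projections

/-! ## Sections of bisections -/

section Sections

variable {G X : Type*} [Group G] [MulAction G X] [MeasurableSpace X] [MeasurableSpace G]
  [Countable G] [DiscreteMeasurableSpace G] [MeasurableConstSMul G X]
  (μ : Measure X) [IsProbabilityMeasure μ] [SMulInvariantMeasure G X μ]

/-- A representative of an element of the inverse semigroup. -/
noncomputable def rep (w : InvSemigroup G μ) : Bisection G X :=
  Quotient.out (s := bisectionSetoid G μ) w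

/-- The set of sources of the arrows over `g` in an element of the inverse semigroup. -/
def sec (w : InvSemigroup G μ) (g : G) : Set X := {x | (g, x) ∈ (rep μ w).carrier}

variable {μ}

theorem measurableSet_sec (w : InvSemigroup G μ) (g : G) : MeasurableSet (sec μ w g) :=
  (rep μ w).measurable.preimage (measurable_const.prodMk measurable_id)

theorem sec_src_inj {w : InvSemigroup G μ} {g h : G} {x : X} (hg : x ∈ sec μ w g)
    (hh : x ∈ sec μ w h) : g = h := by
  have := (rep μ w).src_inj hg hh rfl
  exact (Prod.mk.inj this).1

theorem sec_rng_inj {w : InvSemigroup G μ} {g h : G} {x y : X} (hg : x ∈ sec μ w g)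
    (hh : y ∈ sec μ w h) (e : g • x = h • y) : g = h ∧ x = y := by
  have := (rep μ w).rng_inj hg hh e
  exact Prod.mk.inj this

theorem sec_mk (B : Bisection G X) :
    ∀ᵐ x ∂μ, ∀ g, x ∈ sec μ (Quotient.mk (bisectionSetoid G μ) B) g ↔ (g, x) ∈ B.carrier :=
  (bisection_rel_iff μ).1 (Quotient.exact (s := bisectionSetoid G μ)
    (Quotient.out_eq (s := bisectionSetoid G μ) (Quotient.mk (bisectionSetoid G μ) B)))

theorem mk_rep (w : InvSemigroup G μ) : Quotient.mk (bisectionSetoid G μ) (rep μ w) = w :=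
  Quotient.out_eq (s := bisectionSetoid G μ) w

theorem invSemigroup_ext {w w' : InvSemigroup G μ}
    (h : ∀ᵐ x ∂μ, ∀ g, x ∈ sec μ w g ↔ x ∈ sec μ w' g) : w = w' := by
  rw [← mk_rep w, ← mk_rep w']
  exact Quotient.sound (s := bisectionSetoid G μ) ((bisection_rel_iff μ).2 h)

theorem sec_mul (w w' : InvSemigroup G μ) :
    ∀ᵐ x ∂μ, ∀ k, x ∈ sec μ (w * w') k ↔
      ∃ h, x ∈ sec μ w' h ∧ h • x ∈ sec μ w (k * h⁻¹) := by
  have e : w * w' = Quotient.mk (bisectionSetoid G μ) ((rep μ w).mul (rep μ w')) := by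
    conv_lhs => rw [← mk_rep w, ← mk_rep w']
    rfl
  rw [e]
  filter_upwards [sec_mk ((rep μ w).mul (rep μ w'))] with x hx k
  rw [hx k]
  constructor
  · rintro ⟨⟨b, y⟩, hb, ⟨c, z⟩, hc, h1, h2⟩
    simp only [src, rng, arrowMul, Prod.mk.injEq] at h1 h2
    obtain ⟨rfl, rfl⟩ := h2
    subst h1
    exact ⟨c, hc, by simpa [sec] using hb⟩
  · rintro ⟨h, hc, hb⟩
    exact ⟨_, hb, _, hc, rfl, by simp [arrowMul]⟩

theorem sec_one : ∀ᵐ x ∂μ, ∀ g, x ∈ sec μ (1 : InvSemigroup G μ) g ↔ g = 1 :=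
  sec_mk Bisection.one

/-- The bisection `{g} × A`. -/
def arrB (g : G) {A : Set X} (hA : MeasurableSet A) : Bisection G X where
  carrier := {g} ×ˢ A
  measurable := (measurableSet_singleton g).prod hA
  src_inj := by
    rintro ⟨a, x⟩ ⟨h1, _⟩ ⟨b, y⟩ ⟨h2, _⟩ e
    simp only [Set.mem_singleton_iff] at h1 h2
    simp only [src] at e
    rw [h1, h2, e]
  rng_inj := by
    rintro ⟨a, x⟩ ⟨h1, _⟩ ⟨b, y⟩ ⟨h2, _⟩ e
    simp only [Set.mem_singleton_iff] at h1 h2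
    subst h1 h2
    simp only [rng, smul_left_cancel_iff] at e
    rw [e]

variable (μ) in
/-- The element of the inverse semigroup given by `{g} × A`. -/
noncomputable def arr (g : G) {A : Set X} (hA : MeasurableSet A) : InvSemigroup G μ :=
  Quotient.mk (bisectionSetoid G μ) (arrB g hA)

theorem sec_arr (g : G) {A : Set X} (hA : MeasurableSet A) :
    ∀ᵐ x ∂μ, ∀ h, x ∈ sec μ (arr μ g hA) h ↔ h = g ∧ x ∈ A := by
  filter_upwards [sec_mk (μ := μ) (arrB g hA)] with x hx h
  rw [arr, hx h]
  simp [arrB]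

theorem arr_mul_arr (g h : G) {A B : Set X} (hA : MeasurableSet A) (hB : MeasurableSet B) :
    arr μ g hA * arr μ h hB =
      arr μ (g * h) (hB.inter (measurable_const_smul h hA) : MeasurableSet (B ∩ (h • ·) ⁻¹' A)) := by
  apply invSemigroup_ext
  filter_upwards [sec_mul (arr μ g hA) (arr μ h hB), sec_arr (μ := μ) h hB,
    ae_smul (sec_arr (μ := μ) g hA) h,
    sec_arr (μ := μ) (g * h) (hB.inter (measurable_const_smul h hA))] with x h1 h2 h3 h4 k
  rw [h1, h4]
  constructor
  · rintro ⟨l, hl, hl'⟩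
    obtain ⟨rfl, hx⟩ := (h2 l).1 hl
    obtain ⟨e, hx'⟩ := (h3 _).1 hl'
    exact ⟨by rw [← e]; group, hx, hx'⟩
  · rintro ⟨rfl, hx, hx'⟩
    exact ⟨h, (h2 h).2 ⟨rfl, hx⟩, (h3 _).2 ⟨by group, hx'⟩⟩

/-- Where `w` lies over `g` it acts as `g`: cutting down to the section turns `w` into a restricted
group element. This is how the image of `w` is later compared with the permutation of `g`. -/
theorem mul_arr_sec (w : InvSemigroup G μ) (g : G) :
    w * arr μ 1 (measurableSet_sec w g) = arr μ g (measurableSet_sec w g) := by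
  apply invSemigroup_ext
  filter_upwards [sec_mul w (arr μ 1 (measurableSet_sec w g)),
    sec_arr (μ := μ) (1 : G) (measurableSet_sec w g),
    sec_arr (μ := μ) g (measurableSet_sec w g)] with x h1 h2 h3 k
  rw [h1, h3]
  constructor
  · rintro ⟨l, hl, hl'⟩
    obtain ⟨rfl, hx⟩ := (h2 l).1 hl
    simp only [one_smul, inv_one, mul_one] at hl'
    exact ⟨sec_src_inj hl' hx, hx⟩
  · rintro ⟨rfl, hx⟩
    exact ⟨1, (h2 1).2 ⟨rfl, hx⟩, by simpa using hx⟩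

/-- The source set of an element of the inverse semigroup. -/
def srcSet (w : InvSemigroup G μ) : Set X := ⋃ g, sec μ w g

theorem measurableSet_srcSet (w : InvSemigroup G μ) : MeasurableSet (srcSet w) :=
  MeasurableSet.iUnion fun g => measurableSet_sec w g

theorem mul_arr_srcSet (w : InvSemigroup G μ) :
    w * arr μ 1 (measurableSet_srcSet w) = w := by
  apply invSemigroup_ext
  filter_upwards [sec_mul w (arr μ 1 (measurableSet_srcSet w)),
    sec_arr (μ := μ) (1 : G) (measurableSet_srcSet w)] with x h1 h2 k
  rw [h1]
  constructor
  · rintro ⟨l, hl, hl'⟩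
    obtain ⟨rfl, hx⟩ := (h2 l).1 hl
    simpa using hl'
  · intro hx
    exact ⟨1, (h2 1).2 ⟨rfl, Set.mem_iUnion.2 ⟨k, hx⟩⟩, by simpa using hx⟩

theorem charFun_ae (w : InvSemigroup G μ) :
    ∀ᵐ γ ∂(gdMeasure G μ), charFun μ w γ = (rep μ w).carrier.indicator (fun _ => (1 : ℂ)) γ := by
  have h : charFun μ w = charFun μ (Quotient.mk (bisectionSetoid G μ) (rep μ w)) := by rw [mk_rep]
  rw [h]
  exact AEEqFun.coeFn_mk _ _

/-- The property need not be measurable, so the failure set is first enclosed in a measurable null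
set, to which the Fubini statement `ae_gdMeasure_iff` applies. -/
theorem ae_of_ae_gdMeasure {P : G × X → Prop} (h : ∀ᵐ γ ∂(gdMeasure G μ), P γ) :
    ∀ᵐ x ∂μ, ∀ g, P (g, x) := by
  have h' := ae_iff.1 h
  obtain ⟨t, hsub, ht, h0⟩ := exists_measurable_superset_of_null h'
  have h2 : ∀ᵐ γ ∂(gdMeasure G μ), γ ∈ tᶜ := by
    rw [ae_iff]; simpa using h0
  filter_upwards [(ae_gdMeasure_iff (G := G) μ (P := fun γ => γ ∈ tᶜ) ht.compl).1 h2] with x hx g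
  by_contra hP
  exact hx g (hsub hP)

/-- The chosen representative of an element of the inverse semigroup is almost everywhere the
characteristic function. -/
theorem lift_toSpan_ae (w : InvSemigroup G μ) :
    ∀ᵐ x ∂μ, ∀ g, lift (gdMeasure G μ) (toSpan μ w : (G × X) →ₘ[gdMeasure G μ] ℂ) (g, x) =
      (sec μ w g).indicator (fun _ => (1 : ℂ)) x := by
  apply ae_of_ae_gdMeasure
    (P := fun γ => lift (gdMeasure G μ) (toSpan μ w : (G × X) →ₘ[gdMeasure G μ] ℂ) γ =
      (sec μ w γ.1).indicator (fun _ => (1 : ℂ)) γ.2)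
  filter_upwards [lift_ae (gdMeasure G μ) (toSpan μ w : (G × X) →ₘ[gdMeasure G μ] ℂ), charFun_ae w]
    with γ h1 h2
  rw [h1]
  exact h2

theorem tau_toSpan (w : InvSemigroup G μ) : tau μ (toSpan μ w) = (μ.real (sec μ w 1) : ℂ) := by
  unfold tau
  have hU : MeasurableSet {γ : G × X | γ.1 = 1} :=
    measurable_fst (MeasurableSet.of_discrete (s := {(1 : G)}))
  have e : ∫ γ in {γ : G × X | γ.1 = 1}, (toSpan μ w : (G × X) →ₘ[gdMeasure G μ] ℂ) γ
        ∂(gdMeasure G μ) =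
      ∫ γ in {γ : G × X | γ.1 = 1}, (rep μ w).carrier.indicator (fun _ => (1 : ℂ)) γ
        ∂(gdMeasure G μ) :=
    integral_congr_ae (ae_restrict_of_ae (charFun_ae w))
  rw [e, integral_indicator (rep μ w).measurable]
  simp only [MeasureTheory.integral_const, Complex.real_smul, mul_one]
  congr 1
  rw [measureReal_restrict_apply_univ, measureReal_restrict_apply (rep μ w).measurable]
  have e2 : (rep μ w).carrier ∩ {γ : G × X | γ.1 = 1} = {(1 : G)} ×ˢ sec μ w 1 := by
    ext ⟨g, x⟩
    simp only [Set.mem_inter_iff, Set.mem_ofPred_eq, Set.mem_prod, Set.mem_singleton_iff, sec]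
    constructor
    · rintro ⟨h, rfl⟩; exact ⟨rfl, h⟩
    · rintro ⟨rfl, h⟩; exact ⟨h, rfl⟩
  rw [e2, measureReal_def, measureReal_def, gdMeasure, Measure.prod_prod]
  simp

theorem toSpan_arr_ae (g : G) {A : Set X} (hA : MeasurableSet A) :
    ∀ᵐ γ ∂(gdMeasure G μ), (toSpan μ (arr μ g hA) : (G × X) →ₘ[gdMeasure G μ] ℂ) γ =
      (({g} : Set G) ×ˢ A).indicator (fun _ => (1 : ℂ)) γ :=
  AEEqFun.coeFn_mk _ _

/-- Splitting the unit bisection of a set along finitely many labels. -/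
theorem toSpan_arr_eq_sum {ι : Type*} (g : G) (I : Finset ι) (C : ι → Set X)
    (hC : ∀ i, MeasurableSet (C i)) {A : Set X} (hA : MeasurableSet A)
    (hdisj : ∀ i ∈ I, ∀ j ∈ I, i ≠ j → Disjoint (C i) (C j)) (hU : A = ⋃ i ∈ I, C i) :
    toSpan μ (arr μ g hA) = ∑ i ∈ I, toSpan μ (arr μ g (hC i)) := by
  classical
  induction I using Finset.induction_on generalizing A with
  | empty =>
    apply Subtype.ext
    apply AEEqFun.ext
    simp only [Finset.sum_empty]
    have hz : ∀ᵐ γ ∂(gdMeasure G μ),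
        (((0 : spanI G μ) : (G × X) →ₘ[gdMeasure G μ] ℂ)) γ = 0 := by
      filter_upwards [AEEqFun.coeFn_zero (α := G × X) (β := ℂ) (μ := gdMeasure G μ)] with γ h
      exact h
    filter_upwards [hz, toSpan_arr_ae g hA] with γ h1 h2
    have : A = ∅ := by simpa using hU
    subst this
    rw [h1, h2]
    simp
  | insert a s ha ih =>
    have hB : MeasurableSet (⋃ i ∈ s, C i) := Finset.measurableSet_biUnion _ fun i _ => hC i
    rw [Finset.sum_insert ha, ← ih hB (fun i hi j hj => hdisj i (Finset.mem_insert_of_mem hi) j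
      (Finset.mem_insert_of_mem hj)) rfl]
    have hd : Disjoint (C a) (⋃ i ∈ s, C i) := by
      rw [Set.disjoint_iUnion₂_right]
      intro i hi
      exact hdisj a (Finset.mem_insert_self _ _) i (Finset.mem_insert_of_mem hi)
        (fun e => ha (e ▸ hi))
    rw [Finset.set_biUnion_insert] at hU
    subst hU
    apply Subtype.ext
    apply AEEqFun.ext
    filter_upwards [toSpan_arr_ae g hA, toSpan_arr_ae g (hC a), toSpan_arr_ae g hB,
      AEEqFun.coeFn_add (toSpan μ (arr μ g (hC a)) : (G × X) →ₘ[gdMeasure G μ] ℂ)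
        (toSpan μ (arr μ g hB) : (G × X) →ₘ[gdMeasure G μ] ℂ)] with γ h1 h2 h3 h4
    change _ = ((toSpan μ (arr μ g (hC a)) : (G × X) →ₘ[gdMeasure G μ] ℂ) +
      (toSpan μ (arr μ g hB) : (G × X) →ₘ[gdMeasure G μ] ℂ)) γ
    rw [h4, Pi.add_apply, h1, h2, h3, Set.prod_union]
    rw [Set.indicator_union_of_disjoint]
    rw [Set.disjoint_left] at hd ⊢
    rintro ⟨b, y⟩ ⟨_, h⟩ ⟨_, h'⟩
    exact hd h h'

/-- A linear map on `[I_{G,X}]` cannot see null sets. Hence a set whose unit bisection has nonzero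
image is not null and contains admissible sample points. -/
theorem toSpan_arr_of_null (g : G) {A : Set X} (hA : MeasurableSet A) (h : μ A = 0) :
    toSpan μ (arr μ g hA) = 0 := by
  have e : arr μ g hA = arr μ g MeasurableSet.empty := by
    apply invSemigroup_ext
    have h' : ∀ᵐ x ∂μ, x ∉ A := by rw [ae_iff]; simpa using h
    filter_upwards [sec_arr (μ := μ) g hA, sec_arr (μ := μ) g MeasurableSet.empty, h']
      with x h1 h2 h3 k
    rw [h1, h2]
    simp [h3]
  rw [e]
  have := toSpan_arr_eq_sum (μ := μ) g (∅ : Finset ℕ) (fun _ => ∅) (fun _ => MeasurableSet.empty)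
    (A := ∅) MeasurableSet.empty (by simp) (by simp)
  simpa using this

end Sections


/-! ## Sampled sofic models -/

section Models

variable {G X : Type*} [Group G] [MulAction G X] [MeasurableSpace X]

/-- A sofic model of the action: an approximate action `σ` of `G` on `d` points together with sample
points of `X` that are approximately equidistributed and equivariant, as seen by the elements of `K`
and the members of `𝒯`. -/
structure IsModel (μ : Measure X) (K : Finset G) (𝒯 : Finset (Set X)) (η : ℝ) {d : ℕ}
    (σ : G → Equiv.Perm (Fin d)) (x : Fin d → X) : Prop where
  one : σ 1 = 1
  mul : ∀ g ∈ K, ∀ h ∈ K, cnt (fun v => σ (g * h) v ≠ σ g (σ h v)) ≤ η * d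
  free : ∀ g ∈ K, g ≠ 1 → cnt (fun v => σ g v = v) ≤ η * d
  meas : ∀ T ∈ 𝒯, |cnt (fun v => x v ∈ T) - μ.real T * d| ≤ η * d
  equi : ∀ T ∈ 𝒯, ∀ g ∈ K, cnt (fun v => ¬ (g • x v ∈ T ↔ x (σ g v) ∈ T)) ≤ η * d

theorem IsModel.mono {μ : Measure X} {K K' : Finset G} {𝒯 𝒯' : Finset (Set X)} {η η' : ℝ} {d : ℕ}
    {σ : G → Equiv.Perm (Fin d)} {x : Fin d → X} (h : IsModel μ K 𝒯 η σ x) (hK : K' ⊆ K)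
    (hT : 𝒯' ⊆ 𝒯) (hη : η ≤ η') : IsModel μ K' 𝒯' η' σ x := by
  have hη' : η * d ≤ η' * d := by gcongr
  exact ⟨h.one, fun g hg k hk => (h.mul g (hK hg) k (hK hk)).trans hη',
    fun g hg h1 => (h.free g (hK hg) h1).trans hη', fun T hT' => (h.meas T (hT hT')).trans hη',
    fun T hT' g hg => (h.equi T (hT hT') g (hK hg)).trans hη'⟩

end Models

/-! ## Windows -/

section Windows

variable {G : Type*} [Group G]

theorem one_mem_symmSet (F : Finset G) : (1 : G) ∈ symmSet F := by
  classical
  unfold symmSet; simp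

theorem inv_mem_symmSet {F : Finset G} {s : G} (h : s ∈ symmSet F) : s⁻¹ ∈ symmSet F := by
  classical
  unfold symmSet at *
  simp only [Finset.mem_union, Finset.mem_inv', Finset.mem_singleton, inv_inv, inv_eq_one] at *
  tauto

theorem subset_symmSet (F : Finset G) : F ⊆ symmSet F := by
  classical
  intro s hs
  unfold symmSet; simp [hs]

theorem window_mono (F : Finset G) {m n : ℕ} (h : m ≤ n) : window F m ⊆ window F n := by
  classical
  unfold window
  exact Finset.pow_subset_pow_right (one_mem_symmSet F) h

theorem one_mem_window (F : Finset G) (n : ℕ) : (1 : G) ∈ window F n := by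
  classical
  exact window_mono F (Nat.zero_le n) (by simp [window])

theorem mul_mem_window {F : Finset G} {m n : ℕ} {g h : G} (hg : g ∈ window F m)
    (hh : h ∈ window F n) : g * h ∈ window F (m + n) := by
  classical
  unfold window at *
  rw [pow_add]
  exact Finset.mul_mem_mul hg hh

theorem prod_mem_window {F : Finset G} (l : List G) (hl : ∀ s ∈ l, s ∈ symmSet F) :
    l.prod ∈ window F l.length := by
  classical
  induction l with
  | nil => simp [window]
  | cons a l ih =>
    rw [List.prod_cons, List.length_cons, add_comm]
    refine mul_mem_window ?_ (ih fun s hs => hl s (List.mem_cons_of_mem _ hs))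
    simpa [window] using hl a (by simp)

theorem exists_list_of_mem_window {F : Finset G} {n : ℕ} {g : G} (hg : g ∈ window F n) :
    ∃ l : List G, l.length = n ∧ (∀ s ∈ l, s ∈ symmSet F) ∧ l.prod = g := by
  classical
  induction n generalizing g with
  | zero => exact ⟨[], rfl, by simp, by simpa [window, eq_comm] using hg⟩
  | succ n ih =>
    unfold window at hg
    rw [pow_succ'] at hg
    obtain ⟨a, ha, b, hb, rfl⟩ := Finset.mem_mul.1 hg
    obtain ⟨l, h1, h2, rfl⟩ := ih hb
    refine ⟨a :: l, by simp [h1], ?_, by simp⟩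
    intro s hs
    rcases List.mem_cons.1 hs with rfl | hs
    · exact ha
    · exact h2 s hs

theorem inv_mem_window {F : Finset G} {n : ℕ} {g : G} (hg : g ∈ window F n) :
    g⁻¹ ∈ window F n := by
  obtain ⟨l, h1, h2, rfl⟩ := exists_list_of_mem_window hg
  have := prod_mem_window (F := F) (l.map (·⁻¹)).reverse (by
    intro s hs
    simp only [List.mem_reverse, List.mem_map] at hs
    obtain ⟨t, ht, rfl⟩ := hs
    exact inv_mem_symmSet (h2 t ht))
  rw [List.prod_inv_reverse]
  simpa [h1] using this

theorem exists_mem_window_of_mem_closure {F : Finset G} {g : G}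
    (hg : g ∈ Subgroup.closure (F : Set G)) : ∃ n, g ∈ window F n := by
  classical
  induction hg using Subgroup.closure_induction with
  | mem x hx => exact ⟨1, by simpa [window] using subset_symmSet F hx⟩
  | one => exact ⟨0, one_mem_window F 0⟩
  | mul x y _ _ hx hy =>
    obtain ⟨m, hm⟩ := hx
    obtain ⟨n, hn⟩ := hy
    exact ⟨m + n, mul_mem_window hm hn⟩
  | inv x _ hx =>
    obtain ⟨m, hm⟩ := hx
    exact ⟨m, inv_mem_window hm⟩

theorem exists_subset_window {F : Finset G} (K : Finset G)
    (hK : ∀ g ∈ K, g ∈ Subgroup.closure (F : Set G)) : ∃ n, K ⊆ window F n := by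
  classical
  induction K using Finset.induction_on with
  | empty => exact ⟨0, by simp⟩
  | insert a s _ ih =>
    obtain ⟨n, hn⟩ := ih fun g hg => hK g (Finset.mem_insert_of_mem hg)
    obtain ⟨m, hm⟩ := exists_mem_window_of_mem_closure (hK a (Finset.mem_insert_self _ _))
    refine ⟨max m n, Finset.insert_subset ?_ ?_⟩
    · exact window_mono F (le_max_left _ _) hm
    · exact hn.trans (window_mono F (le_max_right _ _))

/-- Splitting off one letter at a time costs one multiplicativity error `c` per letter; all the
tails that occur stay in the window. -/
theorem cnt_list_prod_le {d : ℕ} {σ : G → Equiv.Perm (Fin d)} {F : Finset G} {n : ℕ} {c : ℝ}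
    (h1 : σ 1 = 1)
    (h : ∀ g ∈ window F n, ∀ k ∈ window F n, cnt (fun v => σ (g * k) v ≠ σ g (σ k v)) ≤ c)
    (l : List G) (hl : l.length ≤ n) (hmem : ∀ s ∈ l, s ∈ symmSet F) :
    cnt (fun v => σ l.prod v ≠ (l.map σ).prod v) ≤ l.length * c := by
  classical
  induction l with
  | nil =>
    rw [cnt_eq_zero]
    · simp
    · simp [h1]
  | cons a l ih =>
    have hl' : l.length + 1 ≤ n := by simpa using hl
    have ih' := ih (by omega) fun s hs => hmem s (List.mem_cons_of_mem _ hs)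
    have ha : a ∈ window F n := by
      have : a ∈ window F 1 := by simpa [window] using hmem a (by simp)
      exact window_mono F (by omega) this
    have hp : l.prod ∈ window F n := window_mono F (by omega)
      (prod_mem_window l fun s hs => hmem s (List.mem_cons_of_mem _ hs))
    have h3 := h a ha _ hp
    have h4 : cnt (fun v => σ (a :: l).prod v ≠ ((a :: l).map σ).prod v) ≤
        cnt (fun v => σ (a * l.prod) v ≠ σ a (σ l.prod v)) +
          cnt (fun v => σ l.prod v ≠ (l.map σ).prod v) := by
      refine cnt_le_of_or fun v hv => ?_
      by_contra hcon
      push Not at hcon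
      apply hv
      rw [List.prod_cons, hcon.1, hcon.2, List.map_cons, List.prod_cons, Equiv.Perm.mul_apply]
    refine h4.trans ?_
    rw [List.length_cons]
    push_cast
    linarith

end Windows

/-! ## Translates of partitions -/

section Translates

variable {G X : Type*} [Group G] [MulAction G X] [MeasurableSpace X] {μ : Measure X}
  [MeasurableConstSMul G X] [SMulInvariantMeasure G X μ]

/-- The product of translates of members of `P` along a choice function. -/
noncomputable def transl (W : Finset G) (P : Finset (Linfty μ)) (c : W → P) : Linfty μ :=
  ∏ s : W, act (s : G) (c s : Linfty μ)

theorem translates_eq_range (W : Finset G) (P : Finset (Linfty μ)) (hP : P.Nonempty) :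
    translates P W = Set.range (transl W P) := by
  classical
  ext f
  constructor
  · rintro ⟨p, hp, rfl⟩
    refine ⟨fun s => ⟨p s, hp s s.2⟩, ?_⟩
    unfold transl
    rw [← Finset.prod_coe_sort W fun s => act s (p s)]
  · rintro ⟨c, rfl⟩
    obtain ⟨p0, hp0⟩ := hP
    refine ⟨fun s => if h : s ∈ W then c ⟨s, h⟩ else p0, ?_, ?_⟩
    · intro s hs
      simp [hs]
    · unfold transl
      rw [← Finset.prod_coe_sort W]
      refine Finset.prod_congr rfl fun s _ => ?_
      simp

theorem IsProjPartition.idem {P : Finset (Linfty μ)} (hP : IsProjPartition P) {p : Linfty μ}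
    (hp : p ∈ P) : p * p = p := (hP.1 p hp).isIdempotentElem

theorem IsProjPartition.nonempty [IsProbabilityMeasure μ] {P : Finset (Linfty μ)}
    (hP : IsProjPartition P) : P.Nonempty := by
  by_contra h
  rw [Finset.not_nonempty_iff_eq_empty] at h
  have h1 : (0 : Linfty μ) = 1 := by simpa [h] using hP.2.2
  have h2 : ∀ᵐ x ∂μ, False := by
    filter_upwards [coe_one_ae (μ := μ), AEEqFun.coeFn_zero (α := X) (β := ℂ) (μ := μ)] with x h3 h4
    rw [← h1] at h3
    have : (0 : X → ℂ) x = 1 := h4.symm.trans h3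
    simp at this
  obtain ⟨x, hx⟩ := h2.exists
  exact hx

theorem transl_idem {W : Finset G} {P : Finset (Linfty μ)} (hP : IsProjPartition P) (c : W → P) :
    transl W P c * transl W P c = transl W P c := by
  unfold transl
  rw [← Finset.prod_mul_distrib]
  exact Finset.prod_congr rfl fun s _ => by rw [← act_mul, hP.idem (c s).2]

/-- The factor of `transl W P c` at `s` either absorbs the translate of `p` or is orthogonal to it.
The elements `transl W P c` thus behave as the atoms, some possibly zero, of the algebra generated
by the translates. -/
theorem act_mul_transl {W : Finset G} {P : Finset (Linfty μ)} (hP : IsProjPartition P) (c : W → P)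
    (s : W) (p : P) [Decidable (c s = p)] :
    act (s : G) (p : Linfty μ) * transl W P c = if c s = p then transl W P c else 0 := by
  classical
  unfold transl
  rw [← Finset.mul_prod_erase _ _ (Finset.mem_univ s), ← mul_assoc, ← act_mul]
  by_cases h : c s = p
  · rw [if_pos h, h, hP.idem p.2]
  · have : (p : Linfty μ) * (c s : Linfty μ) = 0 :=
      hP.2.1 p p.2 (c s) (c s).2 (fun e => h (Subtype.ext e.symm))
    rw [if_neg h, this, act_zero, zero_mul]

theorem transl_mul_transl {W : Finset G} {P : Finset (Linfty μ)} (hP : IsProjPartition P)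
    {c c' : W → P} (h : c ≠ c') : transl W P c * transl W P c' = 0 := by
  classical
  obtain ⟨s, hs⟩ := Function.ne_iff.1 h
  have h1 : transl W P c = act (s : G) (c s : Linfty μ) * transl W P c := by
    rw [act_mul_transl hP, if_pos rfl]
  rw [h1, mul_right_comm, act_mul_transl hP, if_neg (Ne.symm hs), zero_mul]

open Classical in
theorem sum_transl (W : Finset G) {P : Finset (Linfty μ)} (hP : IsProjPartition P) :
    ∑ c : W → P, transl W P c = 1 := by
  classical
  unfold transl
  rw [← Fintype.prod_sum (f := fun (s : W) (p : P) => act (s : G) (p : Linfty μ))]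
  refine Finset.prod_eq_one fun s _ => ?_
  rw [← act_sum, Finset.sum_coe_sort P (fun p => p), hP.2.2, act_one]

variable [IsProbabilityMeasure μ]

theorem transl_mem_domHA {F : Finset G} {P : Finset (Linfty μ)} {n : ℕ} (hP : IsProjPartition P)
    (c : window F n → P) : transl (window F n) P c ∈ domHA F P n :=
  Submodule.subset_span (by rw [translates_eq_range _ _ hP.nonempty]; exact ⟨c, rfl⟩)

/-- Multiply by the decomposition of `1` into atoms: each atom is kept or killed. The equivariance
condition in `HA` speaks only of elements of the domain, so it has content because of this
membership. -/
theorem act_mem_domHA {F : Finset G} {P : Finset (Linfty μ)} {n : ℕ} (hP : IsProjPartition P)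
    {s : G} (hs : s ∈ window F n) {p : Linfty μ} (hp : p ∈ P) : act s p ∈ domHA F P n := by
  classical
  rw [← mul_one (act s p), ← sum_transl (window F n) hP, Finset.mul_sum]
  refine Submodule.sum_mem _ fun c _ => ?_
  have := act_mul_transl hP c ⟨s, hs⟩ ⟨p, hp⟩
  simp only at this
  rw [this]
  split_ifs
  · exact transl_mem_domHA hP c
  · exact Submodule.zero_mem _

theorem mem_domHA {F : Finset G} {P : Finset (Linfty μ)} {n : ℕ} (hP : IsProjPartition P)
    {p : Linfty μ} (hp : p ∈ P) : p ∈ domHA F P n := by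
  have := act_mem_domHA (F := F) (n := n) hP (one_mem_window F n) hp
  rwa [act_one_left] at this

/-- Every good enough model yields a pair of models for the group and for the space. -/
theorem exists_mem_HA_of_isModel (F : Finset G) (P : Finset (Linfty μ)) (hP : IsProjPartition P)
    (n : ℕ) {δ : ℝ} (hδ : 0 < δ) :
    ∃ (K : Finset G) (𝒯 : Finset (Set X)) (η : ℝ) (X₀ : Set X), (∀ T ∈ 𝒯, MeasurableSet T) ∧
      0 < η ∧ X₀ ∈ ae μ ∧ ∀ (d : ℕ), 0 < d → ∀ (σ : G → Equiv.Perm (Fin d)) (x : Fin d → X),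
        IsModel μ K 𝒯 η σ x → (∀ v, x v ∈ X₀) →
          ∃ φ : domHA F P n →ₗ[ℂ] (Fin d → ℂ), (σ, φ) ∈ HA F P n δ d := by
  classical
  set W := window F n with hW
  let 𝒯 : Finset (Set X) := (Finset.univ.image fun c : W → P => pset (transl W P c)) ∪
    (Finset.univ.image fun z : W × P => (fun y : X => (z.1 : G)⁻¹ • y) ⁻¹' pset (z.2 : Linfty μ))
  -- The bound `δ / 2` serves the trace and freeness conditions. An `n`-letter word is wrong at no
  -- more than `n η d` vertices, hence off by `2 n η` in squared norm, which the second bound keeps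
  -- below `δ ^ 2`.
  let η : ℝ := min (δ / 2) (δ ^ 2 / (2 * n + 2))
  -- The points at which the linear lift respects the finitely many relations needed: unit, products
  -- of atoms, and values zero or one on atoms, translates and members of `P`.
  let X₀ : Set X := {x | lift μ ((1 : Linfty μ) : X →ₘ[μ] ℂ) x = 1 ∧
    (∀ c c' : W → P, lift μ ((transl W P c * transl W P c' : Linfty μ) : X →ₘ[μ] ℂ) x =
      lift μ (transl W P c : X →ₘ[μ] ℂ) x * lift μ (transl W P c' : X →ₘ[μ] ℂ) x) ∧
    (∀ c : W → P, lift μ (transl W P c : X →ₘ[μ] ℂ) x =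
      (pset (transl W P c)).indicator (fun _ => (1 : ℂ)) x) ∧
    (∀ z : W × P, lift μ (act (z.1 : G) (z.2 : Linfty μ) : X →ₘ[μ] ℂ) x =
      (pset (z.2 : Linfty μ)).indicator (fun _ => (1 : ℂ)) ((z.1 : G)⁻¹ • x)) ∧
    (∀ p : P, lift μ ((p : Linfty μ) : X →ₘ[μ] ℂ) x =
      (pset (p : Linfty μ)).indicator (fun _ => (1 : ℂ)) x)}
  have hX₀ : X₀ ∈ ae μ := by
    have h1 : ∀ᵐ x ∂μ, lift μ ((1 : Linfty μ) : X →ₘ[μ] ℂ) x = 1 := by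
      filter_upwards [lift_ae μ ((1 : Linfty μ) : X →ₘ[μ] ℂ), coe_one_ae (μ := μ)] with x h h'
      rw [h, h']
    have h2 : ∀ᵐ x ∂μ, ∀ c c' : W → P,
        lift μ ((transl W P c * transl W P c' : Linfty μ) : X →ₘ[μ] ℂ) x =
        lift μ (transl W P c : X →ₘ[μ] ℂ) x * lift μ (transl W P c' : X →ₘ[μ] ℂ) x := by
      rw [ae_all_iff]; intro c
      rw [ae_all_iff]; intro c'
      filter_upwards [lift_ae μ ((transl W P c * transl W P c' : Linfty μ) : X →ₘ[μ] ℂ),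
        lift_ae μ (transl W P c : X →ₘ[μ] ℂ), lift_ae μ (transl W P c' : X →ₘ[μ] ℂ),
        coe_mul_ae (transl W P c) (transl W P c')] with x h1 h2 h3 h4
      rw [h1, h2, h3, h4]
    have h3 : ∀ᵐ x ∂μ, ∀ c : W → P, lift μ (transl W P c : X →ₘ[μ] ℂ) x =
        (pset (transl W P c)).indicator (fun _ => (1 : ℂ)) x := by
      rw [ae_all_iff]; intro c
      filter_upwards [lift_ae μ (transl W P c : X →ₘ[μ] ℂ), proj_ae (transl_idem hP c)]
        with x h1 h2
      rw [h1, h2]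
    have h4 : ∀ᵐ x ∂μ, ∀ z : W × P, lift μ (act (z.1 : G) (z.2 : Linfty μ) : X →ₘ[μ] ℂ) x =
        (pset (z.2 : Linfty μ)).indicator (fun _ => (1 : ℂ)) ((z.1 : G)⁻¹ • x) := by
      rw [ae_all_iff]; intro z
      filter_upwards [lift_ae μ (act (z.1 : G) (z.2 : Linfty μ) : X →ₘ[μ] ℂ),
        act_ae (z.1 : G) (z.2 : Linfty μ), ae_smul (proj_ae (hP.idem z.2.2)) (z.1 : G)⁻¹]
        with x h1 h2 h3
      rw [h1, h2, h3]
    have h5 : ∀ᵐ x ∂μ, ∀ p : P, lift μ ((p : Linfty μ) : X →ₘ[μ] ℂ) x =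
        (pset (p : Linfty μ)).indicator (fun _ => (1 : ℂ)) x := by
      rw [ae_all_iff]; intro p
      filter_upwards [lift_ae μ ((p : Linfty μ) : X →ₘ[μ] ℂ), proj_ae (hP.idem p.2)] with x h1 h2
      rw [h1, h2]
    filter_upwards [h1, h2, h3, h4, h5] with x a b c d e using ⟨a, b, c, d, e⟩
  have hn0 : (0 : ℝ) < 2 * n + 2 := by positivity
  have hη1 : η ≤ δ / 2 := min_le_left _ _
  have hη2 : η * (2 * n + 2) ≤ δ ^ 2 := by
    rw [← le_div_iff₀ hn0]; exact min_le_right _ _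
  have hη : 0 < η := lt_min (by positivity) (by positivity)
  refine ⟨W, 𝒯, η, X₀, ?_, hη, hX₀, ?_⟩
  · intro T hT
    rcases Finset.mem_union.1 hT with h | h
    · obtain ⟨c, _, rfl⟩ := Finset.mem_image.1 h
      exact measurableSet_pset _
    · obtain ⟨z, _, rfl⟩ := Finset.mem_image.1 h
      exact (measurableSet_pset _).preimage (measurable_const_smul _)
  · intro d hd σ x hM hx
    let φ : domHA F P n →ₗ[ℂ] (Fin d → ℂ) :=
      { toFun := fun a v => lift μ ((a : Linfty μ) : X →ₘ[μ] ℂ) (x v)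
        map_add' := fun a b => by
          ext v
          exact congrFun (map_add (lift μ) ((a : Linfty μ) : X →ₘ[μ] ℂ) ((b : Linfty μ) : X →ₘ[μ] ℂ))
            (x v)
        map_smul' := fun r a => by
          ext v
          exact congrFun (map_smul (lift μ) r ((a : Linfty μ) : X →ₘ[μ] ℂ)) (x v) }
    have hφ : ∀ a v, φ a v = lift μ ((a : Linfty μ) : X →ₘ[μ] ℂ) (x v) := fun _ _ => rfl
    refine ⟨φ, ⟨hM.one, ?_, ?_⟩, ⟨?_, ?_⟩, ?_, ?_⟩
    · intro l hl hmem
      apply norm2_lt_of_sq hδ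
      rw [permMat_eq_pmat, permMat_eq_pmat]
      refine (norm2_le_cnt_ne _ _).trans_lt ?_
      have h1 := cnt_list_prod_le (F := F) (n := n) hM.one hM.mul l hl.le hmem
      have h2 : cnt (fun v => (σ l.prod).toPEquiv v ≠ ((l.map σ).prod).toPEquiv v) ≤
          l.length * (η * d) := by
        rw [cnt_congr fun v => perm_ne_iff (σ l.prod) (l.map σ).prod v]
        exact h1
      rw [hl] at h2
      have h3 : 2 * cnt (fun v => (σ l.prod).toPEquiv v ≠ ((l.map σ).prod).toPEquiv v) / d ≤
          2 * (n * η) := div_le_of_le_mul₀ (by positivity) (by positivity) (by linarith)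
      refine h3.trans_lt ?_
      nlinarith
    · intro s hs h1
      rw [permMat_eq_pmat, tr_pmat, Complex.ofReal_re]
      have h2 : cnt (fun v => (σ s).toPEquiv v = some v) = cnt (fun v => σ s v = v) :=
        cnt_congr fun v => by simp [Equiv.toPEquiv_apply]
      rw [h2]
      refine (div_le_of_le_mul₀ (by positivity) hη.le (hM.free s hs h1)).trans_lt ?_
      linarith
    · intro a ha
      ext v
      rw [hφ, ha]
      exact (hx v).1
    · intro a b c hc
      ext v
      rw [Pi.mul_apply, hφ, hφ, hφ, hc]
      -- Multiplicativity at the sample points holds for pairs of atoms by the choice of `X₀` and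
      -- extends to their span by bilinearity.
      have key : ∀ a ∈ domHA F P n, ∀ b ∈ domHA F P n,
          lift μ ((a * b : Linfty μ) : X →ₘ[μ] ℂ) (x v) =
            lift μ (a : X →ₘ[μ] ℂ) (x v) * lift μ (b : X →ₘ[μ] ℂ) (x v) := by
        have ladd : ∀ a b : Linfty μ, lift μ ((a + b : Linfty μ) : X →ₘ[μ] ℂ) (x v) =
            lift μ (a : X →ₘ[μ] ℂ) (x v) + lift μ (b : X →ₘ[μ] ℂ) (x v) := fun a b =>
          congrFun (map_add (lift μ) (a : X →ₘ[μ] ℂ) (b : X →ₘ[μ] ℂ)) (x v)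
        have lsmul : ∀ (r : ℂ) (a : Linfty μ), lift μ ((r • a : Linfty μ) : X →ₘ[μ] ℂ) (x v) =
            r * lift μ (a : X →ₘ[μ] ℂ) (x v) := fun r a =>
          congrFun (map_smul (lift μ) r (a : X →ₘ[μ] ℂ)) (x v)
        have lzero : lift μ ((0 : Linfty μ) : X →ₘ[μ] ℂ) (x v) = 0 :=
          congrFun (map_zero (lift μ)) (x v)
        intro a ha b hb
        unfold domHA at ha hb
        rw [translates_eq_range _ _ hP.nonempty] at ha hb
        induction ha, hb using Submodule.span_induction₂ with
        | mem_mem a b ha hb =>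
          obtain ⟨c, rfl⟩ := ha
          obtain ⟨c', rfl⟩ := hb
          exact (hx v).2.1 c c'
        | zero_left b _ => rw [zero_mul, lzero, zero_mul]
        | zero_right a _ => rw [mul_zero, lzero, mul_zero]
        | add_left a a' b _ _ _ h h' => rw [add_mul, ladd, ladd, h, h', add_mul]
        | add_right a b b' _ _ _ h h' => rw [mul_add, ladd, ladd, h, h', mul_add]
        | smul_left r a b _ _ h => rw [smul_mul_assoc, lsmul, lsmul, h, mul_assoc]
        | smul_right r a b _ _ h => rw [mul_smul_comm, lsmul, lsmul, h, mul_left_comm]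
      exact key a a.2 b b.2
    · intro a ha
      rw [translates_eq_range _ _ hP.nonempty] at ha
      obtain ⟨c, hc⟩ := ha
      have hsum : ∑ v, φ a v = (cnt (fun v => x v ∈ pset (transl W P c)) : ℂ) := by
        rw [← sum_ite_cnt]
        push_cast
        refine Finset.sum_congr rfl fun v _ => ?_
        rw [hφ, ← hc, (hx v).2.2.1 c, Set.indicator_apply]
        split_ifs <;> simp
      rw [tr_diagonal, hsum, ← hc, integral_proj (transl_idem hP c)]
      have h1 := hM.meas (pset (transl W P c)) (Finset.mem_union_left _
        (Finset.mem_image.2 ⟨c, Finset.mem_univ _, rfl⟩))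
      have hd' : (0 : ℝ) < d := by exact_mod_cast hd
      rw [← Complex.ofReal_natCast, ← Complex.ofReal_div, ← Complex.ofReal_sub,
        Complex.norm_real, Real.norm_eq_abs]
      have e : cnt (fun v => x v ∈ pset (transl W P c)) / d - μ.real (pset (transl W P c)) =
          (cnt (fun v => x v ∈ pset (transl W P c)) - μ.real (pset (transl W P c)) * d) / d := by
        field_simp
      rw [e, abs_div, abs_of_pos hd', div_lt_iff₀ hd']
      nlinarith
    · intro s hs a b ha hb
      rw [permMat_conj_diagonal]
      apply norm2_lt_of_sq hδ
      rw [norm2_diagonal_sub]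
      have h1 := hM.equi ((fun y : X => s⁻¹ • y) ⁻¹' pset (a : Linfty μ)) (Finset.mem_union_right _
        (Finset.mem_image.2 ⟨(⟨s, hs⟩, ⟨a, ha⟩), Finset.mem_univ _, rfl⟩)) s hs
      have hterm : ∀ v, ‖φ b v - φ a ((σ s)⁻¹ v)‖ ^ 2 =
          if ¬ (s⁻¹ • x v ∈ pset (a : Linfty μ) ↔ x ((σ s)⁻¹ v) ∈ pset (a : Linfty μ)) then 1
            else 0 := by
        intro v
        rw [hφ, hφ, hb, (hx v).2.2.2.1 (⟨s, hs⟩, ⟨a, ha⟩), (hx _).2.2.2.2 ⟨a, ha⟩,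
          Set.indicator_apply, Set.indicator_apply]
        simp only
        by_cases h1 : s⁻¹ • x v ∈ pset (a : Linfty μ) <;>
          by_cases h2 : x ((σ s)⁻¹ v) ∈ pset (a : Linfty μ) <;>
          simp only [h1, h2, if_true, if_false] <;> simp
      have hsum : ∑ v, ‖φ b v - φ a ((σ s)⁻¹ v)‖ ^ 2 ≤ η * d := by
        rw [Finset.sum_congr rfl fun v _ => hterm v, sum_ite_cnt]
        -- The norm condition is indexed by the image vertex, the model condition by its preimage.
        -- Substituting `σ s v` for the vertex matches them, since `s • x v` lies in the test set
        -- exactly when `x v` lies in `pset a`.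
        refine le_trans (le_of_eq ?_) h1
        rw [← cnt_perm (σ s) (fun v => ¬ (s⁻¹ • x v ∈ pset (a : Linfty μ) ↔
          x ((σ s)⁻¹ v) ∈ pset (a : Linfty μ)))]
        refine cnt_congr fun v => ?_
        rw [show (σ s)⁻¹ (σ s v) = v by simp, Set.mem_preimage, Set.mem_preimage, inv_smul_smul, iff_comm]
        tauto
      refine (div_le_of_le_mul₀ (by positivity) hη.le hsum).trans_lt ?_
      have : 0 ≤ η * n := by positivity
      nlinarith

end Translates


/-! ## From models to approximately multiplicative maps on the inverse semigroup -/

section ModelToSA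

theorem exists_pequiv_of_injOn {α : Type*} (f : α → Option α)
    (hf : ∀ a a' b, f a = some b → f a' = some b → a = a') : ∃ e : α ≃. α, ∀ a, e a = f a := by
  classical
  refine ⟨{ toFun := f, invFun := fun b => if h : ∃ a, f a = some b then some h.choose else none,
            inv := ?_ }, fun a => rfl⟩
  intro a b
  constructor
  · intro h
    split_ifs at h with h1
    have h2 := h1.choose_spec
    rw [Option.some.injEq] at h
    rwa [h] at h2
  · intro h
    have h1 : ∃ a, f a = some b := ⟨a, h⟩
    rw [dif_pos h1, Option.some.injEq]
    exact hf _ _ _ h1.choose_spec h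

variable {G X : Type*} [Group G] [MulAction G X] [MeasurableSpace X] [MeasurableSpace G]
  [Countable G] [DiscreteMeasurableSpace G] [MeasurableConstSMul G X]
  {μ : Measure X} [IsProbabilityMeasure μ] [SMulInvariantMeasure G X μ]

/-- The set of sources of the arrows of `w` that do not lie over `K`. -/
def tailSet (w : InvSemigroup G μ) (K : Finset G) : Set X := ⋃ g : {g // g ∉ K}, sec μ w g

theorem measurableSet_tailSet (w : InvSemigroup G μ) (K : Finset G) :
    MeasurableSet (tailSet w K) :=
  MeasurableSet.iUnion fun g => measurableSet_sec w g

theorem mem_tailSet {w : InvSemigroup G μ} {K : Finset G} {x : X} {g : G} (hx : x ∈ sec μ w g)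
    (hg : g ∉ K) : x ∈ tailSet w K := Set.mem_iUnion.2 ⟨⟨g, hg⟩, hx⟩

/-- The sections of `w` over distinct group elements are disjoint because the source map is
injective, so their measures are summable and the tails of the sum tend to zero. -/
theorem exists_tailSet_le (w : InvSemigroup G μ) {ε : ℝ} (hε : 0 < ε) :
    ∃ K₀ : Finset G, ∀ K, K₀ ⊆ K → μ.real (tailSet w K) ≤ ε := by
  have h1 : ∑' g, μ (sec μ w g) ≠ ∞ := by
    rw [← measure_iUnion _ (fun g => measurableSet_sec w g)]
    · exact measure_ne_top _ _
    · intro g h hgh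
      rw [Function.onFun, Set.disjoint_left]
      intro x hx hx'
      exact hgh (sec_src_inj hx hx')
  have h2 := ENNReal.tendsto_tsum_compl_atTop_zero h1
  have h3 := h2.eventually (gt_mem_nhds (ENNReal.ofReal_pos.2 hε))
  obtain ⟨K₀, hK₀⟩ := eventually_atTop.1 h3
  refine ⟨K₀, fun K hK => ?_⟩
  rw [measureReal_def]
  refine ENNReal.toReal_le_of_le_ofReal hε.le ?_
  exact (measure_iUnion_le _).trans (hK₀ K hK).le

theorem exists_forall_tailSet_le (S : Finset (InvSemigroup G μ)) {ε : ℝ} (hε : 0 < ε) :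
    ∃ K₀ : Finset G, ∀ K, K₀ ⊆ K → ∀ w ∈ S, μ.real (tailSet w K) ≤ ε := by
  classical
  choose K hK using fun w : InvSemigroup G μ => exists_tailSet_le w hε
  refine ⟨S.biUnion K, fun K' hK' w hw => hK w K' ?_⟩
  exact (Finset.subset_biUnion_of_mem K hw).trans hK'

/-- The tests for `v` and `g` succeed. -/
def GoodAt (𝒯 : Finset (Set X)) {d : ℕ} (σ : G → Equiv.Perm (Fin d)) (x : Fin d → X) (g : G)
    (v : Fin d) : Prop :=
  ∀ T ∈ 𝒯, (g • x v ∈ T ↔ x (σ g v) ∈ T)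

theorem cnt_not_goodAt_le {K : Finset G} {𝒯 : Finset (Set X)} {η : ℝ} {d : ℕ}
    {σ : G → Equiv.Perm (Fin d)} {x : Fin d → X} (hM : IsModel μ K 𝒯 η σ x) :
    cnt (fun v => ∃ g ∈ K, ¬ GoodAt 𝒯 σ x g v) ≤ K.card * (𝒯.card * (η * d)) := by
  refine cnt_exists_le_mul K _ fun g hg => ?_
  refine le_trans (cnt_mono (q := fun v => ∃ T ∈ 𝒯, ¬ (g • x v ∈ T ↔ x (σ g v) ∈ T)) ?_)
    (cnt_exists_le_mul 𝒯 _ fun T hT => hM.equi T hT g hg)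
  intro v hv
  unfold GoodAt at hv
  push Not at hv
  obtain ⟨T, hT, h⟩ := hv
  refine ⟨T, hT, fun hiff => ?_⟩
  rcases h with h | h
  · exact h.2 (hiff.1 h.1)
  · exact h.1 (hiff.2 h.2)

open Classical in
/-- The linear map on functions on the groupoid given by a sampled model. -/
noncomputable def sampleMap (μ : Measure X) (K : Finset G) (𝒯 : Finset (Set X)) {d : ℕ}
    (σ : G → Equiv.Perm (Fin d)) (x : Fin d → X) :
    ((G × X) →ₘ[gdMeasure G μ] ℂ) →ₗ[ℂ] Matrix (Fin d) (Fin d) ℂ where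
  toFun f := Matrix.of fun i j =>
    ∑ g ∈ K, if σ g j = i ∧ GoodAt 𝒯 σ x g j then lift (gdMeasure G μ) f (g, x j) else 0
  map_add' f f' := by
    ext i j
    simp only [map_add, Pi.add_apply, Matrix.of_apply, Matrix.add_apply]
    rw [← Finset.sum_add_distrib]
    exact Finset.sum_congr rfl fun g _ => by split_ifs <;> simp
  map_smul' r f := by
    ext i j
    simp only [map_smul, Pi.smul_apply, Matrix.of_apply, Matrix.smul_apply, RingHom.id_apply]
    rw [Finset.smul_sum]
    exact Finset.sum_congr rfl fun g _ => by split_ifs <;> simp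

/-- The translate of a section by its group element. -/
def rngSec (w : InvSemigroup G μ) (g : G) : Set X := (fun y : X => g⁻¹ • y) ⁻¹' sec μ w g

theorem measurableSet_rngSec (w : InvSemigroup G μ) (g : G) : MeasurableSet (rngSec w g) :=
  (measurableSet_sec w g).preimage (measurable_const_smul _)

variable {K : Finset G} {𝒯 : Finset (Set X)} {d : ℕ} {σ : G → Equiv.Perm (Fin d)} {x : Fin d → X}

/-- `SA` asks for exact partial permutations, which is the reason for discarding vertices that fail
a test. If two vertices are sent to `b` over `g` and `h`, the tests place `x b` in both range
sections, injectivity of the range map gives `g = h`, and `σ g` is injective. -/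
theorem exists_pmat_eq_sampleMap (w : InvSemigroup G μ)
    (hT : ∀ g ∈ K, rngSec w g ∈ 𝒯)
    (hx : ∀ v, ∀ g, lift (gdMeasure G μ) (toSpan μ w : (G × X) →ₘ[gdMeasure G μ] ℂ) (g, x v) =
      (sec μ w g).indicator (fun _ => (1 : ℂ)) (x v)) :
    ∃ f : Fin d ≃. Fin d, sampleMap μ K 𝒯 σ x (toSpan μ w : (G × X) →ₘ[gdMeasure G μ] ℂ) = pmat f ∧
      ∀ v u, f v = some u ↔ ∃ g ∈ K, x v ∈ sec μ w g ∧ GoodAt 𝒯 σ x g v ∧ σ g v = u := by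
  classical
  let f₀ : Fin d → Option (Fin d) := fun v =>
    if h : ∃ g ∈ K, x v ∈ sec μ w g ∧ GoodAt 𝒯 σ x g v then some (σ h.choose v) else none
  have hf₀ : ∀ v u, f₀ v = some u ↔ ∃ g ∈ K, x v ∈ sec μ w g ∧ GoodAt 𝒯 σ x g v ∧ σ g v = u := by
    intro v u
    by_cases h : ∃ g ∈ K, x v ∈ sec μ w g ∧ GoodAt 𝒯 σ x g v
    · have h1 : f₀ v = some (σ h.choose v) := dif_pos h
      rw [h1, Option.some.injEq]
      have h2 := h.choose_spec
      constructor
      · rintro e; exact ⟨_, h2.1, h2.2.1, h2.2.2, e⟩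
      · rintro ⟨g, _, hg2, _, hg4⟩
        rw [← hg4, sec_src_inj h2.2.1 hg2]
    · have h1 : f₀ v = none := dif_neg h
      rw [h1]
      constructor
      · intro e; simp at e
      · rintro ⟨g, a, b, c, _⟩; exact absurd ⟨g, a, b, c⟩ h
  obtain ⟨f, hf⟩ := exists_pequiv_of_injOn f₀ (by
    intro a a' b ha ha'
    obtain ⟨g, hg1, hg2, hg3, hg4⟩ := (hf₀ a b).1 ha
    obtain ⟨h, hh1, hh2, hh3, hh4⟩ := (hf₀ a' b).1 ha'
    have e1 : x b ∈ rngSec w g := by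
      rw [← hg4]; exact (hg3 _ (hT g hg1)).1 (by simpa [rngSec] using hg2)
    have e2 : x b ∈ rngSec w h := by
      rw [← hh4]; exact (hh3 _ (hT h hh1)).1 (by simpa [rngSec] using hh2)
    have e3 := sec_rng_inj (w := w) (g := g) (h := h) (x := g⁻¹ • x b) (y := h⁻¹ • x b) e1 e2
      (by simp)
    rw [← e3.1] at hh4
    exact (σ g).injective (hg4.trans hh4.symm))
  refine ⟨f, ?_, fun v u => by rw [hf]; exact hf₀ v u⟩
  ext i j
  rw [pmat_apply, hf]
  have e : sampleMap μ K 𝒯 σ x (toSpan μ w : (G × X) →ₘ[gdMeasure G μ] ℂ) i j =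
      ∑ g ∈ K, if σ g j = i ∧ GoodAt 𝒯 σ x g j then
        (sec μ w g).indicator (fun _ => (1 : ℂ)) (x j) else 0 := by
    simp only [sampleMap, LinearMap.coe_mk, AddHom.coe_mk, Matrix.of_apply]
    exact Finset.sum_congr rfl fun g _ => by rw [hx j g]
  rw [e]
  by_cases h : f₀ j = some i
  · rw [if_pos h]
    obtain ⟨g, hg1, hg2, hg3, hg4⟩ := (hf₀ j i).1 h
    rw [Finset.sum_eq_single g]
    · rw [if_pos ⟨hg4, hg3⟩, Set.indicator_of_mem hg2]
    · intro k _ hk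
      rw [Set.indicator_of_notMem (fun hk' => hk (sec_src_inj hk' hg2)), ite_self]
    · intro hcon; exact absurd hg1 hcon
  · rw [if_neg h]
    refine Finset.sum_eq_zero fun g hg => ?_
    split_ifs with h1
    · exact Set.indicator_of_notMem (fun hg2 => h ((hf₀ j i).2 ⟨g, hg, hg2, h1.2, h1.1⟩)) _
    · rfl

theorem cnt_mem_le {η ε : ℝ} (hM : IsModel μ K 𝒯 η σ x) {T : Set X} (hT : T ∈ 𝒯)
    (h : μ.real T ≤ ε) : cnt (fun v => x v ∈ T) ≤ (ε + η) * d := by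
  have h1 := (abs_le.1 (hM.meas T hT)).2
  have h2 : μ.real T * d ≤ ε * d := by gcongr
  linarith

/-- The partial permutations of a model are approximately multiplicative. -/
theorem cnt_mul_ne_le {η ε : ℝ} (hM : IsModel μ K 𝒯 η σ x) {w w' : InvSemigroup G μ}
    (hsec : ∀ g ∈ K, sec μ w g ∈ 𝒯) (htail : tailSet w K ∈ 𝒯) (htail' : tailSet w' K ∈ 𝒯)
    (htail'' : tailSet (w * w') K ∈ 𝒯) (hε : μ.real (tailSet w K) ≤ ε)
    (hε' : μ.real (tailSet w' K) ≤ ε) (hε'' : μ.real (tailSet (w * w') K) ≤ ε)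
    (hx : ∀ v, ∀ k, x v ∈ sec μ (w * w') k ↔
      ∃ h, x v ∈ sec μ w' h ∧ h • x v ∈ sec μ w (k * h⁻¹))
    {f f' f'' : Fin d ≃. Fin d}
    (hf : ∀ v u, f v = some u ↔ ∃ g ∈ K, x v ∈ sec μ w g ∧ GoodAt 𝒯 σ x g v ∧ σ g v = u)
    (hf' : ∀ v u, f' v = some u ↔ ∃ g ∈ K, x v ∈ sec μ w' g ∧ GoodAt 𝒯 σ x g v ∧ σ g v = u)
    (hf'' : ∀ v u, f'' v = some u ↔
      ∃ g ∈ K, x v ∈ sec μ (w * w') g ∧ GoodAt 𝒯 σ x g v ∧ σ g v = u) :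
    cnt (fun v => f'' v ≠ (f'.trans f) v) ≤
      (3 * (ε + η) + 2 * (K.card * (𝒯.card * η)) + K.card * (K.card * η)) * d := by
  classical
  have b1 := cnt_mem_le hM htail' hε'
  have b2 := cnt_mem_le hM htail'' hε''
  have b3 : cnt (fun v => ∃ u, f' v = some u ∧ x u ∈ tailSet w K) ≤ (ε + η) * d :=
    (cnt_pequiv_le f' _).trans (cnt_mem_le hM htail hε)
  have b4 := cnt_not_goodAt_le hM
  have b5 : cnt (fun v => ∃ u, f' v = some u ∧ ∃ g ∈ K, ¬ GoodAt 𝒯 σ x g u) ≤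
      K.card * (𝒯.card * (η * d)) := (cnt_pequiv_le f' _).trans b4
  have b6 : cnt (fun v => ∃ g ∈ K, ∃ h ∈ K, σ (g * h) v ≠ σ g (σ h v)) ≤
      K.card * (K.card * (η * d)) :=
    cnt_exists_le_mul K _ fun g hg => cnt_exists_le_mul K _ fun h hh => hM.mul g hg h hh
  -- Outside six exceptional sets the arrow of `w * w'` at `x v` factors through an arrow over some
  -- `h ∈ K` and one over `k * h⁻¹ ∈ K`. The tests carry membership in sections from `h • x v` to `x
  -- (σ h v)`, and multiplicativity of `σ` matches the end vertices.
  have key : ∀ v, f'' v ≠ (f'.trans f) v → x v ∈ tailSet w' K ∨ x v ∈ tailSet (w * w') K ∨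
      (∃ u, f' v = some u ∧ x u ∈ tailSet w K) ∨ (∃ g ∈ K, ¬ GoodAt 𝒯 σ x g v) ∨
      (∃ u, f' v = some u ∧ ∃ g ∈ K, ¬ GoodAt 𝒯 σ x g u) ∨
      (∃ g ∈ K, ∃ h ∈ K, σ (g * h) v ≠ σ g (σ h v)) := by
    intro v hv
    by_contra hcon
    push Not at hcon
    obtain ⟨c1, c2, c3, c4, c5, c6⟩ := hcon
    apply hv
    have htr : ∀ i, (f'.trans f) v = some i ↔ ∃ u, f' v = some u ∧ f u = some i := fun i => by
      have := PEquiv.mem_trans f' f v i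
      simpa [Option.mem_def] using this
    apply Option.ext
    intro i
    rw [htr i]
    by_cases hex : ∃ h, x v ∈ sec μ w' h
    · obtain ⟨h, hh⟩ := hex
      have hK : h ∈ K := by
        by_contra hK; exact c1 (mem_tailSet hh hK)
      have hg := c4 h hK
      have hfu : f' v = some (σ h v) := (hf' v _).2 ⟨h, hK, hh, hg, rfl⟩
      have htl : h • x v ∉ tailSet w K := fun hc => c3 _ hfu ((hg _ htail).1 hc)
      constructor
      · intro h1
        obtain ⟨k, hk1, hk2, hk3, hk4⟩ := (hf'' v i).1 h1
        obtain ⟨h', hh', hk'⟩ := (hx v k).1 hk2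
        obtain rfl := sec_src_inj hh hh'
        have hgK : k * h⁻¹ ∈ K := by
          by_contra hc; exact htl (mem_tailSet hk' hc)
        have hxu : x (σ h v) ∈ sec μ w (k * h⁻¹) := (hg _ (hsec _ hgK)).1 hk'
        refine ⟨σ h v, hfu, (hf _ _).2 ⟨k * h⁻¹, hgK, hxu, c5 _ hfu _ hgK, ?_⟩⟩
        rw [← c6 _ hgK _ hK, inv_mul_cancel_right, hk4]
      · rintro ⟨u, hu, hfi⟩
        obtain rfl : σ h v = u := Option.some.inj (hfu.symm.trans hu)
        obtain ⟨g, hg1, hg2, hg3, hg4⟩ := (hf _ _).1 hfi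
        have hxg : h • x v ∈ sec μ w g := (hg _ (hsec _ hg1)).2 hg2
        have hxk : x v ∈ sec μ (w * w') (g * h) := (hx v _).2 ⟨h, hh, by simpa using hxg⟩
        have hkK : g * h ∈ K := by
          by_contra hc; exact c2 (mem_tailSet hxk hc)
        refine (hf'' v i).2 ⟨g * h, hkK, hxk, c4 _ hkK, ?_⟩
        rw [c6 _ hg1 _ hK, hg4]
    · constructor
      · intro h1
        obtain ⟨k, _, hk2, _, _⟩ := (hf'' v i).1 h1
        obtain ⟨h', hh', _⟩ := (hx v k).1 hk2
        exact absurd ⟨h', hh'⟩ hex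
      · rintro ⟨u, hu, _⟩
        obtain ⟨g, _, hg2, _⟩ := (hf' _ _).1 hu
        exact absurd ⟨g, hg2⟩ hex
  have t1 := cnt_le_of_or key
  refine t1.trans ?_
  have t2 := cnt_or_le (fun v => x v ∈ tailSet (w * w') K) (fun v =>
      (∃ u, f' v = some u ∧ x u ∈ tailSet w K) ∨ (∃ g ∈ K, ¬ GoodAt 𝒯 σ x g v) ∨
      (∃ u, f' v = some u ∧ ∃ g ∈ K, ¬ GoodAt 𝒯 σ x g u) ∨
      (∃ g ∈ K, ∃ h ∈ K, σ (g * h) v ≠ σ g (σ h v)))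
  have t3 := cnt_or_le (fun v => ∃ u, f' v = some u ∧ x u ∈ tailSet w K) (fun v =>
      (∃ g ∈ K, ¬ GoodAt 𝒯 σ x g v) ∨
      (∃ u, f' v = some u ∧ ∃ g ∈ K, ¬ GoodAt 𝒯 σ x g u) ∨
      (∃ g ∈ K, ∃ h ∈ K, σ (g * h) v ≠ σ g (σ h v)))
  have t4 := cnt_or_le (fun v => ∃ g ∈ K, ¬ GoodAt 𝒯 σ x g v) (fun v =>
      (∃ u, f' v = some u ∧ ∃ g ∈ K, ¬ GoodAt 𝒯 σ x g u) ∨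
      (∃ g ∈ K, ∃ h ∈ K, σ (g * h) v ≠ σ g (σ h v)))
  have t5 := cnt_or_le (fun v => ∃ u, f' v = some u ∧ ∃ g ∈ K, ¬ GoodAt 𝒯 σ x g u)
    (fun v => ∃ g ∈ K, ∃ h ∈ K, σ (g * h) v ≠ σ g (σ h v))
  linarith

/-- Arrows over `g ≠ 1` produce few fixed vertices by almost freeness. Over `1` no vertex is lost,
since `σ 1 = 1` makes every test succeed. -/
theorem abs_cnt_fixed_sub_le {η : ℝ} (hM : IsModel μ K 𝒯 η σ x) {w : InvSemigroup G μ}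
    (h1 : 1 ∈ K) (hT : sec μ w 1 ∈ 𝒯) {f : Fin d ≃. Fin d}
    (hf : ∀ v u, f v = some u ↔ ∃ g ∈ K, x v ∈ sec μ w g ∧ GoodAt 𝒯 σ x g v ∧ σ g v = u) :
    |cnt (fun v => f v = some v) - μ.real (sec μ w 1) * d| ≤ (K.card + 1) * (η * d) := by
  classical
  have a1 := hM.meas _ hT
  have a2 : |cnt (fun v => f v = some v) - cnt (fun v => x v ∈ sec μ w 1)| ≤
      K.card * (η * d) := by
    have b : cnt (fun v => ∃ g ∈ K.erase 1, σ g v = v) ≤ (K.erase 1).card * (η * d) :=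
      cnt_exists_le_mul _ _ fun g hg =>
        hM.free g (Finset.mem_of_mem_erase hg) (Finset.ne_of_mem_erase hg)
    have hηd : 0 ≤ η * d := le_trans (abs_nonneg _) a1
    refine (abs_cnt_sub_le (r := fun v => ∃ g ∈ K.erase 1, σ g v = v) ?_).trans (b.trans ?_)
    · intro v hv
      rw [hf v v]
      constructor
      · rintro ⟨g, hg, hg2, _, hg4⟩
        have : g = 1 := by
          by_contra hne
          exact hv ⟨g, Finset.mem_erase.2 ⟨hne, hg⟩, hg4⟩
        rwa [this] at hg2
      · intro hm
        refine ⟨1, h1, hm, ?_, by simp [hM.one]⟩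
        intro T _
        simp [hM.one]
    · gcongr
      exact Finset.erase_subset _ _
  have := abs_sub_le (cnt fun v => f v = some v) (cnt fun v => x v ∈ sec μ w 1)
    (μ.real (sec μ w 1) * d)
  linarith

end ModelToSA

/-! ### Approximately multiplicative maps built from models -/

section ModelToSA

variable {G X : Type*} [Group G] [MulAction G X] [MeasurableSpace X] [MeasurableSpace G]
  [Countable G] [DiscreteMeasurableSpace G] [MeasurableConstSMul G X]
  (μ : Measure X) [IsProbabilityMeasure μ] [SMulInvariantMeasure G X μ]

/-- The element of the inverse semigroup given by a group element. -/
noncomputable def unitary (g : G) : InvSemigroup G μ := arr μ g MeasurableSet.univ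

theorem exists_finset_products (S : Finset (InvSemigroup G μ)) (n : ℕ) :
    ∃ W : Finset (InvSemigroup G μ), S ⊆ W ∧
      ∀ l : List (InvSemigroup G μ), l.length ≤ n → (∀ s ∈ l, s ∈ S) → l.prod ∈ W := by
  classical
  have hfin := (List.finite_length_le S n).image
    (fun l : List S => (l.map Subtype.val).prod)
  refine ⟨S ∪ hfin.toFinset, Finset.subset_union_left, fun l hl hs => ?_⟩
  refine Finset.mem_union_right _ (hfin.mem_toFinset.2 ⟨l.pmap (fun a ha => ⟨a, ha⟩) hs, ?_, ?_⟩)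
  · simpa using hl
  · change ((List.pmap (fun a ha => (⟨a, ha⟩ : S)) l hs).map Subtype.val).prod = l.prod
    rw [List.map_pmap]
    simp

/-- List products are nested to the right, so an induction on the first letter needs only the defect
of `a * l.prod`. Neither associativity nor unit laws of `I` are used. -/
theorem exists_pmat_eq_list_prod {I : Type*} [Mul I] [One I] {d : ℕ}
    (ψ : I → Matrix (Fin d) (Fin d) ℂ) (f : I → (Fin d ≃. Fin d)) (S : Finset I) (n : ℕ) {c : ℝ}
    (hone : ∀ v, f 1 v = some v) (hψ : ∀ s ∈ S, ψ s = pmat (f s))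
    (hmul : ∀ a ∈ S, ∀ l : List I, l.length + 1 ≤ n → (∀ s ∈ l, s ∈ S) →
      cnt (fun v => f (a * l.prod) v ≠ ((f l.prod).trans (f a)) v) ≤ c)
    (l : List I) (hl : l.length ≤ n) (hs : ∀ s ∈ l, s ∈ S) :
    ∃ q : Fin d ≃. Fin d, (l.map ψ).prod = pmat q ∧
      cnt (fun v => f l.prod v ≠ q v) ≤ l.length * c := by
  induction l with
  | nil =>
    refine ⟨PEquiv.refl _, by simp [pmat], ?_⟩
    rw [cnt_eq_zero]
    · simp
    · intro v
      rw [not_not]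
      exact hone v
  | cons a l ih =>
    have hl' : l.length + 1 ≤ n := by simpa using hl
    have hs' : ∀ s ∈ l, s ∈ S := fun s h => hs s (List.mem_cons_of_mem _ h)
    obtain ⟨q, hq1, hq2⟩ := ih (by omega) hs'
    have ha : a ∈ S := hs a (by simp)
    refine ⟨q.trans (f a), ?_, ?_⟩
    · rw [List.map_cons, List.prod_cons, hq1, hψ a ha, pmat_mul]
    · have h1 := hmul a ha l hl' hs'
      have hb : cnt (fun v => f (a * l.prod) v ≠ (q.trans (f a)) v) ≤
          cnt (fun v => f (a * l.prod) v ≠ ((f l.prod).trans (f a)) v) +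
            cnt (fun v => f l.prod v ≠ q v) := by
        refine cnt_le_of_or fun v hv => ?_
        by_contra hcon
        push Not at hcon
        apply hv
        rw [hcon.1]
        change (f _ v).bind _ = (q v).bind _
        rw [hcon.2]
      rw [List.prod_cons, List.length_cons]
      push_cast
      linarith

set_option maxHeartbeats 1000000 in
/-- Every good enough model yields an approximately multiplicative linear map which is close to the
model on given group elements. -/
theorem exists_mem_SA_of_isModel (F₀ : Finset (InvSemigroup G μ)) (n₀ : ℕ) {δ₀ : ℝ} (hδ₀ : 0 < δ₀)
    (E : Finset G) {κ : ℝ} (hκ : 0 < κ) :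
    ∃ (K : Finset G) (𝒯 : Finset (Set X)) (η : ℝ) (X₀ : Set X), (∀ T ∈ 𝒯, MeasurableSet T) ∧
      0 < η ∧ X₀ ∈ ae μ ∧ ∀ (d : ℕ), 0 < d → ∀ (σ : G → Equiv.Perm (Fin d)) (x : Fin d → X),
        IsModel μ K 𝒯 η σ x → (∀ v, x v ∈ X₀) →
          ∃ φ ∈ SA μ F₀ n₀ δ₀ d, ∀ s ∈ E,
            cnt (fun v => ¬ ∀ i, φ (toSpan μ (unitary μ s)) i v = if σ s v = i then 1 else 0) ≤
              κ * d := by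
  classical
  let S : Finset (InvSemigroup G μ) := F₀ ∪ F₀.image star
  obtain ⟨W₁, hSW, hW₁⟩ := exists_finset_products μ S n₀
  let W : Finset (InvSemigroup G μ) := W₁ ∪ E.image (unitary μ)
  -- A multiplication will be wrong at no more than `4 ε d` vertices. For `n₀` letters, and with the
  -- factor two between Hamming distance and squared norm, this makes `8 n₀ ε < δ₀ ^ 2`.
  let ε : ℝ := δ₀ ^ 2 / (12 * (n₀ + 1))
  have hε : 0 < ε := by positivity
  obtain ⟨K₀, hK₀⟩ := exists_forall_tailSet_le W hε
  let K : Finset G := K₀ ∪ E ∪ {1}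
  have h1K : (1 : G) ∈ K := by simp [K]
  have hEK : E ⊆ K := fun s hs => by simp [K, hs]
  have htail : ∀ w ∈ W, μ.real (tailSet w K) ≤ ε :=
    hK₀ K (by intro g hg; simp [K, hg])
  let 𝒯 : Finset (Set X) := (W ×ˢ K).image (fun z => sec μ z.1 z.2) ∪
    (W ×ˢ K).image (fun z => rngSec z.1 z.2) ∪ W.image (fun w => tailSet w K)
  have hT1 : ∀ w ∈ W, ∀ g ∈ K, sec μ w g ∈ 𝒯 := fun w hw g hg =>
    Finset.mem_union_left _ (Finset.mem_union_left _ (Finset.mem_image.2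
      ⟨(w, g), Finset.mem_product.2 ⟨hw, hg⟩, rfl⟩))
  have hT2 : ∀ w ∈ W, ∀ g ∈ K, rngSec w g ∈ 𝒯 := fun w hw g hg =>
    Finset.mem_union_left _ (Finset.mem_union_right _ (Finset.mem_image.2
      ⟨(w, g), Finset.mem_product.2 ⟨hw, hg⟩, rfl⟩))
  have hT3 : ∀ w ∈ W, tailSet w K ∈ 𝒯 := fun w hw =>
    Finset.mem_union_right _ (Finset.mem_image.2 ⟨w, hw, rfl⟩)
  -- `C` adds up the coefficients of `η` in the multiplication and trace estimates. The number of
  -- vertices failing a test is bounded separately through `κ`.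
  let C : ℝ := 3 + 2 * (K.card * 𝒯.card) + K.card * K.card + (K.card + 1)
  have hC : 0 < C := by positivity
  let η : ℝ := min (min ε (κ / (K.card * 𝒯.card + 1))) (δ₀ / 2) / C
  have hη : 0 < η := by positivity
  have hηC : η * C = min (min ε (κ / (K.card * 𝒯.card + 1))) (δ₀ / 2) :=
    div_mul_cancel₀ _ hC.ne'
  have hηε : η * C ≤ ε := hηC.le.trans ((min_le_left _ _).trans (min_le_left _ _))
  have hηδ : η * C ≤ δ₀ / 2 := hηC.le.trans (min_le_right _ _)
  have hC1 : 1 ≤ C := by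
    have : (0 : ℝ) ≤ 2 * (K.card * 𝒯.card) + K.card * K.card + (K.card + 1) := by positivity
    simp only [C]; linarith
  have hηκ : K.card * (𝒯.card * η) ≤ κ := by
    have h1 : η * C ≤ κ / (K.card * 𝒯.card + 1) :=
      hηC.le.trans ((min_le_left _ _).trans (min_le_right _ _))
    have h2 : η ≤ κ / (K.card * 𝒯.card + 1) := by nlinarith
    rw [le_div_iff₀ (by positivity)] at h2
    nlinarith
  let X₀ : Set X := {y | (∀ w : W, ∀ g, lift (gdMeasure G μ)
      (toSpan μ (w : InvSemigroup G μ) : (G × X) →ₘ[gdMeasure G μ] ℂ) (g, y) =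
        (sec μ (w : InvSemigroup G μ) g).indicator (fun _ => (1 : ℂ)) y) ∧
    (∀ z : W × W, ∀ k, y ∈ sec μ (z.1 * z.2 : InvSemigroup G μ) k ↔
      ∃ h, y ∈ sec μ (z.2 : InvSemigroup G μ) h ∧
        h • y ∈ sec μ (z.1 : InvSemigroup G μ) (k * h⁻¹)) ∧
    (∀ g, y ∈ sec μ (1 : InvSemigroup G μ) g ↔ g = 1) ∧
    (∀ s : E, ∀ g, y ∈ sec μ (unitary μ (s : G)) g ↔ g = (s : G) ∧ y ∈ Set.univ)}
  have hX₀ : X₀ ∈ ae μ := by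
    have h1 := ae_all_iff.2 fun w : W => lift_toSpan_ae (w : InvSemigroup G μ)
    have h2 := ae_all_iff.2 fun z : W × W =>
      sec_mul (z.1 : InvSemigroup G μ) (z.2 : InvSemigroup G μ)
    have h3 := sec_one (G := G) (μ := μ)
    have h4 := ae_all_iff.2 fun s : E => sec_arr (μ := μ) (s : G) MeasurableSet.univ
    filter_upwards [h1, h2, h3, h4] with y a b c e using ⟨a, b, c, e⟩
  refine ⟨K, 𝒯, η, X₀, ?_, hη, hX₀, ?_⟩
  · intro T hT
    rcases Finset.mem_union.1 hT with h | h
    · rcases Finset.mem_union.1 h with h | h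
      · obtain ⟨z, _, rfl⟩ := Finset.mem_image.1 h
        exact measurableSet_sec _ _
      · obtain ⟨z, _, rfl⟩ := Finset.mem_image.1 h
        exact measurableSet_rngSec _ _
    · obtain ⟨z, _, rfl⟩ := Finset.mem_image.1 h
      exact measurableSet_tailSet _ _
  · intro d hd σ x hM hx
    have hd' : (0 : ℝ) < d := by exact_mod_cast hd
    have hrep : ∀ w : InvSemigroup G μ, ∃ f : Fin d ≃. Fin d, w ∈ W →
        sampleMap μ K 𝒯 σ x (toSpan μ w : (G × X) →ₘ[gdMeasure G μ] ℂ) = pmat f ∧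
          ∀ v u, f v = some u ↔ ∃ g ∈ K, x v ∈ sec μ w g ∧ GoodAt 𝒯 σ x g v ∧ σ g v = u := by
      intro w
      by_cases hw : w ∈ W
      · obtain ⟨f, hf⟩ := exists_pmat_eq_sampleMap w (hT2 w hw) (fun v => (hx v).1 ⟨w, hw⟩)
        exact ⟨f, fun _ => hf⟩
      · exact ⟨PEquiv.refl _, fun h => absurd h hw⟩
    choose f hf using hrep
    let φ : spanI G μ →ₗ[ℂ] Matrix (Fin d) (Fin d) ℂ :=
      (sampleMap μ K 𝒯 σ x).comp (spanI G μ).subtype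
    have hφ : ∀ w ∈ W, φ (toSpan μ w) = pmat (f w) := fun w hw => (hf w hw).1
    have hmem : ∀ l : List (InvSemigroup G μ), l.length ≤ n₀ → (∀ s ∈ l, s ∈ S) → l.prod ∈ W :=
      fun l hl hs => Finset.mem_union_left _ (hW₁ l hl hs)
    have hSW' : ∀ s ∈ S, s ∈ W := fun s hs => Finset.mem_union_left _ (hSW hs)
    have hlist := exists_pmat_eq_list_prod (fun s => φ (toSpan μ s)) f S n₀ (c := 4 * ε * d) (by
        intro v
        have h1W : (1 : InvSemigroup G μ) ∈ W := hmem [] (Nat.zero_le _) (by simp)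
        refine ((hf _ h1W).2 v v).2 ⟨1, h1K, ((hx v).2.2.1 1).2 rfl, ?_, by simp [hM.one]⟩
        intro T _
        simp [hM.one]) (fun s hs => hφ s (hSW' s hs)) (by
        intro a ha l hl hs
        have haW : a ∈ W := hSW' a ha
        have hpW := hmem l (by omega) hs
        have hapW : a * l.prod ∈ W := hmem (a :: l) hl (by
          intro s h
          rcases List.mem_cons.1 h with rfl | h
          · exact ha
          · exact hs s h)
        have hmul := cnt_mul_ne_le (ε := ε) hM (hT1 a haW) (hT3 a haW) (hT3 _ hpW) (hT3 _ hapW)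
            (htail a haW) (htail _ hpW) (htail _ hapW)
            (fun v => (hx v).2.1 (⟨a, haW⟩, ⟨_, hpW⟩)) (hf _ haW).2 (hf _ hpW).2 (hf _ hapW).2
        have hbound : (3 * (ε + η) + 2 * (K.card * (𝒯.card * η)) + K.card * (K.card * η)) ≤
            4 * ε := by
          have : 3 * η + 2 * (K.card * (𝒯.card * η)) + K.card * (K.card * η) ≤ η * C := by
            simp only [C]
            have : 0 ≤ η * (K.card + 1) := by positivity
            linarith
          linarith
        exact hmul.trans (mul_le_mul_of_nonneg_right hbound hd'.le))
    refine ⟨φ, ?_, ?_⟩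
    · intro l _ hl hs
      have hs' : ∀ s ∈ l, s ∈ S := by
        intro s h
        rcases hs s h with h | ⟨t, ht, rfl⟩
        · exact Finset.mem_union_left _ h
        · exact Finset.mem_union_right _ (Finset.mem_image.2 ⟨t, ht, rfl⟩)
      have hlW := hmem l hl hs'
      obtain ⟨q, hq1, hq2⟩ := hlist l hl hs'
      refine ⟨?_, ?_, ?_⟩
      · apply norm2_lt_of_sq hδ₀
        rw [hq1, hφ _ hlW]
        refine (norm2_le_cnt_ne _ _).trans_lt ?_
        rw [div_lt_iff₀ hd']
        have hl2 : (l.length : ℝ) ≤ n₀ := by exact_mod_cast hl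
        have h1 : (l.length : ℝ) * (4 * ε * d) ≤ n₀ * (4 * ε * d) := by gcongr
        have h2 : ε * (12 * (n₀ + 1)) = δ₀ ^ 2 := div_mul_cancel₀ _ (by positivity)
        have h3 : 0 < δ₀ ^ 2 * d := by positivity
        have h4 : 12 * (n₀ * ε * d) ≤ δ₀ ^ 2 * d := by
          rw [← h2]
          have : 0 ≤ ε * d := by positivity
          nlinarith
        linarith
      · rw [hφ _ hlW]
        exact mem_partialPerms.2 ⟨_, rfl⟩
      · rw [hφ _ hlW, tr_pmat, tau_toSpan, ← Complex.ofReal_sub, Complex.norm_real,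
          Real.norm_eq_abs]
        have h1 := abs_cnt_fixed_sub_le hM h1K (hT1 _ hlW 1 h1K) (hf _ hlW).2
        have e : cnt (fun v => f l.prod v = some v) / d - μ.real (sec μ l.prod 1) =
            (cnt (fun v => f l.prod v = some v) - μ.real (sec μ l.prod 1) * d) / d := by
          field_simp
        rw [e, abs_div, abs_of_pos hd', div_lt_iff₀ hd']
        have h2 : (K.card + 1) * η ≤ η * C := by
          simp only [C]
          have : 0 ≤ η * (3 + 2 * (K.card * 𝒯.card) + K.card * K.card) := by positivity
          linarith
        have h3 : (K.card + 1) * η * d ≤ δ₀ / 2 * d := by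
          gcongr
          exact h2.trans hηδ
        have h4 : 0 < δ₀ * d := by positivity
        linarith
    · intro s hs
      have hsW : unitary μ s ∈ W := Finset.mem_union_right _ (Finset.mem_image.2 ⟨s, hs, rfl⟩)
      have hb := cnt_not_goodAt_le hM
      refine (cnt_mono fun v hv => ?_).trans (hb.trans ?_)
      · by_contra hcon
        push Not at hcon
        apply hv
        intro i
        -- At a vertex passing all tests the bisection of `s` has exactly one arrow, the one over
        -- `s`, so the column of its image is the basis vector at `σ s v`.
        have hfv : f (unitary μ s) v = some (σ s v) :=
          ((hf _ hsW).2 v _).2 ⟨s, hEK hs, ((hx v).2.2.2 ⟨s, hs⟩ s).2 ⟨rfl, trivial⟩,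
            hcon s (hEK hs), rfl⟩
        rw [hφ _ hsW, pmat_apply, hfv]
        simp
      · have := mul_le_mul_of_nonneg_right hηκ hd'.le
        linarith

end ModelToSA


/-! ## From separate models for the group and the space to sampled models -/

section GroupModels

variable {G : Type*} [Group G]

theorem cnt_perm_ne_le {d : ℕ} (hd : 0 < d) {σ τ : Equiv.Perm (Fin d)} {δ : ℝ}
    (h : norm2 (permMat σ - permMat τ) < δ) : cnt (fun v => σ v ≠ τ v) ≤ δ ^ 2 * d := by
  rw [← cnt_congr fun v => perm_ne_iff σ τ v]
  refine (cnt_ne_le_norm2 hd _ _).trans ?_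
  rw [← permMat_eq_pmat, ← permMat_eq_pmat]
  have h0 := norm2_nonneg (permMat σ - permMat τ)
  gcongr

/-- Write `g` and `h` as words; the words for `g`, for `h` and for the concatenation each cost `δ ^
2` in relative Hamming distance. -/
theorem cnt_mul_ne_le_of_mem_GA {F : Finset G} {n : ℕ} {δ : ℝ} {d : ℕ} (hd : 0 < d)
    {σ : G → Equiv.Perm (Fin d)} (hσ : σ ∈ GA F n δ d) {a b : ℕ} (hab : a + b ≤ n) {g h : G}
    (hg : g ∈ window F a) (hh : h ∈ window F b) :
    cnt (fun v => σ (g * h) v ≠ σ g (σ h v)) ≤ 3 * δ ^ 2 * d := by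
  obtain ⟨l, hl1, hl2, rfl⟩ := exists_list_of_mem_window hg
  obtain ⟨k, hk1, hk2, rfl⟩ := exists_list_of_mem_window hh
  have key : ∀ l : List G, l.length ≤ n → (∀ s ∈ l, s ∈ symmSet F) →
      cnt (fun v => σ l.prod v ≠ (l.map σ).prod v) ≤ δ ^ 2 * d := by
    intro l hl hs
    -- `GA` controls words of length exactly `n`. Shorter words are padded with the letter `1`,
    -- which is harmless because `σ 1 = 1`.
    have h1 := hσ.2.1 (l ++ List.replicate (n - l.length) 1) (by simp; omega) (by
      intro s h
      rcases List.mem_append.1 h with h | h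
      · exact hs s h
      · rw [List.eq_of_mem_replicate h]; exact one_mem_symmSet F)
    rw [List.prod_append, List.prod_replicate, one_pow, mul_one, List.map_append, List.prod_append,
      List.map_replicate, hσ.1, List.prod_replicate, one_pow, mul_one] at h1
    exact cnt_perm_ne_le hd h1
  have h1 := key l (by omega) hl2
  have h2 := key k (by omega) hk2
  have h3 := key (l ++ k) (by simp; omega) (by
    intro s h
    rcases List.mem_append.1 h with h | h
    · exact hl2 s h
    · exact hk2 s h)
  rw [List.prod_append, List.map_append, List.prod_append] at h3
  have h4 : cnt (fun v => σ l.prod (σ k.prod v) ≠ (l.map σ).prod (σ k.prod v)) ≤ δ ^ 2 * d := by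
    rw [cnt_perm (σ k.prod) (fun v => σ l.prod v ≠ (l.map σ).prod v)]; exact h1
  have h5 : cnt (fun v => σ (l.prod * k.prod) v ≠ σ l.prod (σ k.prod v)) ≤
      cnt (fun v => σ (l.prod * k.prod) v ≠ ((l.map σ).prod * (k.map σ).prod) v) +
        (cnt (fun v => σ k.prod v ≠ (k.map σ).prod v) +
          cnt (fun v => σ l.prod (σ k.prod v) ≠ (l.map σ).prod (σ k.prod v))) := by
    refine (cnt_le_of_or (r := fun v => σ k.prod v ≠ (k.map σ).prod v ∨
      σ l.prod (σ k.prod v) ≠ (l.map σ).prod (σ k.prod v)) fun v hv => ?_).trans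
      (add_le_add_right (cnt_or_le _ _) _)
    by_contra hcon
    push Not at hcon
    apply hv
    rw [hcon.1, hcon.2.2, hcon.2.1, Equiv.Perm.mul_apply]
  linarith

end GroupModels

/-! ### Labellings of vertices by atoms, and the corresponding cells -/

section Labels

variable {G X : Type*} [Group G] [MulAction G X] [MeasurableSpace X] {μ : Measure X}
  [MeasurableConstSMul G X] [SMulInvariantMeasure G X μ] [IsProbabilityMeasure μ]

/-- A homomorphism on the span of the translates of a partition is given by a labelling of the
vertices with choice functions. -/
theorem exists_labelling {F : Finset G} {P : Finset (Linfty μ)} (hP : IsProjPartition P) {n : ℕ}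
    {δ : ℝ} {d : ℕ} (hd : 0 < d) {σ : G → Equiv.Perm (Fin d)}
    {φ : domHA F P n →ₗ[ℂ] (Fin d → ℂ)} (h : (σ, φ) ∈ HA F P n δ d) :
    ∃ c : Fin d → (window F n → P),
      (∀ v, transl (window F n) P (c v) ≠ 0) ∧
      (∀ c', |cnt (fun v => c v = c') - μ.real (pset (transl (window F n) P c')) * d| ≤ δ * d) ∧
      ∀ (s : window F n) (p : P),
        cnt (fun v => ¬ (c v s = p ↔ c ((σ s)⁻¹ v) ⟨1, one_mem_window F n⟩ = p)) ≤ δ ^ 2 * d := by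
  classical
  obtain ⟨_, ⟨hφ1, hφmul⟩, htr, heq⟩ := h
  simp only at hφ1 hφmul htr heq
  have hd' : (0 : ℝ) < d := by exact_mod_cast hd
  set W := window F n with hW
  let t : (W → P) → domHA F P n := fun c => ⟨transl W P c, transl_mem_domHA hP c⟩
  have hidem : ∀ c v, φ (t c) v = 0 ∨ φ (t c) v = 1 := by
    intro c v
    have h1 := congrFun (hφmul (t c) (t c) (t c) (transl_idem hP c).symm) v
    rw [Pi.mul_apply] at h1
    have : φ (t c) v * (φ (t c) v - 1) = 0 := by rw [mul_sub, ← h1]; ring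
    rcases mul_eq_zero.1 this with h | h
    · exact Or.inl h
    · exact Or.inr (sub_eq_zero.1 h)
  -- Evaluation at `v` is a character of the finite-dimensional algebra: it is zero or one on each
  -- atom, and the atoms sum to `1`, so some atom has value one. Orthogonality makes it unique, and
  -- it is the label of `v`.
  have hex : ∀ v, ∃ c, φ (t c) v = 1 := by
    intro v
    by_contra hcon
    push Not at hcon
    have h0 : ∀ c, φ (t c) v = 0 := fun c => (hidem c v).resolve_right (hcon c)
    have h1 : φ (∑ c, t c) = 1 := hφ1 _ (by
      rw [Submodule.coe_sum]
      exact (Finset.sum_congr rfl fun c _ => rfl).trans (by convert sum_transl W hP))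
    have h2 := congrFun h1 v
    rw [map_sum, Finset.sum_apply, Finset.sum_eq_zero fun c _ => h0 c] at h2
    simp at h2
  choose c hc using hex
  have hzero : ∀ a : domHA F P n, (a : Linfty μ) = 0 → φ a = 0 := by
    intro a ha
    have : a = 0 := Subtype.ext ha
    rw [this, map_zero]
  have hlab : ∀ c' v, φ (t c') v = if c v = c' then 1 else 0 := by
    intro c' v
    split_ifs with hcc
    · rw [← hcc, hc]
    · have h1 := congrFun (hφmul (t (c v)) (t c') 0 (transl_mul_transl hP hcc).symm) v
      rw [map_zero, Pi.mul_apply, hc, one_mul] at h1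
      exact h1.symm
  have hact : ∀ (s : W) (p : P) (b : domHA F P n), (b : Linfty μ) = act (s : G) (p : Linfty μ) →
      ∀ v, φ b v = if c v s = p then 1 else 0 := by
    intro s p b hb v
    have h0 := act_mul_transl hP (c v) s p
    split_ifs at h0 ⊢ with hcc
    · have h1 := congrFun (hφmul b (t (c v)) (t (c v)) (by rw [hb]; exact h0.symm)) v
      rw [Pi.mul_apply, hc, mul_one] at h1
      exact h1.symm
    · have h1 := congrFun (hφmul b (t (c v)) 0 (by rw [hb]; exact h0.symm)) v
      rw [map_zero, Pi.mul_apply, hc, mul_one] at h1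
      exact h1.symm
  refine ⟨c, ?_, ?_, ?_⟩
  · intro v h0
    have h1 := hc v
    rw [hzero _ h0] at h1
    simp at h1
  · intro c'
    have h1 := htr (t c') (by rw [translates_eq_range _ _ hP.nonempty]; exact ⟨c', rfl⟩)
    have hsum : ∑ v, φ (t c') v = (cnt (fun v => c v = c') : ℂ) := by
      rw [← sum_ite_cnt]
      push_cast
      refine Finset.sum_congr rfl fun v _ => ?_
      rw [hlab]
      split_ifs <;> simp
    rw [tr_diagonal, hsum, integral_proj (transl_idem hP c'), ← Complex.ofReal_natCast,
      ← Complex.ofReal_div, ← Complex.ofReal_sub, Complex.norm_real, Real.norm_eq_abs] at h1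
    have e : cnt (fun v => c v = c') / d - μ.real (pset (transl W P c')) =
        (cnt (fun v => c v = c') - μ.real (pset (transl W P c')) * d) / d := by
      field_simp
    rw [e, abs_div, abs_of_pos hd', div_lt_iff₀ hd'] at h1
    exact h1.le
  · intro s p
    have h1 := heq s s.2 ⟨p, mem_domHA hP p.2⟩ ⟨act (s : G) (p : Linfty μ), act_mem_domHA hP s.2 p.2⟩
      p.2 rfl
    rw [permMat_conj_diagonal] at h1
    have h2 : norm2 (Matrix.diagonal (φ ⟨act (s : G) (p : Linfty μ), act_mem_domHA hP s.2 p.2⟩) -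
        Matrix.diagonal fun v => φ ⟨p, mem_domHA hP p.2⟩ ((σ (s : G))⁻¹ v)) ^ 2 ≤ δ ^ 2 := by
      have h0 := norm2_nonneg (Matrix.diagonal
        (φ ⟨act (s : G) (p : Linfty μ), act_mem_domHA hP s.2 p.2⟩) -
        Matrix.diagonal fun v => φ ⟨p, mem_domHA hP p.2⟩ ((σ (s : G))⁻¹ v))
      gcongr
    rw [norm2_diagonal_sub, div_le_iff₀ hd'] at h2
    refine le_trans (le_of_eq ?_) h2
    rw [← sum_ite_cnt]
    refine Finset.sum_congr rfl fun v _ => ?_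
    rw [hact s p _ rfl, hact ⟨1, one_mem_window F n⟩ p _ (act_one_left (p : Linfty μ)).symm]
    by_cases h1 : c v s = p <;> by_cases h2 : c ((σ (s : G))⁻¹ v) ⟨1, one_mem_window F n⟩ = p <;>
      simp only [h1, h2, if_true, if_false] <;> simp

/-- The cells of the translates of a partition, inside a given conull set. -/
theorem exists_cells (W : Finset G) {P : Finset (Linfty μ)} (hP : IsProjPartition P) {X₀ : Set X}
    (hX₀ : X₀ ∈ ae μ) :
    ∃ cell : (W → P) → Set X, (∀ c, MeasurableSet (cell c)) ∧ (∀ c, cell c ⊆ X₀) ∧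
      (∀ c, ∀ y ∈ cell c, ∀ (s : W) (p : P), (s : G)⁻¹ • y ∈ pset (p : Linfty μ) ↔ c s = p) ∧
      (∀ c, μ.real (cell c) = μ.real (pset (transl W P c))) ∧
      (∀ᵐ y ∂μ, ∃ c, y ∈ cell c) ∧ ∀ c, transl W P c ≠ 0 → (cell c).Nonempty := by
  classical
  have h1 : ∀ᵐ y ∂μ, ∃! p : P, y ∈ pset (p : Linfty μ) := by
    have hpr : ∀ᵐ y ∂μ, ∀ p : P, ((p : Linfty μ) : X →ₘ[μ] ℂ) y =
        (pset (p : Linfty μ)).indicator (fun _ => (1 : ℂ)) y :=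
      ae_all_iff.2 fun p => proj_ae (hP.idem p.2)
    have hsum : ∀ᵐ y ∂μ, ∑ p : P, ((p : Linfty μ) : X →ₘ[μ] ℂ) y = 1 := by
      have hgen : ∀ I : Finset P, ∀ᵐ y ∂μ, ((∑ p ∈ I, (p : Linfty μ) : Linfty μ) : X →ₘ[μ] ℂ) y =
          ∑ p ∈ I, ((p : Linfty μ) : X →ₘ[μ] ℂ) y := by
        intro I
        induction I using Finset.induction_on with
        | empty =>
          filter_upwards [AEEqFun.coeFn_zero (α := X) (β := ℂ) (μ := μ)] with y hy
          simp [hy]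
        | insert a s ha ih =>
          filter_upwards [ih, AEEqFun.coeFn_add ((a : Linfty μ) : X →ₘ[μ] ℂ)
            ((∑ p ∈ s, (p : Linfty μ) : Linfty μ) : X →ₘ[μ] ℂ)] with y h1 h2
          rw [Finset.sum_insert ha, Finset.sum_insert ha, ← h1]
          exact h2
      filter_upwards [hgen Finset.univ, coe_one_ae (μ := μ)] with y h1 h2
      rw [← h1, Finset.sum_coe_sort P (fun p => p), hP.2.2, h2]
    filter_upwards [hpr, hsum] with y h1 h2
    simp only [h1, Set.indicator_apply] at h2
    rw [Finset.sum_boole] at h2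
    have h3 : (Finset.univ.filter fun p : P => y ∈ pset (p : Linfty μ)).card = 1 := by
      exact_mod_cast h2
    obtain ⟨p, hp⟩ := Finset.card_eq_one.1 h3
    refine ⟨p, ?_, ?_⟩
    · have : p ∈ Finset.univ.filter fun p : P => y ∈ pset (p : Linfty μ) := by rw [hp]; simp
      simpa using this
    · intro q hq
      have : q ∈ Finset.univ.filter fun p : P => y ∈ pset (p : Linfty μ) := by simpa using hq
      rw [hp] at this
      simpa using this
  have h2 : ∀ᵐ y ∂μ, ∀ s : W, ∃! p : P, (s : G)⁻¹ • y ∈ pset (p : Linfty μ) :=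
    ae_all_iff.2 fun s => ae_smul h1 (s : G)⁻¹
  have h3 : ∀ᵐ y ∂μ, ∀ c : W → P, y ∈ pset (transl W P c) ↔
      ∀ s : W, (s : G)⁻¹ • y ∈ pset (c s : Linfty μ) := by
    refine ae_all_iff.2 fun c => ?_
    have ha : ∀ᵐ y ∂μ, ∀ s : W, (act (s : G) (c s : Linfty μ) : X →ₘ[μ] ℂ) y =
        (pset (c s : Linfty μ)).indicator (fun _ => (1 : ℂ)) ((s : G)⁻¹ • y) := by
      refine ae_all_iff.2 fun s => ?_
      filter_upwards [act_ae (s : G) (c s : Linfty μ),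
        ae_smul (proj_ae (hP.idem (c s).2)) (s : G)⁻¹] with y h1 h2
      rw [h1, h2]
    filter_upwards [coe_prod_ae Finset.univ fun s : W => act (s : G) (c s : Linfty μ), ha]
      with y hy1 hy2
    have e : y ∈ pset (transl W P c) ↔
        ∏ s : W, (pset (c s : Linfty μ)).indicator (fun _ => (1 : ℂ)) ((s : G)⁻¹ • y) = 1 := by
      rw [← Finset.prod_congr rfl fun s _ => hy2 s, ← hy1]
      rfl
    rw [e]
    constructor
    · intro h s
      by_contra hs
      rw [Finset.prod_eq_zero (Finset.mem_univ s) (Set.indicator_of_notMem hs _)] at h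
      exact zero_ne_one h
    · intro h
      exact Finset.prod_eq_one fun s _ => Set.indicator_of_mem (h s) _
  -- All almost everywhere statements are collected on one measurable conull set, and the cells are
  -- cut down to it. Positions relative to the partition are then exact at every point of a cell.
  obtain ⟨Z, hZ, hZm, hZsub⟩ := IsMeasurablyGenerated.exists_measurable_subset
    (inter_mem hX₀ (inter_mem h2 h3))
  have hZ' : ∀ᵐ y ∂μ, y ∈ Z := hZ
  refine ⟨fun c => (⋂ s : W, (fun y : X => (s : G)⁻¹ • y) ⁻¹' pset (c s : Linfty μ)) ∩ Z,
    ?_, ?_, ?_, ?_, ?_, ?_⟩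
  · intro c
    exact (MeasurableSet.iInter fun s => (measurableSet_pset _).preimage
      (measurable_const_smul _)).inter hZm
  · rintro c y ⟨_, hy⟩
    exact (hZsub hy).1
  · rintro c y ⟨hy1, hy⟩ s p
    have hu := (hZsub hy).2.1 s
    have hcs := Set.mem_iInter.1 hy1 s
    constructor
    · intro hp; exact hu.unique hcs hp
    · rintro rfl; exact hcs
  · intro c
    refine measureReal_congr ?_
    filter_upwards [hZ', h3] with y hy1 hy2
    apply propext
    change y ∈ _ ∩ Z ↔ y ∈ pset (transl W P c)
    rw [hy2 c]
    simp [hy1]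
  · filter_upwards [hZ', h2] with y hy1 hy2
    choose c hc _ using hy2
    exact ⟨c, Set.mem_iInter.2 hc, hy1⟩
  · intro c hc
    by_contra hne
    rw [Set.not_nonempty_iff_eq_empty] at hne
    apply hc
    apply linfty_ext
    filter_upwards [proj_ae (transl_idem hP c), h3, hZ',
      AEEqFun.coeFn_zero (α := X) (β := ℂ) (μ := μ)] with y hy1 hy2 hy3 hy4
    rw [hy1]
    refine Eq.trans ?_ hy4.symm
    refine Set.indicator_of_notMem (fun hm => ?_) _
    have : y ∈ (∅ : Set X) := by
      rw [← hne]
      exact ⟨Set.mem_iInter.2 ((hy2 c).1 hm), hy3⟩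
    exact this

/-- `B` is determined, up to null sets, by the position of the points `s⁻¹ x`, `s ∈ J`, relative to
the members of `R`. -/
def Determined (J : Finset G) (R : Finset (Linfty μ)) (B : Set X) : Prop :=
  ∃ Z ∈ ae μ, ∀ x ∈ Z, ∀ y ∈ Z,
    (∀ s ∈ J, ∀ p ∈ R, (s⁻¹ • x ∈ pset p ↔ s⁻¹ • y ∈ pset p)) → (x ∈ B ↔ y ∈ B)

/-- `T` can be approximated up to `ε` by sets which are determined by `J` and `R`. -/
def Approximable (ε : ℝ) (J : Finset G) (R : Finset (Linfty μ)) (T : Set X) : Prop :=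
  ∃ B, MeasurableSet B ∧ μ.real (symmDiff T B) ≤ ε ∧ Determined J R B

/-- A union of cells is handled one label at a time, which accounts for the factor `Fintype.card C`.
-/
theorem abs_cnt_label_sub_le {C : Type*} [Fintype C] {cell : C → Set X}
    (hm : ∀ c, MeasurableSet (cell c)) (hdisj : ∀ c c', c ≠ c' → Disjoint (cell c) (cell c')) {d : ℕ}
    {δ : ℝ} {c : Fin d → C} (hc : ∀ c', |cnt (fun v => c v = c') - μ.real (cell c') * d| ≤ δ * d)
    (U : Finset C) :
    |cnt (fun v => c v ∈ U) - μ.real (⋃ c' ∈ U, cell c') * d| ≤ Fintype.card C * (δ * d) := by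
  classical
  by_cases hC : Nonempty C
  · have h0 : 0 ≤ δ * d := (abs_nonneg _).trans (hc hC.some)
    have h1 : cnt (fun v => c v ∈ U) = ∑ c' ∈ U, cnt (fun v => c v = c') := by
      simp_rw [← sum_ite_cnt]
      rw [Finset.sum_comm]
      refine Finset.sum_congr rfl fun v _ => ?_
      rw [Finset.sum_ite_eq]
    have h2 : μ.real (⋃ c' ∈ U, cell c') = ∑ c' ∈ U, μ.real (cell c') :=
      measureReal_biUnion_finset (fun a _ b _ hab => hdisj a b hab) (fun a _ => hm a)
    rw [h1, h2, Finset.sum_mul, ← Finset.sum_sub_distrib]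
    refine (Finset.abs_sum_le_sum_abs _ _).trans ((Finset.sum_le_sum fun c' _ => hc c').trans ?_)
    rw [Finset.sum_const, nsmul_eq_mul]
    gcongr
    exact Finset.card_le_univ U
  · have hU : U = ∅ := by
      ext a; exact absurd ⟨a⟩ hC
    subst hU
    have : IsEmpty C := not_nonempty_iff.1 hC
    rw [cnt_eq_zero (by simp)]
    simp

theorem abs_measureReal_sub_le (S T : Set X) :
    |μ.real S - μ.real T| ≤ μ.real (symmDiff S T) := by
  have h1 : μ.real S ≤ μ.real T + μ.real (symmDiff S T) := by
    refine (measureReal_mono ?_).trans (measureReal_union_le _ _)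
    intro y hy
    by_cases h : y ∈ T
    · exact Or.inl h
    · exact Or.inr (Or.inl ⟨hy, h⟩)
  have h2 : μ.real T ≤ μ.real S + μ.real (symmDiff S T) := by
    refine (measureReal_mono ?_).trans (measureReal_union_le _ _)
    intro y hy
    by_cases h : y ∈ S
    · exact Or.inl h
    · exact Or.inr (Or.inr ⟨hy, h⟩)
  rw [abs_le]
  constructor <;> linarith

end Labels


/-! ### Sample points chosen according to a labelling -/

section SpaceModels

variable {G X : Type*} [Group G] [MulAction G X] [MeasurableSpace X] {μ : Measure X}
  [MeasurableConstSMul G X] [SMulInvariantMeasure G X μ] [IsProbabilityMeasure μ]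

theorem measureReal_iUnion_smul_le (K : Finset G) {A : Set X} (hA : MeasurableSet A) {ε : ℝ}
    (h : μ.real A ≤ ε) : μ.real (⋃ g ∈ K, (fun y : X => g • y) ⁻¹' A) ≤ K.card * ε := by
  refine (measureReal_biUnion_finset_le K _).trans ?_
  rw [← nsmul_eq_mul]
  refine Finset.sum_le_card_nsmul _ _ _ fun g _ => ?_
  rw [measureReal_def, (measurePreserving_smul g μ).measure_preimage hA.nullMeasurableSet]
  exact h

theorem measureReal_iUnion_le_card_mul {ι : Type*} (I : Finset ι) (A : ι → Set X) {ε : ℝ}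
    (h : ∀ i ∈ I, μ.real (A i) ≤ ε) : μ.real (⋃ i ∈ I, A i) ≤ I.card * ε := by
  refine (measureReal_biUnion_finset_le I _).trans ?_
  rw [← nsmul_eq_mul]
  exact Finset.sum_le_card_nsmul _ _ _ h

/-- Equivariance of a labelling in terms of position relative to a partition. -/
theorem cnt_label_equi_le {F : Finset G} {P : Finset (Linfty μ)} {n m : ℕ} (hn : 3 * m ≤ n) {δ : ℝ}
    {d : ℕ} (hd : 0 < d) {σ : G → Equiv.Perm (Fin d)} (hσ : σ ∈ GA F n δ d)
    {c : Fin d → (window F n → P)}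
    (hc : ∀ (s : window F n) (p : P),
      cnt (fun v => ¬ (c v s = p ↔ c ((σ s)⁻¹ v) ⟨1, one_mem_window F n⟩ = p)) ≤ δ ^ 2 * d)
    {g : G} (hg : g ∈ window F m) :
    cnt (fun v => ∃ s : window F n, (s : G) ∈ window F m ∧ ∃ s' : window F n,
      (s' : G) = g⁻¹ * s ∧ c v s' ≠ c (σ g v) s) ≤
      (window F n).card * (P.card * (2 * (δ ^ 2 * d)) + 3 * δ ^ 2 * d) := by
  classical
  set e : window F n := ⟨1, one_mem_window F n⟩
  have hb : ∀ s ∈ (Finset.univ : Finset (window F n)), cnt (fun v => (s : G) ∈ window F m ∧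
      ∃ s' : window F n, (s' : G) = g⁻¹ * s ∧ c v s' ≠ c (σ g v) s) ≤
      P.card * (2 * (δ ^ 2 * d)) + 3 * δ ^ 2 * d := by
    intro s _
    by_cases hs : (s : G) ∈ window F m
    swap
    · rw [cnt_eq_zero fun v h => hs h.1]; positivity
    have hs' : g⁻¹ * (s : G) ∈ window F (m + m) := mul_mem_window (inv_mem_window hg) hs
    have hs'n : g⁻¹ * (s : G) ∈ window F n := window_mono F (by omega) hs'
    set s' : window F n := ⟨g⁻¹ * s, hs'n⟩
    -- Since `g * s' = s`, the vertices `(σ s')⁻¹ v` and `(σ s)⁻¹ (σ g v)` agree unless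
    -- multiplicativity fails for the pair `g, s'`. The labels at `s'` and `s` are both compared
    -- with the identity coordinate there.
    have b3 : cnt (fun v => (σ (s' : G))⁻¹ v ≠ (σ (s : G))⁻¹ (σ g v)) ≤ 3 * δ ^ 2 * d := by
      have h1 := cnt_mul_ne_le_of_mem_GA hd hσ (by omega : m + (m + m) ≤ n) hg hs'
      rw [mul_inv_cancel_left] at h1
      refine le_trans ?_ h1
      rw [← cnt_perm ((σ g)⁻¹ * σ (s : G)) (fun v => (σ (s' : G))⁻¹ v ≠ (σ (s : G))⁻¹ (σ g v))]
      refine cnt_mono fun v hv hcon => hv ?_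
      rw [Equiv.Perm.inv_eq_iff_eq]
      have e1 : (σ (s : G))⁻¹ (σ g (((σ g)⁻¹ * σ (s : G)) v)) = v := by simp
      rw [e1, Equiv.Perm.mul_apply, Equiv.Perm.inv_eq_iff_eq]
      exact hcon
    have b12 : ∀ p ∈ (Finset.univ : Finset P),
        cnt (fun v => ¬ (c v s' = p ↔ c ((σ (s' : G))⁻¹ v) e = p) ∨
          ¬ (c (σ g v) s = p ↔ c ((σ (s : G))⁻¹ (σ g v)) e = p)) ≤ 2 * (δ ^ 2 * d) := by
      intro p _
      refine (cnt_or_le _ _).trans ?_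
      have h1 := hc s' p
      have h2 := hc s p
      rw [← cnt_perm (σ g)] at h2
      linarith
    have b := cnt_exists_le_mul Finset.univ _ b12
    rw [Finset.card_univ, Fintype.card_coe] at b
    refine (cnt_le_of_or (fun v hv => ?_)).trans (add_le_add b b3)
    obtain ⟨_, t, ht, hne⟩ := hv
    have ht' : t = s' := Subtype.ext ht
    rw [ht'] at hne
    by_contra hcon
    push Not at hcon
    obtain ⟨h1, h2⟩ := hcon
    obtain ⟨h3, h4⟩ := h1 (c v s') (Finset.mem_univ _)
    rw [h2] at h3
    exact hne (h4.2 (h3.1 rfl)).symm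
  have := cnt_exists_le_mul Finset.univ _ hb
  rw [Finset.card_univ, Fintype.card_coe] at this
  refine le_trans (cnt_mono ?_) this
  rintro v ⟨s, h⟩
  exact ⟨s, Finset.mem_univ _, h⟩

/-- Good separate models for the group and the space yield sampled models, if the tests can be
approximated by sets determined by the translates of the partition. -/
theorem exists_isModel_of_mem_HA {K : Finset G} {𝒯 : Finset (Set X)} {η : ℝ} (hη : 0 < η)
    {X₀ : Set X} (hX₀ : X₀ ∈ ae μ) (h𝒯 : ∀ T ∈ 𝒯, MeasurableSet T) {F : Finset G}
    {P : Finset (Linfty μ)} (hP : IsProjPartition P) {m : ℕ} (hK : K ⊆ window F m)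
    (happ : ∀ T ∈ 𝒯, Approximable (μ := μ) (η / (4 * ((𝒯.card + 1) * (K.card + 1)))) (window F m)
      P T) :
    ∃ n, 1 ≤ n ∧ ∃ δ : ℝ, 0 < δ ∧ ∀ d : ℕ, 0 < d → ∀ (σ : G → Equiv.Perm (Fin d))
      (φ : domHA F P n →ₗ[ℂ] (Fin d → ℂ)), (σ, φ) ∈ HA F P n δ d →
        ∃ x : Fin d → X, (∀ v, x v ∈ X₀) ∧ IsModel μ K 𝒯 η σ x := by
  classical
  have happ' : ∀ T, ∃ B : Set X, T ∈ 𝒯 → MeasurableSet B ∧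
      μ.real (symmDiff T B) ≤ η / (4 * ((𝒯.card + 1) * (K.card + 1))) ∧
      Determined (μ := μ) (window F m) P B := by
    intro T
    by_cases h : T ∈ 𝒯
    · obtain ⟨B, hB⟩ := happ T h
      exact ⟨B, fun _ => hB⟩
    · exact ⟨∅, fun h' => absurd h' h⟩
  choose B hB using happ'
  have hdet : ∀ T, ∃ Z ∈ ae μ, T ∈ 𝒯 → ∀ x ∈ Z, ∀ y ∈ Z, (∀ s ∈ window F m, ∀ p ∈ P,
      (s⁻¹ • x ∈ pset p ↔ s⁻¹ • y ∈ pset p)) → (x ∈ B T ↔ y ∈ B T) := by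
    intro T
    by_cases h : T ∈ 𝒯
    · obtain ⟨Z, hZ, h'⟩ := (hB T h).2.2
      exact ⟨Z, hZ, fun _ => h'⟩
    · exact ⟨Set.univ, univ_mem, fun h' => absurd h' h⟩
  choose Z hZ hZdet using hdet
  have hZall : X₀ ∩ {y | (∀ T ∈ 𝒯, y ∈ Z T) ∧ ∀ T ∈ 𝒯, ∀ g ∈ K, g • y ∈ Z T} ∈ ae μ := by
    refine inter_mem hX₀ (inter_mem ?_ ?_)
    · exact (Finset.eventually_all 𝒯).2 fun T _ => hZ T
    · exact (Finset.eventually_all 𝒯).2 fun T _ => (Finset.eventually_all K).2 fun g _ =>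
        ae_smul (P := fun y => y ∈ Z T) (hZ T) g
  -- Equivariance multiplies an element `g` of the `m`-window by `g⁻¹ * s` from the `2 m`-window, so
  -- `3 m` letters are needed; the extra one gives `1 ≤ n`.
  obtain ⟨n, hn⟩ : ∃ n, n = 3 * m + 1 := ⟨_, rfl⟩
  have hmn : window F m ⊆ window F n := window_mono F (by omega)
  obtain ⟨cell, hcm, hcsub, hcpos, hcμ, hcov, hcne⟩ := exists_cells (window F n) hP hZall
  obtain ⟨Err, hErr⟩ : ∃ Err, Err = ⋃ T ∈ 𝒯, symmDiff T (B T) := ⟨_, rfl⟩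
  -- The points that some element of `K`, or the identity, moves into the region where a test
  -- differs from its determined approximation. The denominators in the approximation hypothesis
  -- make its measure at most `η / 4`.
  obtain ⟨Err', hErr'⟩ : ∃ E, E = ⋃ g ∈ insert 1 K, (fun y : X => g • y) ⁻¹' Err := ⟨_, rfl⟩
  have hErrm : MeasurableSet Err := by
    rw [hErr]
    exact Finset.measurableSet_biUnion _ fun T hT => (h𝒯 T hT).symmDiff (hB T hT).1
  obtain ⟨η', hη'⟩ : ∃ e, e = η / (4 * ((𝒯.card + 1) * (K.card + 1))) := ⟨_, rfl⟩
  rw [← hη'] at hB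
  have hη'pos : 0 < η' := by rw [hη']; positivity
  have hη'eq : η' * (4 * ((𝒯.card + 1) * (K.card + 1))) = η := by
    rw [hη']; exact div_mul_cancel₀ _ (by positivity)
  have hErr'μ : μ.real Err' ≤ η / 4 := by
    have h1 : μ.real Err ≤ 𝒯.card * η' := by
      rw [hErr]
      exact measureReal_iUnion_le_card_mul _ _ fun T hT => (hB T hT).2.1
    have h2 : μ.real Err' ≤ (insert 1 K).card * (𝒯.card * η') := by
      rw [hErr']; exact measureReal_iUnion_smul_le _ hErrm h1
    have h3 : ((insert 1 K).card : ℝ) ≤ K.card + 1 := by exact_mod_cast Finset.card_insert_le _ _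
    have h4 : ((insert 1 K).card : ℝ) * (𝒯.card * η') ≤ (K.card + 1) * ((𝒯.card + 1) * η') := by
      gcongr; linarith
    rw [← hη'eq]
    linarith
  have hη'4 : η' ≤ η / 4 := by
    rw [← hη'eq]
    have : (0 : ℝ) ≤ 𝒯.card * K.card + 𝒯.card + K.card := by positivity
    nlinarith
  have hdisj : ∀ c c', c ≠ c' → Disjoint (cell c) (cell c') := by
    intro c c' hne
    rw [Set.disjoint_left]
    intro y hy hy'
    apply hne
    ext1 s
    exact ((hcpos c' y hy' s (c s)).1 ((hcpos c y hy s (c s)).2 rfl)).symm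
  have hErrT : ∀ T ∈ 𝒯, ∀ y, y ∉ Err → (y ∈ T ↔ y ∈ B T) := by
    intro T hT y hy
    rw [hErr] at hy
    simp only [Set.mem_iUnion, not_exists] at hy
    have := hy T hT
    rw [Set.mem_symmDiff] at this
    tauto
  have hErrK : ∀ y, y ∉ Err' → y ∉ Err ∧ ∀ g ∈ K, g • y ∉ Err := by
    intro y hy
    rw [hErr'] at hy
    simp only [Set.mem_iUnion, not_exists] at hy
    refine ⟨fun h => hy 1 (Finset.mem_insert_self _ _) (by simpa using h), fun g hg h => ?_⟩
    exact hy g (Finset.mem_insert_of_mem hg) h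
  have hcellB : ∀ T ∈ 𝒯, ∀ c, ∀ y ∈ cell c, ∀ y' ∈ cell c, (y ∈ B T ↔ y' ∈ B T) := by
    intro T hT c y hy y' hy'
    refine hZdet T hT y ((hcsub c hy).2.1 T hT) y' ((hcsub c hy').2.1 T hT) fun s hs p hp => ?_
    rw [hcpos c y hy ⟨s, hmn hs⟩ ⟨p, hp⟩, hcpos c y' hy' ⟨s, hmn hs⟩ ⟨p, hp⟩]
  obtain ⟨N, hN⟩ : ∃ N : ℝ, N = Fintype.card (window F n → P) := ⟨_, rfl⟩
  have hN0 : 0 ≤ N := by rw [hN]; positivity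
  obtain ⟨C, hC⟩ : ∃ C : ℝ, C = 2 * N + (window F n).card * (2 * P.card + 3) + 4 := ⟨_, rfl⟩
  have hCpos : 0 < C := by rw [hC]; positivity
  obtain ⟨δ, hδ⟩ : ∃ δ : ℝ, δ = min 1 (η / 2 / C) := ⟨_, rfl⟩
  have hδpos : 0 < δ := by rw [hδ]; positivity
  have hδ1 : δ ≤ 1 := by rw [hδ]; exact min_le_left _ _
  have hδC : C * δ ≤ η / 2 := by
    have : δ ≤ η / 2 / C := by rw [hδ]; exact min_le_right _ _
    rw [le_div_iff₀ hCpos] at this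
    linarith
  have hδsq : δ ^ 2 ≤ δ := by nlinarith
  have hterm1 : 0 ≤ (window F n).card * (2 * (P.card : ℝ) + 3) := by positivity
  refine ⟨n, by omega, δ, hδpos, fun d hd σ φ hHA => ?_⟩
  have hd' : (0 : ℝ) < d := by exact_mod_cast hd
  have hσ : σ ∈ GA F n δ d := hHA.1
  obtain ⟨c, hc1, hc2, hc3⟩ := exists_labelling hP hd hHA
  simp_rw [← hcμ] at hc2
  have hlab := abs_cnt_label_sub_le hcm hdisj hc2
  rw [← hN] at hlab
  -- The sample avoids `Err'` whenever its cell permits. Bad samples then occur only in cells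
  -- contained in `Err'`, whose total measure is at most `η / 4`, and the trace condition bounds the
  -- number of vertices carrying such labels.
  have hxex : ∀ v, ∃ y, y ∈ cell (c v) ∧ (¬ cell (c v) ⊆ Err' → y ∉ Err') := by
    intro v
    by_cases h : cell (c v) ⊆ Err'
    · obtain ⟨y, hy⟩ := hcne (c v) (hc1 v)
      exact ⟨y, hy, fun h' => absurd h h'⟩
    · obtain ⟨y, hy, hy'⟩ := Set.not_subset.1 h
      exact ⟨y, hy, fun _ => hy'⟩
  choose x hx hxErr using hxex
  have bErr : cnt (fun v => x v ∈ Err') ≤ (η / 4 + N * δ) * d := by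
    have h1 := hlab (Finset.univ.filter fun c' => cell c' ⊆ Err')
    have h2 : μ.real (⋃ c' ∈ Finset.univ.filter fun c' => cell c' ⊆ Err', cell c') ≤ η / 4 := by
      refine (measureReal_mono ?_).trans hErr'μ
      intro y hy
      obtain ⟨c', hc', hy'⟩ := Set.mem_iUnion₂.1 hy
      exact (Finset.mem_filter.1 hc').2 hy'
    have h3 : cnt (fun v => x v ∈ Err') ≤
        cnt (fun v => c v ∈ Finset.univ.filter fun c' => cell c' ⊆ Err') := by
      refine cnt_mono fun v hv => ?_
      by_contra hcon
      exact hxErr v (fun h => hcon (by simpa using h)) hv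
    have h4 := (abs_le.1 h1).2
    have h5 := mul_le_mul_of_nonneg_right h2 hd'.le
    linarith
  have hBT : ∀ T ∈ 𝒯, |cnt (fun v => x v ∈ B T) - μ.real (B T) * d| ≤ N * (δ * d) := by
    intro T hT
    have h1 := hlab (Finset.univ.filter fun c' => ∃ y ∈ cell c', y ∈ B T)
    have h2 : μ.real (⋃ c' ∈ Finset.univ.filter fun c' => ∃ y ∈ cell c', y ∈ B T, cell c') =
        μ.real (B T) := by
      refine measureReal_congr ?_
      filter_upwards [hcov] with y hy
      apply propext
      obtain ⟨c', hc'⟩ := hy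
      constructor
      · intro hy
        obtain ⟨c'', hc'', hy''⟩ := Set.mem_iUnion₂.1 hy
        obtain ⟨z, hz, hz'⟩ := (Finset.mem_filter.1 hc'').2
        exact (hcellB T hT c'' z hz y hy'').1 hz'
      · intro hy
        exact Set.mem_iUnion₂.2 ⟨c', Finset.mem_filter.2 ⟨Finset.mem_univ _, y, hc', hy⟩, hc'⟩
    have h3 : cnt (fun v => x v ∈ B T) =
        cnt (fun v => c v ∈ Finset.univ.filter fun c' => ∃ y ∈ cell c', y ∈ B T) := by
      refine cnt_congr fun v => ?_
      constructor
      · intro h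
        exact Finset.mem_filter.2 ⟨Finset.mem_univ _, x v, hx v, h⟩
      · intro h
        obtain ⟨z, hz, hz'⟩ := (Finset.mem_filter.1 h).2
        exact (hcellB T hT _ z hz _ (hx v)).1 hz'
    rw [h3, ← h2]
    exact h1
  have hηd : 0 < η * d := by positivity
  have hδd : 0 < δ * d := by positivity
  have hδ2d : δ ^ 2 * d ≤ δ * d := by gcongr
  have hCd : C * (δ * d) ≤ η / 2 * d := by
    have := mul_le_mul_of_nonneg_right hδC hd'.le
    linarith
  have hCd' : 2 * N * (δ * d) + (window F n).card * (2 * P.card + 3) * (δ * d) + 4 * (δ * d) ≤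
      η / 2 * d := by
    refine le_trans (le_of_eq ?_) hCd
    rw [hC]; ring
  have ht1 : 0 ≤ N * (δ * d) := by positivity
  have ht2 : 0 ≤ (window F n).card * (2 * (P.card : ℝ) + 3) * (δ * d) := by positivity
  refine ⟨x, fun v => (hcsub _ (hx v)).1, hσ.1, ?_, ?_, ?_, ?_⟩
  · intro g hg h hh
    have := cnt_mul_ne_le_of_mem_GA hd hσ (by omega : m + m ≤ n) (hK hg) (hK hh)
    linarith
  · intro g hg h1
    have h2 := hσ.2.2 g (hmn (hK hg)) h1
    rw [permMat_eq_pmat, tr_pmat, Complex.ofReal_re, div_lt_iff₀ hd'] at h2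
    have h3 : cnt (fun v => (σ g).toPEquiv v = some v) = cnt (fun v => σ g v = v) :=
      cnt_congr fun v => by simp [Equiv.toPEquiv_apply]
    rw [h3] at h2
    linarith
  · intro T hT
    have h1 : |cnt (fun v => x v ∈ T) - cnt (fun v => x v ∈ B T)| ≤ cnt (fun v => x v ∈ Err') :=
      abs_cnt_sub_le fun v hv => hErrT T hT _ (hErrK _ hv).1
    have h2 := hBT T hT
    have h3 := (abs_measureReal_sub_le T (B T)).trans (hB T hT).2.1
    have h4 : |μ.real (B T) * d - μ.real T * d| ≤ η' * d := by
      rw [← sub_mul, abs_mul, abs_of_pos hd', abs_sub_comm]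
      gcongr
    have h5 := abs_sub_le (cnt fun v => x v ∈ T) (cnt fun v => x v ∈ B T) (μ.real T * d)
    have h6 := abs_sub_le (cnt fun v => x v ∈ B T) (μ.real (B T) * d) (μ.real T * d)
    have h7 : η' * d ≤ η / 4 * d := by gcongr
    linarith
  · intro T hT g hg
    have h1 := cnt_label_equi_le (by omega : 3 * m ≤ n) hd hσ hc3 (hK hg)
    have h2 : cnt (fun v => x (σ g v) ∈ Err') ≤ (η / 4 + N * δ) * d := by
      rw [cnt_perm (σ g) (fun v => x v ∈ Err')]; exact bErr
    have h3 : ((window F n).card : ℝ) * (P.card * (2 * (δ ^ 2 * d)) + 3 * δ ^ 2 * d) ≤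
        (window F n).card * (2 * P.card + 3) * (δ * d) := by
      calc ((window F n).card : ℝ) * (P.card * (2 * (δ ^ 2 * d)) + 3 * δ ^ 2 * d)
          = (window F n).card * (2 * P.card + 3) * (δ ^ 2 * d) := by ring
        _ ≤ _ := by gcongr
    have key : ∀ v, ¬ (g • x v ∈ T ↔ x (σ g v) ∈ T) → (x v ∈ Err' ∨ x (σ g v) ∈ Err') ∨
        ∃ s : window F n, (s : G) ∈ window F m ∧ ∃ s' : window F n,
          (s' : G) = g⁻¹ * s ∧ c v s' ≠ c (σ g v) s := by
      intro v hv
      by_contra hcon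
      push Not at hcon
      obtain ⟨⟨c1, c2⟩, c3⟩ := hcon
      apply hv
      rw [hErrT T hT _ ((hErrK _ c1).2 g hg), hErrT T hT _ (hErrK _ c2).1]
      -- The labels of `v` and `σ g v` match after translation by `g`, so `g • x v` and `x (σ g v)`
      -- have the same position relative to all translates in the window. The determined set `B T`
      -- cannot separate them.
      refine hZdet T hT _ ((hcsub _ (hx v)).2.2 T hT g hg) _ ((hcsub _ (hx _)).2.1 T hT)
        fun s hs p hp => ?_
      have hs' : g⁻¹ * s ∈ window F n := window_mono F (by omega : m + m ≤ n)
        (mul_mem_window (inv_mem_window (hK hg)) hs)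
      have h4 := hcpos _ _ (hx v) ⟨g⁻¹ * s, hs'⟩ ⟨p, hp⟩
      have h5 := hcpos _ _ (hx (σ g v)) ⟨s, hmn hs⟩ ⟨p, hp⟩
      rw [c3 ⟨s, hmn hs⟩ hs ⟨g⁻¹ * s, hs'⟩ rfl] at h4
      simp only [mul_inv_rev, inv_inv, mul_smul] at h4
      rw [h4, h5]
    have h6 := (cnt_le_of_or key).trans (add_le_add_left (cnt_or_le _ _) _)
    linarith

end SpaceModels


/-! ## From approximately multiplicative maps on the inverse semigroup to models -/

section SAToModel

/-- Domain and range of a partial bijection of a finite set have the same size, hence so have their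
complements, which can be matched arbitrarily. -/
theorem exists_perm_extending {α : Type*} [Fintype α] (f : α ≃. α) :
    ∃ τ : Equiv.Perm α, ∀ v u, f v = some u → τ v = u := by
  classical
  let e : {v // ∃ u, f v = some u} ≃ {u // ∃ v, f v = some u} :=
    Equiv.ofBijective (fun v => ⟨v.2.choose, v, v.2.choose_spec⟩) (by
      constructor
      · intro v w h
        have h' : v.2.choose = w.2.choose := congrArg Subtype.val h
        have h1 := v.2.choose_spec
        have h2 := w.2.choose_spec
        rw [h'] at h1
        exact Subtype.ext (PEquiv.inj f h1 h2)
      · rintro ⟨u, v, hv⟩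
        have hex : ∃ u, f v = some u := ⟨u, hv⟩
        refine ⟨⟨v, hex⟩, Subtype.ext ?_⟩
        exact Option.some.inj (hex.choose_spec.symm.trans hv))
  refine ⟨e.extendSubtype, fun v u h => ?_⟩
  have hex : ∃ u, f v = some u := ⟨u, h⟩
  rw [Equiv.extendSubtype_apply_of_mem e v hex]
  exact Option.some.inj (hex.choose_spec.symm.trans h)

variable {G X : Type*} [Group G] [MulAction G X] [MeasurableSpace X] [MeasurableSpace G]
  [Countable G] [DiscreteMeasurableSpace G] [MeasurableConstSMul G X]
  {μ : Measure X} [IsProbabilityMeasure μ] [SMulInvariantMeasure G X μ]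

theorem invSemigroup_mul_one (w : InvSemigroup G μ) : w * 1 = w := by
  apply invSemigroup_ext
  filter_upwards [sec_mul w 1, sec_one (G := G) (μ := μ)] with x h1 h2 k
  rw [h1]
  constructor
  · rintro ⟨h, hh, hk⟩
    obtain rfl := (h2 h).1 hh
    simpa using hk
  · intro hk
    exact ⟨1, (h2 1).2 rfl, by simpa using hk⟩

theorem exists_pequiv_of_mem_SA {F : Finset (InvSemigroup G μ)} {δ : ℝ} {d : ℕ} (hd : 0 < d)
    {φ : spanI G μ →ₗ[ℂ] Matrix (Fin d) (Fin d) ℂ} (hφ : φ ∈ SA μ F 2 δ d) :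
    ∃ f : InvSemigroup G μ → (Fin d ≃. Fin d),
      (∀ a ∈ F, φ (toSpan μ a) = pmat (f a)) ∧
      (∀ a ∈ F, |cnt (fun v => f a v = some v) - μ.real (sec μ a 1) * d| ≤ δ * d) ∧
      ∀ a ∈ F, ∀ b ∈ F, cnt (fun v => f (a * b) v ≠ ((f b).trans (f a)) v) ≤ δ ^ 2 * d := by
  classical
  have hd' : (0 : ℝ) < d := by exact_mod_cast hd
  have hex : ∀ a : InvSemigroup G μ, ∃ f : Fin d ≃. Fin d,
      φ (toSpan μ a) ∈ partialPerms d → φ (toSpan μ a) = pmat f := by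
    intro a
    by_cases h : φ (toSpan μ a) ∈ partialPerms d
    · obtain ⟨f, hf⟩ := mem_partialPerms.1 h
      exact ⟨f, fun _ => hf⟩
    · exact ⟨PEquiv.refl _, fun h' => absurd h' h⟩
  choose f hf using hex
  have hsing : ∀ a ∈ F, φ (toSpan μ a) ∈ partialPerms d ∧
      ‖tr (φ (toSpan μ a)) - tau μ (toSpan μ a)‖ < δ := by
    intro a ha
    have h := hφ [a] (by simp) (by simp) (by simpa using Or.inl ha)
    -- The product of a one-letter list unfolds to `a * 1`, and no monoid structure has been put on
    -- the semigroup, so the right unit law is invoked by hand here and for two-letter lists.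
    have e : [a].prod = a := invSemigroup_mul_one a
    rw [e] at h
    exact h.2
  refine ⟨f, fun a ha => hf a (hsing a ha).1, ?_, ?_⟩
  · intro a ha
    have h := (hsing a ha).2
    rw [hf a (hsing a ha).1, tr_pmat, tau_toSpan, ← Complex.ofReal_sub, Complex.norm_real,
      Real.norm_eq_abs] at h
    have e : cnt (fun v => f a v = some v) / d - μ.real (sec μ a 1) =
        (cnt (fun v => f a v = some v) - μ.real (sec μ a 1) * d) / d := by
      field_simp
    rw [e, abs_div, abs_of_pos hd', div_lt_iff₀ hd'] at h
    exact h.le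
  · intro a ha b hb
    have h := hφ [a, b] (by simp) (by simp) (by
      intro s hs
      simp only [List.mem_cons, List.not_mem_nil, or_false] at hs
      rcases hs with rfl | rfl
      · exact Or.inl ha
      · exact Or.inl hb)
    have e : [a, b].prod = a * b := congrArg (a * ·) (invSemigroup_mul_one b)
    rw [e] at h
    have h1 := h.1
    rw [hf _ h.2.1] at h1
    simp only [List.map_cons, List.map_nil, List.prod_cons, List.prod_nil, mul_one] at h1
    rw [hf a (hsing a ha).1, hf b (hsing b hb).1, pmat_mul] at h1
    refine (cnt_ne_le_norm2 hd _ _).trans ?_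
    have h0 := norm2_nonneg (pmat (f (a * b)) - pmat ((f b).trans (f a)))
    gcongr

open Classical in
variable (μ) in
/-- The element of the inverse semigroup given by `{g} × A`, for measurable `A`. -/
noncomputable def arrOf (g : G) (A : Set X) : InvSemigroup G μ :=
  if h : MeasurableSet A then arr μ g h else 1

theorem arrOf_eq (g : G) {A : Set X} (h : MeasurableSet A) : arrOf μ g A = arr μ g h := dif_pos h

theorem arrOf_mul_arrOf (g h : G) {A B : Set X} (hA : MeasurableSet A) (hB : MeasurableSet B) :
    arrOf μ g A * arrOf μ h B = arrOf μ (g * h) (B ∩ (h • ·) ⁻¹' A) := by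
  rw [arrOf_eq g hA, arrOf_eq h hB, arr_mul_arr, arrOf_eq]

theorem unitary_eq_arrOf (g : G) : unitary μ g = arrOf μ g Set.univ :=
  (arrOf_eq g MeasurableSet.univ).symm

theorem unitary_mul_unitary (g h : G) : unitary μ g * unitary μ h = unitary μ (g * h) := by
  simp only [unitary_eq_arrOf]
  rw [arrOf_mul_arrOf g h MeasurableSet.univ MeasurableSet.univ]
  simp

theorem unitary_mul_arrOf (g : G) {A : Set X} (hA : MeasurableSet A) :
    unitary μ g * arrOf μ 1 A = arrOf μ g A := by
  rw [unitary_eq_arrOf, arrOf_mul_arrOf g 1 MeasurableSet.univ hA]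
  simp

theorem arrOf_mul_unitary (g : G) {A : Set X} (hA : MeasurableSet A) :
    arrOf μ 1 A * unitary μ g = arrOf μ g ((g • ·) ⁻¹' A) := by
  rw [unitary_eq_arrOf, arrOf_mul_arrOf 1 g hA MeasurableSet.univ]
  simp

theorem arrOf_idem {A : Set X} (hA : MeasurableSet A) :
    arrOf μ (1 : G) A * arrOf μ (1 : G) A = arrOf μ 1 A := by
  rw [arrOf_mul_arrOf 1 1 hA hA]
  simp

theorem measureReal_sec_arrOf (g : G) {A : Set X} (hA : MeasurableSet A) [Decidable (g = 1)] :
    μ.real (sec μ (arrOf μ g A) 1) = if g = 1 then μ.real A else 0 := by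
  rw [arrOf_eq g hA]
  have h := sec_arr (μ := μ) g hA
  split_ifs with hg
  · refine measureReal_congr ?_
    filter_upwards [h] with x hx
    apply propext
    change x ∈ sec μ (arr μ g hA) 1 ↔ x ∈ A
    exact (hx 1).trans (by simp [hg])
  · have e : sec μ (arr μ g hA) 1 =ᵐ[μ] (∅ : Set X) := by
      filter_upwards [h] with x hx
      apply propext
      change x ∈ sec μ (arr μ g hA) 1 ↔ x ∈ (∅ : Set X)
      exact (hx 1).trans (by simp [Ne.symm hg])
    rw [measureReal_congr e]
    simp

/-- The points whose membership in the members of `𝒮` is as prescribed by `c`. -/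
def signCell (𝒮 c : Finset (Set X)) : Set X := {y | ∀ S ∈ 𝒮, (y ∈ S ↔ S ∈ c)}

theorem measurableSet_signCell {𝒮 : Finset (Set X)} (h : ∀ S ∈ 𝒮, MeasurableSet S)
    (c : Finset (Set X)) : MeasurableSet (signCell 𝒮 c) := by
  classical
  have e : signCell 𝒮 c = ⋂ S ∈ 𝒮, if S ∈ c then S else Sᶜ := by
    ext y
    simp only [signCell, Set.mem_ofPred_eq, Set.mem_iInter]
    refine forall₂_congr fun S _ => ?_
    by_cases hS : S ∈ c <;> simp [hS]
  rw [e]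
  refine Finset.measurableSet_biInter _ fun S hS => ?_
  split_ifs
  · exact h S hS
  · exact (h S hS).compl

theorem signCell_disjoint {𝒮 c c' : Finset (Set X)} (hc : c ∈ 𝒮.powerset) (hc' : c' ∈ 𝒮.powerset)
    (h : c ≠ c') : Disjoint (signCell 𝒮 c) (signCell 𝒮 c') := by
  rw [Set.disjoint_left]
  intro y hy hy'
  apply h
  ext S
  constructor
  · intro hS
    have hS' := Finset.mem_powerset.1 hc hS
    exact (hy' S hS').1 ((hy S hS').2 hS)
  · intro hS
    have hS' := Finset.mem_powerset.1 hc' hS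
    exact (hy S hS').1 ((hy' S hS').2 hS)

theorem exists_mem_signCell (𝒮 : Finset (Set X)) (y : X) :
    ∃ c ∈ 𝒮.powerset, y ∈ signCell 𝒮 c := by
  classical
  refine ⟨𝒮.filter (fun S => y ∈ S), Finset.mem_powerset.2 (Finset.filter_subset _ _), ?_⟩
  intro S hS
  simp [hS]

/-- The diagonal parts of the images of the unit bisections of sets are given by sample points. -/
theorem exists_samples {𝒮 : Finset (Set X)} (h𝒮 : ∀ S ∈ 𝒮, MeasurableSet S) {X₀ : Set X}
    (hX₀ : X₀ ∈ ae μ) {d : ℕ} (φ : spanI G μ →ₗ[ℂ] Matrix (Fin d) (Fin d) ℂ)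
    (f : InvSemigroup G μ → (Fin d ≃. Fin d))
    (h1 : φ (toSpan μ (unitary μ 1)) = pmat (f (unitary μ 1)))
    (hS : ∀ S ∈ 𝒮, φ (toSpan μ (arrOf μ 1 S)) = pmat (f (arrOf μ 1 S)))
    (hc : ∀ c ∈ 𝒮.powerset, φ (toSpan μ (arrOf μ 1 (signCell 𝒮 c))) =
      pmat (f (arrOf μ 1 (signCell 𝒮 c)))) :
    ∃ x : Fin d → X, (∀ v, x v ∈ X₀) ∧ ∀ v, f (unitary μ 1) v = some v →
      ∀ S ∈ 𝒮, (f (arrOf μ 1 S) v = some v ↔ x v ∈ S) := by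
  classical
  have hcm := measurableSet_signCell h𝒮
  have hdisj : ∀ c ∈ 𝒮.powerset, ∀ c' ∈ 𝒮.powerset, c ≠ c' →
      Disjoint (signCell 𝒮 c) (signCell 𝒮 c') := fun c hc c' hc' => signCell_disjoint hc hc'
  -- Linearity of `φ` makes the diagonal entries at `v` add up exactly over a disjoint
  -- decomposition. All these entries are zero or one, which gives an equation between natural
  -- numbers.
  have hsum : ∀ {I : Finset (Finset (Set X))} (_ : I ⊆ 𝒮.powerset) {A : Set X}
      (hA : MeasurableSet A) (_ : A = ⋃ c ∈ I, signCell 𝒮 c)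
      (_ : φ (toSpan μ (arrOf μ 1 A)) = pmat (f (arrOf μ 1 A))) (v : Fin d),
      (if f (arrOf μ 1 A) v = some v then (1 : ℕ) else 0) =
        (I.filter fun c => f (arrOf μ 1 (signCell 𝒮 c)) v = some v).card := by
    intro I hI A hA hU hfA v
    have h2 := toSpan_arr_eq_sum (μ := μ) (1 : G) I (fun c => signCell 𝒮 c) hcm hA
      (fun c hc c' hc' => hdisj c (hI hc) c' (hI hc')) hU
    have h3 := congrArg (fun a => φ a v v) h2
    simp only [map_sum, ← arrOf_eq] at h3
    rw [hfA, Matrix.sum_apply, Finset.sum_congr rfl fun c hc' => by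
      rw [hc c (hI hc'), pmat_apply], pmat_apply, Finset.sum_boole] at h3
    have h4 : ((if f (arrOf μ 1 A) v = some v then (1 : ℕ) else 0 : ℕ) : ℂ) =
        ((I.filter fun c => f (arrOf μ 1 (signCell 𝒮 c)) v = some v).card : ℂ) := by
      rw [← h3]
      push_cast
      rfl
    exact_mod_cast h4
  have huniv : (Set.univ : Set X) = ⋃ c ∈ 𝒮.powerset, signCell 𝒮 c := by
    ext y
    simpa using exists_mem_signCell 𝒮 y
  have hSU : ∀ S ∈ 𝒮, S = ⋃ c ∈ 𝒮.powerset.filter (fun c => S ∈ c), signCell 𝒮 c := by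
    intro S hS
    ext y
    rw [Set.mem_iUnion₂]
    constructor
    · intro hy
      obtain ⟨c, hc, hyc⟩ := exists_mem_signCell 𝒮 y
      exact ⟨c, Finset.mem_filter.2 ⟨hc, (hyc S hS).1 hy⟩, hyc⟩
    · rintro ⟨c, hc, hyc⟩
      exact (hyc S hS).2 (Finset.mem_filter.1 hc).2
  obtain ⟨x₀, hx₀⟩ : X₀.Nonempty := by
    rw [Set.nonempty_iff_ne_empty]
    rintro rfl
    exact (ae_neBot.2 (IsProbabilityMeasure.ne_zero μ)).ne (empty_mem_iff_bot.1 hX₀)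
  have hx : ∀ v, ∃ y, y ∈ X₀ ∧ (f (unitary μ 1) v = some v →
      ∀ S ∈ 𝒮, (f (arrOf μ 1 S) v = some v ↔ y ∈ S)) := by
    intro v
    by_cases hv : f (unitary μ 1) v = some v
    swap
    · exact ⟨x₀, hx₀, fun h => absurd h hv⟩
    have h2 := hsum (Finset.Subset.refl _) MeasurableSet.univ huniv
      (by rw [← unitary_eq_arrOf]; exact h1) v
    rw [← unitary_eq_arrOf, if_pos hv] at h2
    obtain ⟨c, hc'⟩ := Finset.card_eq_one.1 h2.symm
    have hcmem : c ∈ 𝒮.powerset.filter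
        (fun c => f (arrOf μ 1 (signCell 𝒮 c)) v = some v) := by rw [hc']; simp
    obtain ⟨hcp, hcv⟩ := Finset.mem_filter.1 hcmem
    -- For a vertex fixed by the image of the unit exactly one cell `c` has diagonal entry one. That
    -- cell cannot be null, because `φ` kills null sets, so it meets `X₀` and supplies the sample
    -- point.
    have hne : μ (signCell 𝒮 c) ≠ 0 := by
      intro h0
      have h3 := toSpan_arr_of_null (μ := μ) (1 : G) (hcm c) h0
      have h4 := hc c hcp
      rw [arrOf_eq _ (hcm c), h3, map_zero, ← arrOf_eq] at h4
      have h5 := congrFun (congrFun h4 v) v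
      rw [pmat_apply, if_pos hcv] at h5
      simp at h5
    obtain ⟨y, hy, hyX⟩ : (signCell 𝒮 c ∩ X₀).Nonempty := by
      rw [Set.nonempty_iff_ne_empty]
      intro h0
      apply hne
      refine measure_mono_null ?_ (mem_ae_iff.1 hX₀)
      intro y hy hyX
      have : y ∈ (∅ : Set X) := by rw [← h0]; exact ⟨hy, hyX⟩
      exact this
    refine ⟨y, hyX, fun _ S hS' => ?_⟩
    have h6 := hsum (Finset.filter_subset _ _) (h𝒮 S hS') (hSU S hS') (hS S hS') v
    rw [hy S hS']
    have h7 : (𝒮.powerset.filter (fun c => S ∈ c)).filter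
        (fun c => f (arrOf μ 1 (signCell 𝒮 c)) v = some v) = ({c} : Finset _).filter (S ∈ ·) := by
      rw [← hc', Finset.filter_filter, Finset.filter_filter]
      refine Finset.filter_congr fun c' _ => and_comm
    rw [h7, Finset.filter_singleton] at h6
    by_cases hSc : S ∈ c <;> by_cases hfS : f (arrOf μ 1 S) v = some v <;>
      simp [hSc, hfS] at h6 ⊢
  choose x hx1 hx2 using hx
  exact ⟨x, hx1, hx2⟩

end SAToModel


/-! ### Reading permutations and sample points off an approximate representation -/

section SAToModel

variable {G X : Type*} [Group G] [MulAction G X] [MeasurableSpace X] [MeasurableSpace G]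
  [Countable G] [DiscreteMeasurableSpace G] [MeasurableConstSMul G X]
  {μ : Measure X} [IsProbabilityMeasure μ] [SMulInvariantMeasure G X μ]

/-- Up to a proportion `δ` of points, `f` is multiplicative on `F` and has the trace prescribed
by `τ`. -/
structure IsApproxRep (F : Finset (InvSemigroup G μ)) (δ : ℝ) {d : ℕ}
    (f : InvSemigroup G μ → (Fin d ≃. Fin d)) : Prop where
  tr : ∀ a ∈ F, |cnt (fun v => f a v = some v) - μ.real (sec μ a 1) * d| ≤ δ * d
  mul : ∀ a ∈ F, ∀ b ∈ F, cnt (fun v => f (a * b) v ≠ ((f b).trans (f a)) v) ≤ δ * d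

variable {F : Finset (InvSemigroup G μ)} {δ : ℝ} {d : ℕ} {f : InvSemigroup G μ → (Fin d ≃. Fin d)}

theorem IsApproxRep.cnt_one_ne_le (hf : IsApproxRep F δ f) (h1 : unitary μ 1 ∈ F) :
    cnt (fun v => f (unitary μ (1 : G)) v ≠ some v) ≤ δ * d := by
  classical
  have h := hf.tr _ h1
  rw [unitary_eq_arrOf, measureReal_sec_arrOf 1 MeasurableSet.univ, if_pos rfl, probReal_univ,
    one_mul] at h
  have h2 := cnt_not_add (fun v => f (arrOf μ (1 : G) Set.univ) v = some v)
  rw [Fintype.card_fin] at h2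
  rw [unitary_eq_arrOf]
  have h3 := (abs_le.1 h).1
  change cnt (fun v => ¬ f (arrOf μ (1 : G) Set.univ) v = some v) ≤ _
  linarith

/-- Composing with the image of `g⁻¹` gives almost the image of the unit, which fixes almost every
vertex since its trace is nearly one. So the image of `g` is defined almost everywhere. -/
theorem IsApproxRep.cnt_eq_none_le (hf : IsApproxRep F δ f) (h1 : unitary μ 1 ∈ F) {g : G}
    (hg : unitary μ g ∈ F) (hg' : unitary μ g⁻¹ ∈ F) :
    cnt (fun v => f (unitary μ g) v = none) ≤ 2 * δ * d := by
  have h := hf.mul _ hg' _ hg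
  rw [unitary_mul_unitary, inv_mul_cancel] at h
  have h2 := hf.cnt_one_ne_le h1
  have h3 : cnt (fun v => f (unitary μ g) v = none) ≤ _ := cnt_le_of_or (q := fun v =>
      f (unitary μ (1 : G)) v ≠ some v) (r := fun v => f (unitary μ 1) v ≠
        ((f (unitary μ g)).trans (f (unitary μ g⁻¹))) v) (fun v hv => by
    by_contra hcon
    push Not at hcon
    have h4 := hcon.2
    rw [hcon.1] at h4
    have h5 : ((f (unitary μ g)).trans (f (unitary μ g⁻¹))) v = none := by
      change (f (unitary μ g) v).bind _ = none
      rw [hv]; rfl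
    rw [h5] at h4
    exact absurd h4 (by simp))
  linarith

/-- An idempotent partial injection is a partial identity: if `v` goes to `u` and `u` is fixed,
injectivity gives `u = v`. The bisection of `S` is idempotent, hence its image nearly so. -/
theorem IsApproxRep.cnt_unit_le (hf : IsApproxRep F δ f) {S : Set X} (hS : MeasurableSet S)
    (hSF : arrOf μ 1 S ∈ F) :
    cnt (fun v => ∃ u, f (arrOf μ (1 : G) S) v = some u ∧ u ≠ v) ≤ δ * d := by
  have h := hf.mul _ hSF _ hSF
  rw [arrOf_idem hS] at h
  refine (cnt_mono ?_).trans h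
  rintro v ⟨u, hu, huv⟩ hcon
  apply huv
  have h2 : ((f (arrOf μ (1 : G) S)).trans (f (arrOf μ (1 : G) S))) v = f (arrOf μ (1 : G) S) u := by
    change (f (arrOf μ (1 : G) S) v).bind _ = _
    rw [hu]; rfl
  rw [h2, hu] at hcon
  exact PEquiv.inj _ hcon.symm hu

/-- The permutations `σ g` and the sample points `x v` read off from an approximate
representation. -/
structure IsReadOff (F : Finset (InvSemigroup G μ)) (δ : ℝ) {d : ℕ}
    (f : InvSemigroup G μ → (Fin d ≃. Fin d)) (K : Finset G) (𝒮 : Finset (Set X))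
    (σ : G → Equiv.Perm (Fin d)) (x : Fin d → X) : Prop extends IsApproxRep F δ f where
  one_mem : unitary μ 1 ∈ F
  unitary_mem : ∀ g ∈ K, unitary μ g ∈ F
  unit_mem : ∀ S ∈ 𝒮, arrOf μ 1 S ∈ F
  meas : ∀ S ∈ 𝒮, MeasurableSet S
  perm : ∀ g ∈ K, cnt (fun v => f (unitary μ g) v ≠ some (σ g v)) ≤ 2 * δ * d
  point : ∀ v, f (unitary μ 1) v = some v → ∀ S ∈ 𝒮, (f (arrOf μ 1 S) v = some v ↔ x v ∈ S)

variable {K : Finset G} {𝒮 : Finset (Set X)} {σ : G → Equiv.Perm (Fin d)} {x : Fin d → X}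

/-- One `δ` for the multiplication of group elements, and `2 δ` for each of the three replacements
of a partial permutation by a permutation. -/
theorem IsReadOff.mul_le (h : IsReadOff F δ f K 𝒮 σ x) {g k : G} (hg : g ∈ K) (hk : k ∈ K)
    (hgk : g * k ∈ K) : cnt (fun v => σ (g * k) v ≠ σ g (σ k v)) ≤ 7 * δ * d := by
  have h1 := h.mul _ (h.unitary_mem g hg) _ (h.unitary_mem k hk)
  rw [unitary_mul_unitary] at h1
  have h2 := h.perm _ hgk
  have h3 := h.perm _ hk
  have h4 := h.perm _ hg
  rw [← cnt_perm (σ k)] at h4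
  have h5 := cnt_exists_le (Finset.univ : Finset (Fin 4)) ![fun v => f (unitary μ (g * k)) v ≠
    ((f (unitary μ k)).trans (f (unitary μ g))) v, fun v => f (unitary μ (g * k)) v ≠
      some (σ (g * k) v), fun v => f (unitary μ k) v ≠ some (σ k v),
      fun v => f (unitary μ g) (σ k v) ≠ some (σ g (σ k v))]
  have h6 : cnt (fun v => σ (g * k) v ≠ σ g (σ k v)) ≤ _ := (cnt_mono fun v hv => by
    by_contra hcon
    simp only [Finset.mem_univ, true_and, Fin.exists_fin_succ, Matrix.cons_val_zero,
      Matrix.cons_val_succ, IsEmpty.exists_iff, or_false, not_or, not_not] at hcon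
    obtain ⟨c1, c2, c3, c4⟩ := hcon
    apply hv
    rw [c2] at c1
    have e : ((f (unitary μ k)).trans (f (unitary μ g))) v = some (σ g (σ k v)) := by
      change (f (unitary μ k) v).bind _ = _
      rw [c3]; exact c4
    rw [e] at c1
    exact Option.some.inj c1).trans h5
  simp only [Fin.sum_univ_four, Matrix.cons_val_zero, Matrix.cons_val_one, Matrix.cons_val] at h6
  linarith

theorem IsReadOff.free_le (h : IsReadOff F δ f K 𝒮 σ x) {g : G} (hg : g ∈ K) (h1 : g ≠ 1) :
    cnt (fun v => σ g v = v) ≤ 3 * δ * d := by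
  classical
  have h2 := h.perm _ hg
  have h3 := h.tr _ (h.unitary_mem g hg)
  rw [unitary_eq_arrOf, measureReal_sec_arrOf g MeasurableSet.univ, if_neg h1, zero_mul, sub_zero,
    abs_of_nonneg (cnt_nonneg _), ← unitary_eq_arrOf] at h3
  have h4 : cnt (fun v => σ g v = v) ≤ _ := cnt_le_of_or
    (q := fun v => f (unitary μ g) v ≠ some (σ g v)) (r := fun v => f (unitary μ g) v = some v)
    (fun v hv => by
      by_contra hcon
      push Not at hcon
      rw [hv] at hcon
      exact hcon.2 hcon.1)
  linarith

theorem IsReadOff.meas_le (h : IsReadOff F δ f K 𝒮 σ x) {S : Set X} (hS : S ∈ 𝒮) :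
    |cnt (fun v => x v ∈ S) - μ.real S * d| ≤ 2 * δ * d := by
  classical
  have h1 := h.cnt_one_ne_le h.one_mem
  have h2 := h.tr _ (h.unit_mem S hS)
  rw [measureReal_sec_arrOf 1 (h.meas S hS), if_pos rfl] at h2
  have h3 : |cnt (fun v => x v ∈ S) - cnt (fun v => f (arrOf μ (1 : G) S) v = some v)| ≤ _ :=
    abs_cnt_sub_le (r := fun v => f (unitary μ (1 : G)) v ≠ some v) (fun v hv =>
      (h.point v (not_not.1 hv) S hS).symm)
  have h4 := abs_sub_le (cnt (fun v => x v ∈ S)) (cnt (fun v => f (arrOf μ (1 : G) S) v = some v))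
    (μ.real S * d)
  linarith

/-- The bisection of `g` over the preimage of `T` is both the unit bisection of `T` times `g` and
`g` times the unit bisection of the preimage. Evaluating both factorizations at `v` compares `x (σ g
v) ∈ T` with `g • x v ∈ T`. -/
theorem IsReadOff.equi_le (h : IsReadOff F δ f K 𝒮 σ x) {T : Set X} (hT : T ∈ 𝒮) {g : G}
    (hg : g ∈ K) (hT' : (g • ·) ⁻¹' T ∈ 𝒮) :
    cnt (fun v => ¬ (g • x v ∈ T ↔ x (σ g v) ∈ T)) ≤ 7 * δ * d := by
  have h1 := h.mul _ (h.unit_mem T hT) _ (h.unitary_mem g hg)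
  rw [arrOf_mul_unitary g (h.meas T hT)] at h1
  have h2 := h.mul _ (h.unitary_mem g hg) _ (h.unit_mem _ hT')
  rw [unitary_mul_arrOf g (h.meas _ hT')] at h2
  have h3 := h.perm _ hg
  have h4 := h.cnt_unit_le (h.meas _ hT') (h.unit_mem _ hT')
  have h5 := h.cnt_one_ne_le h.one_mem
  have h6 := h5
  rw [← cnt_perm (σ g)] at h6
  have h7 := cnt_exists_le (Finset.univ : Finset (Fin 6)) ![
    fun v => f (arrOf μ g ((g • ·) ⁻¹' T)) v ≠ ((f (unitary μ g)).trans (f (arrOf μ 1 T))) v,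
    fun v => f (arrOf μ g ((g • ·) ⁻¹' T)) v ≠
      ((f (arrOf μ 1 ((g • ·) ⁻¹' T))).trans (f (unitary μ g))) v,
    fun v => f (unitary μ g) v ≠ some (σ g v),
    fun v => ∃ u, f (arrOf μ 1 ((g • ·) ⁻¹' T)) v = some u ∧ u ≠ v,
    fun v => f (unitary μ (1 : G)) v ≠ some v,
    fun v => f (unitary μ (1 : G)) (σ g v) ≠ some (σ g v)]
  have h8 : cnt (fun v => ¬ (g • x v ∈ T ↔ x (σ g v) ∈ T)) ≤ _ := (cnt_mono fun v hv => by
    by_contra hcon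
    simp only [Finset.mem_univ, true_and, Fin.exists_fin_succ, Matrix.cons_val_zero,
      Matrix.cons_val_succ, IsEmpty.exists_iff, or_false, not_or, not_not] at hcon
    obtain ⟨c1, c2, c3, c4, c5, c6⟩ := hcon
    apply hv
    rw [c1] at c2
    have e1 : ((f (unitary μ g)).trans (f (arrOf μ 1 T))) v = f (arrOf μ 1 T) (σ g v) := by
      change (f (unitary μ g) v).bind _ = _
      rw [c3]; rfl
    rw [e1] at c2
    have e2 := h.point _ c5 _ hT'
    have e3 := h.point _ c6 _ hT
    rw [Set.mem_preimage] at e2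
    rw [← e2, ← e3, c2]
    have e4 : ((f (arrOf μ 1 ((g • ·) ⁻¹' T))).trans (f (unitary μ g))) v =
      (f (arrOf μ 1 ((g • ·) ⁻¹' T)) v).bind (f (unitary μ g)) := rfl
    rw [e4]
    rcases hn : f (arrOf μ 1 ((g • ·) ⁻¹' T)) v with _ | u
    · simp
    · obtain rfl : u = v := by
        by_contra huv
        exact c4 ⟨u, hn, huv⟩
      simp [c3]).trans h7
  simp only [Fin.sum_univ_six, Matrix.cons_val_zero, Matrix.cons_val_one, Matrix.cons_val] at h8
  linarith

/-- If `x v` lies outside the source set of `w`, restricting `w` to that set shows that `v` is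
killed. Otherwise `x v` lies in a section over some `g`, with `g ∈ K₁` outside the tail, and there
`w` and `g` have the same restriction, so `v` goes to `σ g v`. -/
theorem IsReadOff.control_le (h : IsReadOff F δ f K 𝒮 σ x) (w : InvSemigroup G μ) (hw : w ∈ F)
    {K₁ : Finset G} (hK₁ : K₁ ⊆ K) (hsec : ∀ g ∈ K₁, sec μ w g ∈ 𝒮) (hsrc : srcSet w ∈ 𝒮)
    (htail : tailSet w K₁ ∈ 𝒮) {κ : ℝ} (hκ : μ.real (tailSet w K₁) ≤ κ) :
    cnt (fun v => ¬ (f w v = none ∨ ∃ g ∈ K₁, f w v = some (σ g v))) ≤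
      (κ + (4 * K₁.card + 5) * δ) * d := by
  have h1 : cnt (fun v => x v ∈ tailSet w K₁) ≤ (κ + 2 * δ) * d := by
    have := (abs_le.1 (h.meas_le htail)).2
    have h' : μ.real (tailSet w K₁) * d ≤ κ * d := by gcongr
    linarith
  have h2 := h.cnt_one_ne_le h.one_mem
  have h3 := h.cnt_unit_le (h.meas _ hsrc) (h.unit_mem _ hsrc)
  have h4 := h.mul _ hw _ (h.unit_mem _ hsrc)
  rw [arrOf_eq _ (h.meas _ hsrc), mul_arr_srcSet, ← arrOf_eq] at h4
  have h5 : cnt (fun v => ∃ g ∈ K₁, (f (arrOf μ g (sec μ w g)) v ≠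
      ((f (arrOf μ 1 (sec μ w g))).trans (f w)) v ∨ f (arrOf μ g (sec μ w g)) v ≠
      ((f (arrOf μ 1 (sec μ w g))).trans (f (unitary μ g))) v ∨
      f (unitary μ g) v ≠ some (σ g v))) ≤ K₁.card * (4 * δ * d) := by
    refine cnt_exists_le_mul _ _ fun g hg => ?_
    have a1 := h.mul _ hw _ (h.unit_mem _ (hsec g hg))
    rw [arrOf_eq _ (h.meas _ (hsec g hg)), mul_arr_sec, ← arrOf_eq, ← arrOf_eq] at a1
    have a2 := h.mul _ (h.unitary_mem g (hK₁ hg)) _ (h.unit_mem _ (hsec g hg))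
    rw [unitary_mul_arrOf _ (h.meas _ (hsec g hg))] at a2
    have a3 := h.perm g (hK₁ hg)
    refine (cnt_or_le _ _).trans ?_
    have := cnt_or_le (fun v => f (arrOf μ g (sec μ w g)) v ≠
      ((f (arrOf μ 1 (sec μ w g))).trans (f (unitary μ g))) v)
      (fun v => f (unitary μ g) v ≠ some (σ g v))
    linarith
  have h7 := cnt_exists_le (Finset.univ : Finset (Fin 5)) ![
    fun v => x v ∈ tailSet w K₁, fun v => f (unitary μ (1 : G)) v ≠ some v,
    fun v => ∃ u, f (arrOf μ 1 (srcSet w)) v = some u ∧ u ≠ v,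
    fun v => f w v ≠ ((f (arrOf μ 1 (srcSet w))).trans (f w)) v,
    fun v => ∃ g ∈ K₁, (f (arrOf μ g (sec μ w g)) v ≠
      ((f (arrOf μ 1 (sec μ w g))).trans (f w)) v ∨ f (arrOf μ g (sec μ w g)) v ≠
      ((f (arrOf μ 1 (sec μ w g))).trans (f (unitary μ g))) v ∨
      f (unitary μ g) v ≠ some (σ g v))]
  have h8 : cnt (fun v => ¬ (f w v = none ∨ ∃ g ∈ K₁, f w v = some (σ g v))) ≤ _ :=
    (cnt_mono fun v hv => by
    by_contra hcon
    simp only [Finset.mem_univ, true_and, Fin.exists_fin_succ, Matrix.cons_val_zero,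
      Matrix.cons_val_succ, IsEmpty.exists_iff, or_false, not_or, not_not] at hcon
    obtain ⟨c1, c2, c3, c4, c5⟩ := hcon
    apply hv
    rcases hn : f (arrOf μ 1 (srcSet w)) v with _ | u
    · left
      rw [c4]
      change (f (arrOf μ 1 (srcSet w)) v).bind _ = none
      rw [hn]; rfl
    · right
      obtain rfl : u = v := by
        by_contra huv
        exact c3 ⟨u, hn, huv⟩
      obtain ⟨g, hg⟩ := Set.mem_iUnion.1 ((h.point u c2 _ hsrc).1 hn)
      have hgK : g ∈ K₁ := by
        by_contra hgK
        exact c1 (mem_tailSet hg hgK)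
      have hfg := (h.point u c2 _ (hsec g hgK)).2 hg
      refine ⟨g, hgK, ?_⟩
      by_contra hne
      apply c5
      refine ⟨g, hgK, ?_⟩
      by_contra hcon2
      simp only [not_or, not_not] at hcon2
      obtain ⟨b1, b2, b3⟩ := hcon2
      rw [b1] at b2
      have e : ∀ k : Fin d ≃. Fin d, ((f (arrOf μ 1 (sec μ w g))).trans k) u = k u := by
        intro k
        change (f (arrOf μ 1 (sec μ w g)) u).bind _ = _
        rw [hfg]; rfl
      rw [e, e, b3] at b2
      exact hne b2).trans h7
  simp only [Fin.sum_univ_five, Matrix.cons_val_zero, Matrix.cons_val_one, Matrix.cons_val] at h8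
  linarith

/-- Good finite approximations of the inverse semigroup produce good finite models of the action,
together with a control of the images of given elements by the permutations. -/
theorem exists_isModel_of_mem_SA (K : Finset G) {𝒯 : Finset (Set X)}
    (h𝒯 : ∀ T ∈ 𝒯, MeasurableSet T) {η : ℝ} (hη : 0 < η) {X₀ : Set X} (hX₀ : X₀ ∈ ae μ)
    (E₀ : Finset (InvSemigroup G μ)) {K₁ : Finset G} (hK₁ : K₁ ⊆ K) {κ : ℝ} (hκ : 0 < κ)
    (htail : ∀ w ∈ E₀, μ.real (tailSet w K₁) ≤ κ / 2) :
    ∃ (F₀ : Finset (InvSemigroup G μ)) (δ₀ : ℝ), 0 < δ₀ ∧ ∀ d, 0 < d → ∀ φ ∈ SA μ F₀ 2 δ₀ d,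
      ∃ (σ : G → Equiv.Perm (Fin d)) (x : Fin d → X), (∀ v, x v ∈ X₀) ∧ IsModel μ K 𝒯 η σ x ∧
        ∀ w ∈ E₀, ∃ f : Fin d ≃. Fin d, φ (toSpan μ w) = pmat f ∧
          cnt (fun v => ¬ (f v = none ∨ ∃ g ∈ K₁, f v = some (σ g v))) ≤ κ * d := by
  classical
  -- Multiplicativity on `K` also involves the images of products, so these are controlled too.
  let K' : Finset G := insert 1 (K ∪ K * K)
  let 𝒮 : Finset (Set X) := 𝒯 ∪ Finset.image₂ (fun g T => (g • ·) ⁻¹' T) K 𝒯 ∪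
    Finset.image₂ (fun w g => sec μ w g) E₀ K₁ ∪ E₀.image srcSet ∪ E₀.image (tailSet · K₁)
  have h𝒮 : ∀ S ∈ 𝒮, MeasurableSet S := by
    intro S hS
    simp only [𝒮, Finset.mem_union, Finset.mem_image₂, Finset.mem_image] at hS
    rcases hS with (((h | ⟨g, _, T, hT, rfl⟩) | ⟨w, _, g, _, rfl⟩) | ⟨w, _, rfl⟩) | ⟨w, _, rfl⟩
    · exact h𝒯 S h
    · exact measurable_const_smul g (h𝒯 T hT)
    · exact measurableSet_sec w g
    · exact measurableSet_srcSet w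
    · exact measurableSet_tailSet w K₁
  -- Besides the given elements, group elements with inverses are needed to obtain nearly total
  -- maps, and unit bisections of the cells as well as of the test sets to choose the samples.
  let F₀ : Finset (InvSemigroup G μ) := E₀ ∪ (K' ∪ K'⁻¹).image (unitary μ) ∪
    𝒮.image (arrOf μ 1) ∪ 𝒮.powerset.image fun c => arrOf μ 1 (signCell 𝒮 c)
  have m1 : ∀ w ∈ E₀, w ∈ F₀ := fun w hw => by simp [F₀, hw]
  have m2 : ∀ g ∈ K', unitary μ g ∈ F₀ := fun g hg => by
    simp only [F₀, Finset.mem_union]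
    exact Or.inl (Or.inl (Or.inr (Finset.mem_image_of_mem _ (Finset.mem_union_left _ hg))))
  have m2' : ∀ g ∈ K', unitary μ g⁻¹ ∈ F₀ := fun g hg => by
    simp only [F₀, Finset.mem_union]
    exact Or.inl (Or.inl (Or.inr (Finset.mem_image_of_mem _
      (Finset.mem_union_right _ (Finset.inv_mem_inv hg)))))
  have m3 : ∀ S ∈ 𝒮, arrOf μ 1 S ∈ F₀ := fun S hS => by
    simp only [F₀, Finset.mem_union]
    exact Or.inl (Or.inr (Finset.mem_image_of_mem _ hS))
  have m4 : ∀ c ∈ 𝒮.powerset, arrOf μ 1 (signCell 𝒮 c) ∈ F₀ := fun c hc => by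
    simp only [F₀, Finset.mem_union]
    exact Or.inr (Finset.mem_image_of_mem (fun c => arrOf μ 1 (signCell 𝒮 c)) hc)
  have k1 : (1 : G) ∈ K' := Finset.mem_insert_self _ _
  have k2 : K ⊆ K' := fun g hg => Finset.mem_insert_of_mem (Finset.mem_union_left _ hg)
  have k3 : ∀ g ∈ K, ∀ h ∈ K, g * h ∈ K' := fun g hg h hh =>
    Finset.mem_insert_of_mem (Finset.mem_union_right _ (Finset.mul_mem_mul hg hh))
  let δ : ℝ := min 1 (min (η / 7) (κ / 2 / (4 * K₁.card + 5)))
  have hδ : 0 < δ := by simp only [δ]; positivity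
  have hδ1 : δ ≤ 1 := min_le_left _ _
  have hδη : 7 * δ ≤ η := by
    have : δ ≤ η / 7 := (min_le_right _ _).trans (min_le_left _ _)
    linarith
  have hδκ : (4 * K₁.card + 5) * δ ≤ κ / 2 := by
    have : δ ≤ κ / 2 / (4 * K₁.card + 5) := (min_le_right _ _).trans (min_le_right _ _)
    rw [le_div_iff₀ (by positivity)] at this
    linarith
  refine ⟨F₀, δ, hδ, fun d hd φ hφ => ?_⟩
  obtain ⟨f, hf1, hf2, hf3⟩ := exists_pequiv_of_mem_SA hd hφ
  have hrep : IsApproxRep F₀ δ f := ⟨hf2, fun a ha b hb => (hf3 a ha b hb).trans (by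
    have : δ ^ 2 ≤ δ := by nlinarith
    gcongr)⟩
  choose τ hτ using fun g : G => exists_perm_extending (f (unitary μ g))
  obtain ⟨x, hx0, hx⟩ := exists_samples h𝒮 hX₀ φ f (hf1 _ (m2 1 k1)) (fun S hS => hf1 _ (m3 S hS))
    (fun c hc => hf1 _ (m4 c hc))
  -- The image of the unit is only close to the identity, whereas a model demands `σ 1 = 1` exactly.
  let σ : G → Equiv.Perm (Fin d) := fun g => if g = 1 then 1 else τ g
  have hδd : 0 ≤ δ * d := by positivity
  have hR : IsReadOff F₀ δ f K' 𝒮 σ x :=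
    { hrep with
      one_mem := m2 1 k1
      unitary_mem := m2
      unit_mem := m3
      meas := h𝒮
      perm := by
        intro g hg
        by_cases h1 : g = 1
        · subst h1
          have := hrep.cnt_one_ne_le (m2 1 k1)
          simp only [σ, if_true, Equiv.Perm.one_apply]
          linarith
        · refine (cnt_mono fun v hv => ?_).trans
            (hrep.cnt_eq_none_le (m2 1 k1) (m2 g hg) (m2' g hg))
          simp only [σ, h1, if_false] at hv
          rcases hn : f (unitary μ g) v with _ | u
          · rfl
          · exact absurd (by rw [hn, hτ g v u hn]) hv
      point := hx }
  have hmono : ∀ {a : ℝ}, a ≤ 7 → a * δ * d ≤ η * d := by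
    intro a ha
    have : a * δ ≤ η := by nlinarith
    gcongr
  refine ⟨σ, x, hx0, ⟨if_pos rfl, ?_, ?_, ?_, ?_⟩, ?_⟩
  · exact fun g hg h hh => (hR.mul_le (k2 hg) (k2 hh) (k3 g hg h hh)).trans (hmono le_rfl)
  · exact fun g hg h1 => (hR.free_le (k2 hg) h1).trans (hmono (by norm_num))
  · exact fun T hT => (hR.meas_le (by simp [𝒮, hT])).trans (hmono (by norm_num))
  · refine fun T hT g hg => (hR.equi_le (by simp [𝒮, hT]) (k2 hg) ?_).trans (hmono le_rfl)
    simp only [𝒮, Finset.mem_union]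
    exact Or.inl (Or.inl (Or.inl (Or.inr (Finset.mem_image₂_of_mem hg hT))))
  · intro w hw
    refine ⟨f w, hf1 w (m1 w hw), (hR.control_le w (m1 w hw) (hK₁.trans k2) ?_ ?_ ?_
      (htail w hw)).trans ?_⟩
    · intro g hg
      simp only [𝒮, Finset.mem_union]
      exact Or.inl (Or.inl (Or.inr (Finset.mem_image₂_of_mem hw hg)))
    · simp only [𝒮, Finset.mem_union]
      exact Or.inl (Or.inr (Finset.mem_image_of_mem _ hw))
    · simp only [𝒮, Finset.mem_union]
      exact Or.inr (Finset.mem_image_of_mem (tailSet · K₁) hw)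
    · have : κ / 2 + (4 * K₁.card + 5) * δ ≤ κ := by linarith
      gcongr

end SAToModel


/-! ## Comparison of the counting functions -/

section Words

/-- The permutation of an element of a generated subgroup is determined, up to few points, by the
permutations of the generators. -/
theorem exists_word_eval {G : Type*} [Group G] (E : Finset G) {g : G}
    (hg : g ∈ Subgroup.closure (E : Set G)) :
    ∃ (ev : ∀ d : ℕ, (E → Equiv.Perm (Fin d)) → Equiv.Perm (Fin d)) (K : Finset G) (C : ℝ), 0 ≤ C ∧
      ∀ (d : ℕ) (σ : G → Equiv.Perm (Fin d)) (ε : ℝ), 0 ≤ ε → σ 1 = 1 →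
        (∀ a ∈ K, ∀ b ∈ K, cnt (fun v => σ (a * b) v ≠ σ a (σ b v)) ≤ ε) →
        cnt (fun v => σ g v ≠ ev d (fun s => σ s) v) ≤ C * ε := by
  classical
  induction hg using Subgroup.closure_induction with
  | mem s hs =>
    refine ⟨fun d τ => τ ⟨s, hs⟩, ∅, 0, le_rfl, fun d σ ε _ _ _ => ?_⟩
    rw [cnt_eq_zero fun v => by simp, zero_mul]
  | one =>
    refine ⟨fun d τ => 1, ∅, 0, le_rfl, fun d σ ε _ h1 _ => ?_⟩
    rw [cnt_eq_zero fun v => by simp [h1], zero_mul]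
  | mul a b _ _ iha ihb =>
    obtain ⟨eva, Ka, Ca, hCa, ha⟩ := iha
    obtain ⟨evb, Kb, Cb, hCb, hb⟩ := ihb
    refine ⟨fun d τ => eva d τ * evb d τ, {a, b} ∪ Ka ∪ Kb, 1 + (Ca + Cb), by positivity,
      fun d σ ε hε h1 hK => ?_⟩
    have a1 := ha d σ ε hε h1 fun s hs t ht => hK s (by simp [hs]) t (by simp [ht])
    have b1 := hb d σ ε hε h1 fun s hs t ht => hK s (by simp [hs]) t (by simp [ht])
    have c1 := hK a (by simp) b (by simp)
    rw [← cnt_perm (evb d fun s => σ s)] at a1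
    have h2 := cnt_or_le (fun v => σ a ((evb d fun s => σ s) v) ≠
      (eva d fun s => σ s) ((evb d fun s => σ s) v)) (fun v => σ b v ≠ (evb d fun s => σ s) v)
    have h3 : cnt (fun v => σ (a * b) v ≠ ((eva d fun s => σ s) * (evb d fun s => σ s)) v) ≤ _ :=
      cnt_le_of_or (q := fun v => σ (a * b) v ≠ σ a (σ b v))
        (r := fun v => σ a ((evb d fun s => σ s) v) ≠
          (eva d fun s => σ s) ((evb d fun s => σ s) v) ∨ σ b v ≠ (evb d fun s => σ s) v)
        (fun v hv => by
          by_contra hcon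
          push Not at hcon
          apply hv
          rw [hcon.1, hcon.2.2, hcon.2.1]
          rfl)
    linarith
  | inv a _ iha =>
    obtain ⟨ev, Ka, Ca, hCa, ha⟩ := iha
    refine ⟨fun d τ => (ev d τ)⁻¹, {a, a⁻¹} ∪ Ka, 1 + Ca, by positivity,
      fun d σ ε hε h1 hK => ?_⟩
    have a1 := ha d σ ε hε h1 fun s hs t ht => hK s (by simp [hs]) t (by simp [ht])
    have c1 := hK a⁻¹ (by simp) a (by simp)
    -- Reindexing by the word permutation puts its inverse back at `v`; then `σ a⁻¹ (σ a v) = v` up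
    -- to the multiplicativity error is the required comparison.
    rw [← cnt_perm (ev d fun s => σ s)]
    have h3 : cnt (fun v => σ a⁻¹ ((ev d fun s => σ s) v) ≠
        (ev d fun s => σ s)⁻¹ ((ev d fun s => σ s) v)) ≤ _ :=
      cnt_le_of_or (q := fun v => σ (a⁻¹ * a) v ≠ σ a⁻¹ (σ a v))
        (r := fun v => σ a v ≠ (ev d fun s => σ s) v)
        (fun v hv => by
          by_contra hcon
          push Not at hcon
          apply hv
          have e : (ev d fun s => σ s)⁻¹ ((ev d fun s => σ s) v) = v :=
            (ev d fun s => σ s).symm_apply_apply v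
          rw [e, ← hcon.2, ← hcon.1, inv_mul_cancel, h1]
          rfl)
    linarith

end Words

/-! ### Comparison of the two counts -/

section Comparison

variable {G X : Type*} [Group G] [MulAction G X] [MeasurableSpace X] [MeasurableSpace G]
  [Countable G] [DiscreteMeasurableSpace G] [MeasurableConstSMul G X]
  {μ : Measure X} [IsProbabilityMeasure μ] [SMulInvariantMeasure G X μ]

theorem encard_perm_near_le {ι : Type*} [Fintype ι] {d : ℕ} (κ : ℝ)
    (S : ι → Fin d → Finset (Fin d)) (hS : ∀ i v, (S i v).card ≤ 1) :
    {σ : ι → Equiv.Perm (Fin d) | ∀ i, cnt (fun v => σ i v ∉ S i v) ≤ κ * d}.encard ≤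
      (hamBound 1 κ d ^ Fintype.card ι : ℕ) := by
  refine le_trans ?_ (encard_pi_le (fun i => {f : Fin d → Fin d | cnt (fun v => f v ∉ S i v) ≤ κ * d})
    fun i => encard_near_le le_rfl κ (by simp) (S i) (hS i))
  refine Set.encard_le_encard_of_injOn (f := fun σ i v => σ i v) ?_ ?_
  · intro σ hσ i _
    exact hσ i
  · intro σ _ τ _ h
    funext i
    ext1 v
    exact congrFun (congrFun h i) v

/-- A bound exponential in `d`, hence of rate zero on the scale `d log d`. It is the reason why the
choice of `Q` does not affect the value. -/
theorem encard_zero_one_le {ι : Type*} [Finite ι] {N : ℕ} (hN : Nat.card ι ≤ N) (d : ℕ) :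
    {ψ : ι → Fin d → ℂ | ∀ i v, ψ i v = 0 ∨ ψ i v = 1}.encard ≤ (2 ^ (d * N) : ℕ) := by
  have := Fintype.ofFinite ι
  have e : {ψ : ι → Fin d → ℂ | ∀ i v, ψ i v = 0 ∨ ψ i v = 1} =
      Set.univ.pi fun _ : ι => Set.univ.pi fun _ : Fin d => ({0, 1} : Set ℂ) := by
    ext ψ
    simp
  rw [e]
  refine (encard_pi_le _ (N := 2 ^ d) fun i => ?_).trans ?_
  · refine (encard_pi_le _ (N := 2) fun i => ?_).trans ?_
    · exact (Set.encard_insert_le _ _).trans (by rw [Set.encard_singleton]; norm_num)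
    · simp
  · rw [← pow_mul, ← Nat.card_eq_fintype_card]
    norm_cast
    exact Nat.pow_le_pow_right (by norm_num) (Nat.mul_le_mul_left _ hN)

open Classical in
/-- The entries are found in the columns of a matrix that are standard basis vectors. -/
noncomputable def basisIndex {d : ℕ} (A : Matrix (Fin d) (Fin d) ℂ) (v : Fin d) : Finset (Fin d) :=
  Finset.univ.filter fun i => ∀ j, A j v = if i = j then 1 else 0

theorem card_basisIndex_le {d : ℕ} (A : Matrix (Fin d) (Fin d) ℂ) (v : Fin d) :
    (basisIndex A v).card ≤ 1 := by
  classical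
  rw [Finset.card_le_one]
  intro i hi j hj
  have h1 := (Finset.mem_filter.1 hi).2 i
  have h2 := (Finset.mem_filter.1 hj).2 i
  rw [h1, if_pos rfl] at h2
  by_contra hne
  rw [if_neg (Ne.symm hne)] at h2
  exact one_ne_zero h2

/-- A pair in `HA` gives a model with the same `σ`, which gives a `ψ` in `SA`. The columns of `ψ` at
the elements of `E` reveal `σ` on `E` except at few vertices, so few restricted pairs share one `ψ`.
The data `K`, `𝒯` and `η` do not depend on `F` and `P`, which may therefore be chosen afterwards. -/
theorem exists_sAct_le {lim : (ℕ → EReal) → EReal} (hlim : IsLimLike lim) (E : Finset G)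
    {Q : Finset (Linfty μ)} (hQ : ∀ q ∈ Q, q * q = q) (F₀ : Finset (InvSemigroup G μ)) (n₀ : ℕ)
    {δ₀ : ℝ} (hδ₀ : 0 < δ₀) {κ : ℝ} (hκ : 0 < κ) [DecidableEq (InvSemigroup G μ)] :
    ∃ (K : Finset G) (𝒯 : Finset (Set X)) (η : ℝ), 0 < η ∧ (∀ T ∈ 𝒯, MeasurableSet T) ∧
      ∀ (F : Finset G) (P : Finset (Linfty μ)) (m : ℕ), IsProjPartition P → K ⊆ window F m →
        (∀ T ∈ 𝒯, Approximable (μ := μ) η (window F m) P T) →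
        sAct lim E Q F P ≤
          lim (rate (cardSA μ (E.image (unitary μ)) F₀ n₀ δ₀)) + (κ : ℝ) := by
  classical
  -- One Hamming ball of radius `κ' d` is spent for each element of `E`; the factor `4` is the one
  -- required by `eventually_log_hamBound_le`.
  let κ' : ℝ := κ / (4 * (E.card + 1))
  have hκ' : 0 < κ' := by positivity
  have hκκ : 4 * E.card * κ' ≤ κ := by
    simp only [κ']
    rw [mul_div_assoc', div_le_iff₀ (by positivity)]
    nlinarith
  obtain ⟨K, 𝒯, η, X₀, h𝒯, hη, hX₀, hL2⟩ :=
    exists_mem_SA_of_isModel μ F₀ n₀ hδ₀ E hκ'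
  refine ⟨K, 𝒯, η / (4 * ((𝒯.card + 1) * (K.card + 1))), by positivity, h𝒯,
    fun F P m hP hK happ => ?_⟩
  obtain ⟨n, hn, δ, hδ, hL1⟩ := exists_isModel_of_mem_HA hη hX₀ h𝒯 hP hK happ
  refine (iInf₂_le_of_le n hn (iInf₂_le δ hδ)).trans (hlim _ _ κ ?_)
  refine rate_le_rate_add (N := fun d => hamBound 1 κ' d ^ E.card * 2 ^ (d * Q.card)) ?_ ?_
    (eventually_log_hamBound_le le_rfl _ _ hκ hκ'.le hκκ)
  swap
  · refine Eventually.of_forall fun d => ?_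
    have := hamBound_pos (le_refl 1) κ' d
    positivity
  filter_upwards [eventually_gt_atTop 0] with d hd
  -- A restricted pair is related to a restricted element of `SA` when its permutations nearly agree
  -- with the basis-vector columns and its functions have values zero or one.
  refine encard_le_mul_of_rel (R := fun t s =>
    (∀ g : E, cnt (fun v => s.1 g v ∉
      basisIndex (t ⟨unitary μ (g : G), Finset.mem_image_of_mem _ g.2⟩) v) ≤ κ' * d) ∧
    ∀ a v, s.2 a v = 0 ∨ s.2 a v = 1) ?_ ?_ ?_
  · have := hamBound_pos (le_refl 1) κ' d
    positivity
  · rintro _ ⟨⟨σ, φ⟩, hφ, rfl⟩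
    obtain ⟨x, hx0, hM⟩ := hL1 d hd σ φ hφ
    obtain ⟨ψ, hψ, hcol⟩ := hL2 d hd σ x hM hx0
    refine ⟨_, ⟨ψ, hψ, rfl⟩, fun g => ?_, fun a v => ?_⟩
    · refine le_trans (cnt_mono fun v hv => ?_) (hcol g g.2)
      intro hcon
      apply hv
      exact Finset.mem_filter.2 ⟨Finset.mem_univ _, hcon⟩
    · have h := congrFun (hφ.2.1.2 a.1 a.1 a.1 (hQ _ a.2).symm) v
      simp only [Pi.mul_apply] at h
      have h' : φ a.1 v * (φ a.1 v - 1) = 0 := by linear_combination -h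
      rcases mul_eq_zero.1 h' with h' | h'
      · exact Or.inl h'
      · exact Or.inr (sub_eq_zero.1 h')
  · intro t _
    let A := {a : domHA F P n // (a : Linfty μ) ∈ Q}
    let ι : A → Q := fun a => ⟨a.1, a.2⟩
    have hι : Function.Injective ι := by
      intro a b h
      have := congrArg Subtype.val h
      exact Subtype.ext (Subtype.ext this)
    have : Finite A := Finite.of_injective ι hι
    have hA : Nat.card A ≤ Q.card := by
      refine (Nat.card_le_card_of_injective ι hι).trans ?_
      simp
    have e : {s : (E → Equiv.Perm (Fin d)) × (A → Fin d → ℂ) | (∀ g : E, cnt (fun v => s.1 g v ∉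
        basisIndex (t ⟨unitary μ (g : G), Finset.mem_image_of_mem _ g.2⟩) v) ≤ κ' * d) ∧
        ∀ a v, s.2 a v = 0 ∨ s.2 a v = 1} = {σ : E → Equiv.Perm (Fin d) | ∀ g : E,
          cnt (fun v => σ g v ∉
            basisIndex (t ⟨unitary μ (g : G), Finset.mem_image_of_mem _ g.2⟩) v) ≤ κ' * d} ×ˢ
        {ψ : A → Fin d → ℂ | ∀ i v, ψ i v = 0 ∨ ψ i v = 1} := by
      ext s; rfl
    refine (congrArg Set.encard e).le.trans ?_
    rw [Set.encard_prod, Nat.cast_mul]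
    refine mul_le_mul' ?_ (encard_zero_one_le hA d)
    refine (encard_perm_near_le κ' _ fun g v => card_basisIndex_le _ v).trans ?_
    simp

/-- An element `φ` of `SA` gives a model and then a pair in `HA` with the same `σ`. At most vertices
`φ` of a given `w` is undefined or agrees with one of finitely many `σ g`, each nearly a word in `σ`
on `E`. Knowing `σ` on `E` thus leaves boundedly many values per vertex, and the part of the pair
living on `Q` is not needed. -/
theorem exists_cardSA_rate_le {lim : (ℕ → EReal) → EReal} (hlim : IsLimLike lim)
    (E₀ : Finset (InvSemigroup G μ)) {κ : ℝ} (hκ : 0 < κ) :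
    ∃ K : Finset G, ∀ E : Finset G, (K : Set G) ⊆ Subgroup.closure (E : Set G) →
      ∀ (Q : Finset (Linfty μ)) (F : Finset G) (P : Finset (Linfty μ)), IsProjPartition P →
      ∀ (n : ℕ) (δ : ℝ), 0 < δ → ∃ (F₀ : Finset (InvSemigroup G μ)) (δ₀ : ℝ), 0 < δ₀ ∧
        lim (rate (cardSA μ E₀ F₀ 2 δ₀)) ≤ lim (rate (cardHA E Q F P n δ)) + (κ : ℝ) := by
  classical
  let κ' : ℝ := κ / (4 * (E₀.card + 1))
  have hκ' : 0 < κ' := by positivity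
  have hκκ : 4 * E₀.card * κ' ≤ κ := by
    simp only [κ']
    rw [mul_div_assoc', div_le_iff₀ (by positivity)]
    nlinarith
  -- The tolerance `κ'` is halved: one half pays for replacing `σ g` by words, the other for
  -- controlling the image of `w`, which in turn needs tails of half that size.
  obtain ⟨K₁, hK₁⟩ := exists_forall_tailSet_le E₀ (show 0 < κ' / 2 / 2 by positivity)
  refine ⟨K₁, fun E hE Q F P hP n δ hδ => ?_⟩
  choose ev Kw C hC hev using fun g : K₁ => exists_word_eval E (hE g.2)
  obtain ⟨K, 𝒯, η, X₀, h𝒯, hη, hX₀, hL4⟩ := exists_mem_HA_of_isModel (μ := μ) F P hP n hδ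
  let B : ℝ := ∑ g, C g
  have hB : 0 ≤ B := Finset.sum_nonneg fun g _ => hC g
  let η' : ℝ := min η (κ' / 2 / (B + 1))
  have hη' : 0 < η' := by simp only [η']; positivity
  have hBη : B * η' ≤ κ' / 2 := by
    have : η' ≤ κ' / 2 / (B + 1) := min_le_right _ _
    rw [le_div_iff₀ (by positivity)] at this
    nlinarith
  let K' : Finset G := K ∪ Finset.univ.biUnion Kw ∪ K₁
  obtain ⟨F₀, δ₀, hδ₀, hL3⟩ := exists_isModel_of_mem_SA (μ := μ) K' h𝒯 hη' hX₀ E₀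
    (K₁ := K₁) Finset.subset_union_right (κ := κ' / 2) (by positivity)
    (hK₁ K₁ (Finset.Subset.refl _))
  refine ⟨F₀, δ₀, hδ₀, hlim _ _ κ ?_⟩
  have hL : 1 ≤ K₁.card + 1 := Nat.le_add_left _ _
  -- The trivial factor `2 ^ (d * 0)` only matches the shape of the growth estimate; there are no
  -- values on `Q` to count here.
  refine rate_le_rate_add (N := fun d => hamBound (K₁.card + 1) κ' d ^ E₀.card * 2 ^ (d * 0)) ?_ ?_
    (eventually_log_hamBound_le hL _ _ hκ hκ'.le hκκ)
  swap
  · refine Eventually.of_forall fun d => ?_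
    have := hamBound_pos hL κ' d
    positivity
  filter_upwards [eventually_gt_atTop 0] with d hd
  -- The possible images of `v`: undefined, or moved by one of the words representing the elements
  -- of `K₁`. This gives `K₁.card + 1` choices.
  let S : (E → Equiv.Perm (Fin d)) → Fin d → Finset (Option (Fin d)) := fun τ v =>
    insert none (Finset.univ.image fun g : K₁ => some (ev g d τ v))
  refine encard_le_mul_of_rel (R := fun t s => ∀ w, ∃ f : Fin d ≃. Fin d, s w = pmat f ∧
    cnt (fun v => f v ∉ S t.1 v) ≤ κ' * d) ?_ ?_ ?_
  · have := hamBound_pos hL κ' d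
    positivity
  · rintro _ ⟨φ, hφ, rfl⟩
    obtain ⟨σ, x, hx0, hM, hw⟩ := hL3 d hd φ hφ
    obtain ⟨ψ, hψ⟩ := hL4 d hd σ x (hM.mono
      (Finset.subset_union_left.trans Finset.subset_union_left) (Finset.Subset.refl _)
      (min_le_left _ _)) hx0
    refine ⟨_, ⟨(σ, ψ), hψ, rfl⟩, fun w => ?_⟩
    obtain ⟨f, hf, hfc⟩ := hw w w.2
    refine ⟨f, hf, ?_⟩
    have hev' : cnt (fun v => ∃ g ∈ (Finset.univ : Finset K₁),
        σ g v ≠ ev g d (fun s => σ s) v) ≤ κ' / 2 * d := by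
      refine (cnt_exists_le _ _).trans ?_
      have h1 : ∀ g ∈ (Finset.univ : Finset K₁),
          cnt (fun v => σ g v ≠ ev g d (fun s => σ s) v) ≤ C g * (η' * d) := by
        intro g _
        have hsub : Kw g ⊆ K' := (Finset.subset_biUnion_of_mem Kw (Finset.mem_univ g)).trans
          (Finset.subset_union_right.trans Finset.subset_union_left)
        exact hev g d σ (η' * d) (by positivity) hM.one fun a ha b hb =>
          hM.mul a (hsub ha) b (hsub hb)
      refine (Finset.sum_le_sum h1).trans ?_
      rw [← Finset.sum_mul]
      have : B * η' * d ≤ κ' / 2 * d := by gcongr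
      linarith
    have h2 : cnt (fun v => f v ∉ S (fun s => σ s) v) ≤ _ :=
      cnt_le_of_or (q := fun v => ¬ (f v = none ∨ ∃ g ∈ K₁, f v = some (σ g v)))
      (r := fun v => ∃ g ∈ (Finset.univ : Finset K₁), σ g v ≠ ev g d (fun s => σ s) v)
      (fun v hv => by
        by_contra hcon
        rw [not_or, not_not] at hcon
        obtain ⟨h3, h4⟩ := hcon
        push Not at h4
        apply hv
        simp only [S]
        rcases h3 with h3 | ⟨g, hg, h3⟩
        · rw [h3]; exact Finset.mem_insert_self _ _
        · refine Finset.mem_insert_of_mem (Finset.mem_image.2 ⟨⟨g, hg⟩, Finset.mem_univ _, ?_⟩)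
          rw [h3, ← h4 ⟨g, hg⟩ (Finset.mem_univ _)])
    change cnt (fun v => f v ∉ S (fun s => σ s) v) ≤ _
    linarith
  · intro t _
    have hS : ∀ v, (S t.1 v).card ≤ K₁.card + 1 := by
      intro v
      refine (Finset.card_insert_le _ _).trans ?_
      have := Finset.card_image_le (s := (Finset.univ : Finset K₁))
        (f := fun g : K₁ => some (ev g d t.1 v))
      simpa using this
    have h1 := encard_near_le hL κ' (β := Option (Fin d)) (by simp) (S t.1) hS
    let M : (Fin d → Option (Fin d)) → Matrix (Fin d) (Fin d) ℂ :=
      fun f i v => if f v = some i then 1 else 0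
    refine le_trans (Set.encard_le_encard ?_) ((encard_pi_le (fun _ : E₀ => M ''
      {f : Fin d → Option (Fin d) | cnt (fun v => f v ∉ S t.1 v) ≤ κ' * d})
      fun _ => (Set.encard_image_le _ _).trans h1).trans ?_)
    · intro s hs w _
      obtain ⟨f, hf, hfc⟩ := hs w
      refine ⟨f, hfc, ?_⟩
      rw [hf]
      ext i v
      rw [pmat_apply]
    · simp

end Comparison


/-! ## Approximation of measurable sets by means of a dynamically generating set -/

section Density

variable {X : Type*} [MeasurableSpace X] {μ : Measure X}

theorem coe_add_ae (a b : Linfty μ) :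
    ∀ᵐ x ∂μ, ((a + b : Linfty μ) : X →ₘ[μ] ℂ) x = (a : X →ₘ[μ] ℂ) x + (b : X →ₘ[μ] ℂ) x := by
  filter_upwards [AEEqFun.coeFn_add (a : X →ₘ[μ] ℂ) (b : X →ₘ[μ] ℂ)] with x hx
  exact hx

theorem coe_star_ae (a : Linfty μ) :
    ∀ᵐ x ∂μ, ((star a : Linfty μ) : X →ₘ[μ] ℂ) x = star ((a : X →ₘ[μ] ℂ) x) := by
  filter_upwards [AEEqFun.coeFn_star (a : X →ₘ[μ] ℂ)] with x hx
  exact hx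

theorem coe_algebraMap_ae (r : ℂ) :
    ∀ᵐ x ∂μ, ((algebraMap ℂ (Linfty μ) r : Linfty μ) : X →ₘ[μ] ℂ) x = r := by
  have e : ((algebraMap ℂ (Linfty μ) r : Linfty μ) : X →ₘ[μ] ℂ) = r • (1 : X →ₘ[μ] ℂ) :=
    Algebra.algebraMap_eq_smul_one r
  rw [e]
  filter_upwards [AEEqFun.coeFn_smul r (1 : X →ₘ[μ] ℂ),
    AEEqFun.coeFn_one (α := X) (β := ℂ) (μ := μ)] with x h1 h2
  simp [h1, h2]

/-- The functions in `L^∞` that are measurable, up to null sets, for a given `σ`-algebra. -/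
def measSubalgebra {X : Type*} (m : MeasurableSpace X) [MeasurableSpace X] (μ : Measure X) :
    StarSubalgebra ℂ (Linfty μ) where
  carrier := {f | AEStronglyMeasurable[m] (f : X →ₘ[μ] ℂ) μ}
  mul_mem' {a b} ha hb := by
    have h : AEStronglyMeasurable[m] (fun x => (a : X →ₘ[μ] ℂ) x * (b : X →ₘ[μ] ℂ) x) μ :=
      ha.mul hb
    exact h.congr ((coe_mul_ae a b).mono fun x hx => hx.symm)
  add_mem' {a b} ha hb := by
    have h : AEStronglyMeasurable[m] (fun x => (a : X →ₘ[μ] ℂ) x + (b : X →ₘ[μ] ℂ) x) μ :=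
      ha.add hb
    exact h.congr ((coe_add_ae a b).mono fun x hx => hx.symm)
  algebraMap_mem' r := by
    have h : AEStronglyMeasurable[m] (fun _ : X => r) μ :=
      (@stronglyMeasurable_const _ _ m _ r).aestronglyMeasurable
    exact h.congr ((coe_algebraMap_ae r).mono fun x hx => hx.symm)
  star_mem' {a} ha := by
    have h : AEStronglyMeasurable[m] (fun x => star ((a : X →ₘ[μ] ℂ) x)) μ :=
      continuous_star.comp_aestronglyMeasurable ha
    exact h.congr ((coe_star_ae a).mono fun x hx => hx.symm)

/-- For a finite measure `L^∞` lies in `L^2`, where the `m`-measurable functions form a closed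
subspace, namely the orthogonal complement of its own complement. Orthogonality to an `L^2` vector
is the vanishing of the pairing with an `L^1` function, so the algebra is an intersection of kernels
of weak-`*` continuous functionals. -/
theorem isClosed_measSubalgebra {X : Type*} {m : MeasurableSpace X} [m₀ : MeasurableSpace X]
    {μ : Measure X} [IsProbabilityMeasure μ] (hm : m ≤ m₀) :
    @IsClosed _ (weakStar μ) (measSubalgebra m μ : Set (Linfty μ)) := by
  have : Fact (m ≤ m₀) := ⟨hm⟩
  let V : Submodule ℂ (X →₂[μ] ℂ) := lpMeas ℂ ℂ m 2 μ
  have hL2 : ∀ f : Linfty μ, MemLp (f : X →ₘ[μ] ℂ) 2 μ := fun f => MemLp.mono_exponent f.2 le_top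
  have hL1 : ∀ h : X →₂[μ] ℂ, MemLp (fun x => star (h x)) 1 μ := fun h =>
    ((Lp.memLp h).star).mono_exponent (by norm_num)
  have key : ∀ f : Linfty μ, f ∈ measSubalgebra m μ ↔ ∀ h ∈ Vᗮ,
      ∫ x, (f : X →ₘ[μ] ℂ) x * ((hL1 h).toLp _ : X →₁[μ] ℂ) x ∂μ = 0 := by
    intro f
    have e1 : f ∈ measSubalgebra m μ ↔ (hL2 f).toLp _ ∈ V := by
      rw [mem_lpMeas_iff_aestronglyMeasurable]
      exact ⟨fun h => AEStronglyMeasurable.congr h (hL2 f).coeFn_toLp.symm,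
        fun h => h.congr (hL2 f).coeFn_toLp⟩
    have e3 : (hL2 f).toLp _ ∈ V ↔ ∀ h ∈ Vᗮ, inner ℂ h ((hL2 f).toLp _) = 0 := by
      conv_lhs => rw [← Submodule.orthogonal_orthogonal V]
      exact Submodule.mem_orthogonal _ _
    rw [e1, e3]
    refine forall₂_congr fun h _ => ?_
    rw [L2.inner_def]
    have e2 : ∫ x, inner ℂ (h x) ((hL2 f).toLp (f : X →ₘ[μ] ℂ) x) ∂μ =
        ∫ x, (f : X →ₘ[μ] ℂ) x * ((hL1 h).toLp _ : X →₁[μ] ℂ) x ∂μ := by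
      refine integral_congr_ae ?_
      filter_upwards [(hL2 f).coeFn_toLp, (hL1 h).coeFn_toLp] with x h1 h2
      rw [h1, h2]
      simp
    rw [e2]
  refine isClosed_induced_iff.2 ⟨⋂ h : Vᗮ, {Φ | Φ ((hL1 h).toLp _) = 0}, ?_, ?_⟩
  · exact isClosed_iInter fun h => isClosed_singleton.preimage (continuous_apply _)
  · ext f
    rw [SetLike.mem_coe, key f]
    simp

variable {G : Type*} [Group G] [MulAction G X] [MeasurableConstSMul G X]
  [SMulInvariantMeasure G X μ]

theorem Determined.mono {J J' : Finset G} {R R' : Finset (Linfty μ)} {B : Set X}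
    (h : Determined (μ := μ) J R B) (hJ : J ⊆ J') (hR : R ⊆ R') : Determined (μ := μ) J' R' B := by
  obtain ⟨Z, hZ, h⟩ := h
  exact ⟨Z, hZ, fun x hx y hy hxy => h x hx y hy fun s hs p hp => hxy s (hJ hs) p (hR hp)⟩

theorem Approximable.mono {ε : ℝ} {J J' : Finset G} {R R' : Finset (Linfty μ)} {B : Set X}
    (h : Approximable (μ := μ) ε J R B) (hJ : J ⊆ J') (hR : R ⊆ R') :
    Approximable (μ := μ) ε J' R' B := by
  obtain ⟨T, h1, h2, h3⟩ := h
  exact ⟨T, h1, h2, h3.mono hJ hR⟩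

variable (μ G) in
/-- The algebra of the sets determined by finitely many translates of members of `S`. -/
def determinedSets (S : Set (Linfty μ)) : Set (Set X) :=
  {B | MeasurableSet B ∧ ∃ (J : Finset G) (R : Finset (Linfty μ)), (R : Set (Linfty μ)) ⊆ S ∧
    Determined J R B}

/-- Two determined sets are both determined by the unions of their data. Being an algebra is what
the approximation of generated measurable sets requires. -/
theorem isSetAlgebra_determinedSets (S : Set (Linfty μ)) :
    IsSetAlgebra (determinedSets μ G S) where
  empty_mem := ⟨MeasurableSet.empty, ∅, ∅, by simp, Set.univ, univ_mem, fun _ _ _ _ _ => by simp⟩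
  compl_mem := by
    rintro B ⟨hB, J, R, hR, Z, hZ, h⟩
    exact ⟨hB.compl, J, R, hR, Z, hZ, fun x hx y hy hxy => not_congr (h x hx y hy hxy)⟩
  union_mem := by
    classical
    rintro B B' ⟨hB, J, R, hR, h⟩ ⟨hB', J', R', hR', h'⟩
    obtain ⟨Z, hZ, h⟩ := h.mono (J' := J ∪ J') (R' := R ∪ R') Finset.subset_union_left
      Finset.subset_union_left
    obtain ⟨Z', hZ', h'⟩ := h'.mono (J' := J ∪ J') (R' := R ∪ R') Finset.subset_union_right
      Finset.subset_union_right
    refine ⟨hB.union hB', J ∪ J', R ∪ R', by simp [hR, hR'], Z ∩ Z', inter_mem hZ hZ', ?_⟩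
    exact fun x hx y hy hxy => or_congr (h x hx.1 y hy.1 hxy) (h' x hx.2 y hy.2 hxy)

variable (μ G) in
/-- The `σ`-algebra generated by the sets determined by finitely many translates of members
of `S`. -/
@[reducible]
def determinedSpace (S : Set (Linfty μ)) : MeasurableSpace X :=
  MeasurableSpace.generateFrom (determinedSets μ G S)

/-- Measurable sets can be approximated by sets determined by finitely many translates of finitely
many members of a dynamically generating set of projections. -/
theorem exists_approximable [IsProbabilityMeasure μ] {S : Set (Linfty μ)}
    (hS : ∀ p ∈ S, p * p = p) (hgen : DynGenerating G S) {T : Set X} (hT : MeasurableSet T) {ε : ℝ}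
    (hε : 0 < ε) :
    ∃ (J : Finset G) (R : Finset (Linfty μ)), (R : Set (Linfty μ)) ⊆ S ∧
      Approximable (μ := μ) ε J R T := by
  classical
  have hm : determinedSpace μ G S ≤ ‹MeasurableSpace X› := MeasurableSpace.generateFrom_le fun B hB => hB.1
  have hsub : {f : Linfty μ | ∃ s : G, ∃ a ∈ S, f = act s a} ⊆ measSubalgebra (determinedSpace μ G S) μ := by
    rintro _ ⟨s, p, hp, rfl⟩
    have hB : (fun x => s⁻¹ • x) ⁻¹' pset p ∈ determinedSets μ G S :=
      ⟨measurable_const_smul s⁻¹ (measurableSet_pset p), {s}, {p}, by simpa using hp, Set.univ,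
        univ_mem, fun x _ y _ h => h s (by simp) p (by simp)⟩
    have h1 : AEStronglyMeasurable[determinedSpace μ G S]
        (((fun x => s⁻¹ • x) ⁻¹' pset p).indicator fun _ => (1 : ℂ)) μ :=
      ((@stronglyMeasurable_const _ _ (determinedSpace μ G S) _ (1 : ℂ)).indicator
        (MeasurableSpace.measurableSet_generateFrom hB)).aestronglyMeasurable
    refine h1.congr ?_
    filter_upwards [act_ae s p, ae_smul (proj_ae (hS p hp)) s⁻¹] with x h2 h3
    rw [h2, h3]
    rfl
  -- The translates of `S` are measurable for the generated `σ`-algebra, so dynamical generation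
  -- forces every bounded function to be measurable for it up to null sets.
  have htop := hgen (measSubalgebra (determinedSpace μ G S) μ) hsub (isClosed_measSubalgebra hm)
  have hind : AEStronglyMeasurable[determinedSpace μ G S] (ind μ hT : X →ₘ[μ] ℂ) μ := by
    have : ind μ hT ∈ measSubalgebra (determinedSpace μ G S) μ := by rw [htop]; exact StarSubalgebra.mem_top
    exact this
  obtain ⟨g, hg, hgT⟩ := hind
  have hT' : MeasurableSet[determinedSpace μ G S] (g ⁻¹' {1}) := hg.measurable (measurableSet_singleton 1)
  have hTT' : T =ᵐ[μ] g ⁻¹' {1} := by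
    filter_upwards [hgT, ind_ae (μ := μ) hT] with x h1 h2
    apply propext
    change x ∈ T ↔ g x = 1
    rw [← h1, h2]
    by_cases hx : x ∈ T <;> simp [hx]
  -- An algebra of sets is dense in measure in the `σ`-algebra it generates; the measure has to be
  -- trimmed to that smaller `σ`-algebra.
  have hdense := @Measure.MeasureDense.of_generateFrom_isSetAlgebra_finite X (determinedSpace μ G S)
    (μ.trim hm) (determinedSets μ G S) _ (isSetAlgebra_determinedSets S) rfl
  obtain ⟨B, hB, hBε⟩ := @Measure.MeasureDense.approx X (determinedSpace μ G S)
    _ _ hdense _ hT' (measure_ne_top (μ.trim hm) _) ε hε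
  obtain ⟨hBm, J, R, hR, hdet⟩ := hB
  refine ⟨J, R, hR, B, hBm, ?_, hdet⟩
  have hBm' : MeasurableSet[determinedSpace μ G S] B := MeasurableSpace.measurableSet_generateFrom ⟨hBm, J, R, hR, hdet⟩
  rw [trim_measurableSet_eq hm (@MeasurableSet.symmDiff _ (determinedSpace μ G S) _ _ hT' hBm')] at hBε
  have e : μ.real (symmDiff T B) = μ.real (symmDiff (g ⁻¹' {1}) B) :=
    measureReal_congr (hTT'.symmDiff (ae_eq_refl B))
  rw [e, measureReal_def]
  exact ENNReal.toReal_le_of_le_ofReal hε.le hBε.le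

end Density

/-! ### The partition generated by finitely many projections -/

section Refinement

variable {X : Type*} [MeasurableSpace X] {μ : Measure X}

open Classical in
/-- The projection onto the points which lie in the members of `c` and in no other member of `R`. -/
noncomputable def signProj (R c : Finset (Linfty μ)) : Linfty μ :=
  (∏ r ∈ c, r) * ∏ r ∈ R \ c, (1 - r)

theorem isStarProjection_prod {ι : Type*} (I : Finset ι) (f : ι → Linfty μ)
    (h : ∀ i ∈ I, IsStarProjection (f i)) : IsStarProjection (∏ i ∈ I, f i) := by
  classical
  induction I using Finset.induction_on with
  | empty => simp
  | insert a s ha ih =>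
    rw [Finset.prod_insert ha]
    exact (h a (by simp)).mul (ih fun i hi => h i (by simp [hi])) (Commute.all _ _)

open Classical in
theorem signProj_mul_signProj {R c c' : Finset (Linfty μ)} (hR : ∀ r ∈ R, IsStarProjection r)
    (hc : c ⊆ R) (hc' : c' ⊆ R) (h : c ≠ c') : signProj R c * signProj R c' = 0 := by
  have key : ∀ {a b : Finset (Linfty μ)} {r : Linfty μ}, a ⊆ R → r ∈ a → r ∉ b →
      signProj R a * signProj R b = 0 := by
    intro a b r ha hra hrb
    have h1 : r * (1 - r) ∣ signProj R a * signProj R b := by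
      refine mul_dvd_mul ?_ ?_
      · exact (Finset.dvd_prod_of_mem (fun r => r) hra).mul_right _
      · exact (Finset.dvd_prod_of_mem (fun r => 1 - r)
          (Finset.mem_sdiff.2 ⟨ha hra, hrb⟩)).mul_left _
    rw [(hR r (ha hra)).mul_one_sub_self] at h1
    exact zero_dvd_iff.1 h1
  by_cases hsub : c ⊆ c'
  · obtain ⟨r, hr, hr'⟩ : ∃ r ∈ c', r ∉ c := by
      by_contra hcon
      push Not at hcon
      exact h (hsub.antisymm hcon)
    rw [mul_comm]
    exact key hc' hr hr'
  · obtain ⟨r, hr, hr'⟩ := Finset.not_subset.1 hsub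
    exact key hc hr hr'

/-- Expand the product of the factors `r + (1 - r)`, each of which is `1`. -/
theorem sum_signProj (R : Finset (Linfty μ)) : ∑ c ∈ R.powerset, signProj R c = 1 := by
  classical
  have h := Finset.prod_add (fun r : Linfty μ => r) (fun r => 1 - r) R
  simp only [add_sub_cancel, Finset.prod_const_one] at h
  exact h.symm

open Classical in
/-- The partition of unity generated by a finite set of projections. -/
noncomputable def generatedPartition (R : Finset (Linfty μ)) : Finset (Linfty μ) :=
  R.powerset.image (signProj R)

theorem isStarProjection_signProj {R c : Finset (Linfty μ)} (hR : ∀ r ∈ R, IsStarProjection r)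
    (hc : c ⊆ R) : IsStarProjection (signProj R c) := by
  classical
  exact (isStarProjection_prod _ _ fun r hr => hR r (hc hr)).mul
    (isStarProjection_prod _ _ fun r hr => (hR r (Finset.mem_sdiff.1 hr).1).one_sub)
    (Commute.all _ _)

theorem isProjPartition_generatedPartition {R : Finset (Linfty μ)}
    (hR : ∀ r ∈ R, IsStarProjection r) : IsProjPartition (generatedPartition R) := by
  classical
  refine ⟨?_, ?_, ?_⟩
  · intro p hp
    obtain ⟨c, hc, rfl⟩ := Finset.mem_image.1 hp
    exact isStarProjection_signProj hR (Finset.mem_powerset.1 hc)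
  · intro p hp q hq hpq
    obtain ⟨c, hc, rfl⟩ := Finset.mem_image.1 hp
    obtain ⟨c', hc', rfl⟩ := Finset.mem_image.1 hq
    exact signProj_mul_signProj hR (Finset.mem_powerset.1 hc) (Finset.mem_powerset.1 hc')
      fun h => hpq (by rw [h])
  -- Passing to the image identifies equal sign projections. Two of them with different signs are
  -- orthogonal, so if they coincide they vanish and the sum does not change.
  · rw [generatedPartition, Finset.sum_image_of_pairwise_eq_zero, sum_signProj]
    intro c hc c' hc' hne he
    have h1 := signProj_mul_signProj hR (Finset.mem_powerset.1 hc) (Finset.mem_powerset.1 hc') hne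
    rw [← he] at h1
    rw [← h1]
    exact (isStarProjection_signProj hR (Finset.mem_powerset.1 hc)).isIdempotentElem.symm

theorem generatedPartition_mem {R : Finset (Linfty μ)} {M : StarSubalgebra ℂ (Linfty μ)}
    (hR : ∀ r ∈ R, r ∈ M) {p : Linfty μ} (hp : p ∈ generatedPartition R) : p ∈ M := by
  classical
  obtain ⟨c, hc, rfl⟩ := Finset.mem_image.1 hp
  exact mul_mem (prod_mem fun r hr => hR r (Finset.mem_powerset.1 hc hr))
    (prod_mem fun r hr => sub_mem (one_mem M) (hR r (Finset.mem_sdiff.1 hr).1))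

open Classical in
theorem mem_pset_signProj_ae {R : Finset (Linfty μ)} (hR : ∀ r ∈ R, r * r = r) :
    ∀ᵐ x ∂μ, ∀ c ∈ R.powerset, x ∈ pset (signProj R c) ↔ ∀ r ∈ R, (x ∈ pset r ↔ r ∈ c) := by
  refine (Finset.eventually_all _).2 fun c hc => ?_
  have hcR := Finset.mem_powerset.1 hc
  have h1 : ∀ᵐ x ∂μ, ∀ r ∈ R, (r : X →ₘ[μ] ℂ) x = (pset r).indicator (fun _ => (1 : ℂ)) x :=
    (Finset.eventually_all _).2 fun r hr => proj_ae (hR r hr)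
  have h2 : ∀ᵐ x ∂μ, ∀ r ∈ R, ((1 - r : Linfty μ) : X →ₘ[μ] ℂ) x =
      ((1 : Linfty μ) : X →ₘ[μ] ℂ) x - (r : X →ₘ[μ] ℂ) x :=
    (Finset.eventually_all _).2 fun r _ => coe_sub_ae 1 r
  filter_upwards [h1, h2, coe_mul_ae (∏ r ∈ c, r) (∏ r ∈ R \ c, (1 - r)),
    coe_prod_ae c (fun r => r), coe_prod_ae (R \ c) (fun r => 1 - r), coe_one_ae (μ := μ)]
    with x h1 h2 h3 h4 h5 h6
  change ((signProj R c : Linfty μ) : X →ₘ[μ] ℂ) x = 1 ↔ _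
  rw [signProj, h3, h4, h5]
  constructor
  · intro h r hr
    have hne := left_ne_zero_of_mul (h.trans_ne one_ne_zero)
    have hne' := right_ne_zero_of_mul (h.trans_ne one_ne_zero)
    rw [Finset.prod_ne_zero_iff] at hne hne'
    constructor
    · intro hx
      by_contra hrc
      apply hne' r (Finset.mem_sdiff.2 ⟨hr, hrc⟩)
      rw [h2 r hr, h6, h1 r hr, Set.indicator_of_mem hx, sub_self]
    · intro hrc
      by_contra hx
      apply hne r hrc
      rw [h1 r hr, Set.indicator_of_notMem hx]
  · intro h
    rw [Finset.prod_eq_one, Finset.prod_eq_one, one_mul]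
    · intro r hr
      obtain ⟨hrR, hrc⟩ := Finset.mem_sdiff.1 hr
      rw [h2 r hrR, h6, h1 r hrR, Set.indicator_of_notMem (fun hx => hrc ((h r hrR).1 hx)),
        sub_zero]
    · intro r hrc
      rw [h1 r (hcR hrc), Set.indicator_of_mem ((h r (hcR hrc)).2 hrc)]

variable {G : Type*} [Group G] [MulAction G X] [MeasurableConstSMul G X]
  [SMulInvariantMeasure G X μ]

/-- The sign projection whose set contains a point records the membership of that point in all
members of `R`, so agreement on the generated partition implies agreement on `R`. -/
theorem Determined.generatedPartition {J : Finset G} {R : Finset (Linfty μ)} {B : Set X}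
    (hR : ∀ r ∈ R, r * r = r) (h : Determined (μ := μ) J R B) :
    Determined (μ := μ) J (generatedPartition R) B := by
  classical
  obtain ⟨Z, hZ, h⟩ := h
  have h1 : ∀ᵐ x ∂μ, ∀ s ∈ J, ∀ c ∈ R.powerset, s⁻¹ • x ∈ pset (signProj R c) ↔
      ∀ r ∈ R, (s⁻¹ • x ∈ pset r ↔ r ∈ c) :=
    (Finset.eventually_all _).2 fun s _ => ae_smul (mem_pset_signProj_ae hR) s⁻¹
  refine ⟨Z ∩ {x | ∀ s ∈ J, ∀ c ∈ R.powerset, s⁻¹ • x ∈ pset (signProj R c) ↔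
      ∀ r ∈ R, (s⁻¹ • x ∈ pset r ↔ r ∈ c)}, inter_mem hZ h1, ?_⟩
  intro x hx y hy hxy
  refine h x hx.1 y hy.1 fun s hs r hr => ?_
  let c : Finset (Linfty μ) := R.filter fun r => s⁻¹ • x ∈ pset r
  have hc : c ∈ R.powerset := Finset.mem_powerset.2 (Finset.filter_subset _ _)
  have h2 : s⁻¹ • x ∈ pset (signProj R c) := (hx.2 s hs c hc).2 fun r hr => by simp [c, hr]
  have h3 := (hxy s hs _ (Finset.mem_image_of_mem _ hc)).1 h2
  rw [(hx.2 s hs c hc).1 h2 r hr, (hy.2 s hs c hc).1 h3 r hr]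

end Refinement


/-! ## The two formulas for the sofic dimension -/

/-- A finite `κ` can be moved to the left side. This allows the infima over all parameters to be
removed one by one while the error term stays fixed. -/
theorem le_iInf_add_coe {ι : Sort*} {a : EReal} {b : ι → EReal} {κ : ℝ}
    (h : ∀ i, a ≤ b i + (κ : ℝ)) : a ≤ (⨅ i, b i) + (κ : ℝ) := by
  have key : ∀ c : EReal, a ≤ c + (κ : ℝ) ↔ a - (κ : ℝ) ≤ c := fun c =>
    (EReal.sub_le_iff_le_add (Or.inl (EReal.coe_ne_bot κ)) (Or.inl (EReal.coe_ne_top κ))).symm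
  rw [key]
  exact le_iInf fun i => (key _).1 (h i)

theorem exists_finset_subset_closure {G : Type*} [Group G] {Ω : Set G}
    (hΩ : Subgroup.closure Ω = ⊤) (K : Finset G) :
    ∃ E : Finset G, (E : Set G) ⊆ Ω ∧ (K : Set G) ⊆ Subgroup.closure (E : Set G) := by
  classical
  have key : ∀ g : G, ∃ E : Finset G, (E : Set G) ⊆ Ω ∧ g ∈ Subgroup.closure (E : Set G) := by
    intro g
    have hg : g ∈ Subgroup.closure Ω := by rw [hΩ]; exact Subgroup.mem_top g
    induction hg using Subgroup.closure_induction with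
    | mem s hs => exact ⟨{s}, by simpa using hs, Subgroup.subset_closure (by simp)⟩
    | one => exact ⟨∅, by simp, one_mem _⟩
    | mul a b _ _ iha ihb =>
      obtain ⟨A, hA, ha⟩ := iha
      obtain ⟨B, hB, hb⟩ := ihb
      refine ⟨A ∪ B, by simp [hA, hB], mul_mem ?_ ?_⟩
      · exact Subgroup.closure_mono (by simp) ha
      · exact Subgroup.closure_mono (by simp) hb
    | inv a _ iha =>
      obtain ⟨A, hA, ha⟩ := iha
      exact ⟨A, hA, inv_mem ha⟩
  choose E hE hgE using key
  refine ⟨K.biUnion E, by simpa using fun g _ => hE g, fun g hg => ?_⟩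
  exact Subgroup.closure_mono (by exact_mod_cast Finset.subset_biUnion_of_mem E hg) (hgE g)

section Formulas

variable {G X : Type*} [Group G] [MulAction G X] [MeasurableSpace X] [MeasurableSpace G]
  [Countable G] [DiscreteMeasurableSpace G] [MeasurableConstSMul G X]
  {μ : Measure X} [IsProbabilityMeasure μ] [SMulInvariantMeasure G X μ]

/-- Every set that can be approximated by means of `R` can be approximated by means of `P`. -/
def Refines (μ : Measure X) [SMulInvariantMeasure G X μ] (P R : Finset (Linfty μ)) : Prop :=
  ∀ (ε : ℝ) (J : Finset G) (T : Set X), Approximable (μ := μ) ε J R T →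
    Approximable (μ := μ) ε J P T

/-- Each of the finitely many tests is approximated by means of finitely many translates of members
of `S`; `R` collects these members. As `F` generates the group elements involved, one window of
large radius contains them all. -/
theorem exists_sAct_le_of_refines {lim : (ℕ → EReal) → EReal} (hlim : IsLimLike lim)
    {S : Set (Linfty μ)} (hS : ∀ p ∈ S, p * p = p) (hgen : DynGenerating G S) (E : Finset G)
    {Q : Finset (Linfty μ)} (hQ : ∀ q ∈ Q, q * q = q) (F₀ : Finset (InvSemigroup G μ)) (n₀ : ℕ)
    {δ₀ : ℝ} (hδ₀ : 0 < δ₀) {κ : ℝ} (hκ : 0 < κ) [DecidableEq (InvSemigroup G μ)] :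
    ∃ (K : Finset G) (R : Finset (Linfty μ)), (R : Set (Linfty μ)) ⊆ S ∧
      ∀ (F : Finset G) (P : Finset (Linfty μ)), (K : Set G) ⊆ Subgroup.closure (F : Set G) →
        IsProjPartition P → Refines (G := G) μ P R →
        sAct lim E Q F P ≤
          lim (rate (cardSA μ (E.image (unitary μ)) F₀ n₀ δ₀)) + (κ : ℝ) := by
  classical
  obtain ⟨K, 𝒯, η, hη, h𝒯, h⟩ := exists_sAct_le hlim E hQ F₀ n₀ hδ₀ hκ
  choose J R hR hJR using fun T : 𝒯 =>
    exists_approximable (G := G) hS hgen (h𝒯 T T.2) hη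
  refine ⟨K ∪ Finset.univ.biUnion J, Finset.univ.biUnion R, by simpa using hR,
    fun F P hF hP hPR => ?_⟩
  obtain ⟨m, hm⟩ := exists_subset_window (F := F) (K ∪ Finset.univ.biUnion J) fun g hg => hF hg
  refine h F P m hP (Finset.subset_union_left.trans hm) fun T hT => hPR _ _ _ ?_
  exact (hJR ⟨T, hT⟩).mono ((Finset.subset_biUnion_of_mem J (Finset.mem_univ _)).trans
    (Finset.subset_union_right.trans hm)) (Finset.subset_biUnion_of_mem R (Finset.mem_univ _))

theorem isProjPartition_one : IsProjPartition ({1} : Finset (Linfty μ)) :=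
  ⟨by simp [IsStarProjection.one], by simp, by simp⟩

/-- For one inequality the trivial partition `{1}` serves as `Q`, and `E` is a finite part of `Ω`
generating the relevant group elements. For the other, each choice of `F₀`, `n₀`, `δ₀` is answered
by a finite `F ⊆ Ω` and by the partition generated by finitely many projections of `M`. -/
theorem sSet_eq_supInf {lim : (ℕ → EReal) → EReal} (hlim : IsLimLike lim) (Ω : Set G)
    (M : StarSubalgebra ℂ (Linfty μ)) (hΩ : Subgroup.closure Ω = ⊤)
    (hgen : DynGenerating G {p : Linfty μ | p ∈ M ∧ IsStarProjection p}) :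
    sSet (G := G) μ lim Set.univ = supInf lim Ω M := by
  classical
  apply le_antisymm
  · refine iSup₂_le fun E₀ _ => le_of_forall_le_add_pos fun κ hκ => ?_
    obtain ⟨K, hK⟩ := exists_cardSA_rate_le (μ := μ) hlim E₀ hκ
    obtain ⟨E, hE, hKE⟩ := exists_finset_subset_closure hΩ K
    have h1 : (⨅ (F : Finset G) (_ : (F : Set G) ⊆ Ω),
        ⨅ (P : Finset (Linfty μ)) (_ : IsProjPartition P ∧ ∀ p ∈ P, p ∈ M), sAct lim E {1} F P) ≤
        supInf lim Ω M := by
      refine le_iSup₂_of_le (f := fun (E : Finset G) (_ : (E : Set G) ⊆ Ω) => _) E hE ?_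
      exact le_iSup₂_of_le (f := fun (Q : Finset (Linfty μ))
        (_ : IsProjPartition Q ∧ ∀ q ∈ Q, q ∈ M) => _) {1}
        ⟨isProjPartition_one, by simp⟩ le_rfl
    refine le_trans ?_ (add_le_add_left h1 _)
    refine le_iInf_add_coe fun F => le_iInf_add_coe fun _ => le_iInf_add_coe fun P =>
      le_iInf_add_coe fun hP => le_iInf_add_coe fun n => le_iInf_add_coe fun _ =>
      le_iInf_add_coe fun δ => le_iInf_add_coe fun hδ => ?_
    obtain ⟨F₀, δ₀, hδ₀, h2⟩ := hK E hKE {1} F P hP.1 n δ hδ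
    exact (iInf₂_le_of_le F₀ (Set.subset_univ _)
      (iInf₂_le_of_le 2 (by norm_num) (iInf₂_le δ₀ hδ₀))).trans h2
  · refine iSup₂_le fun E _ => iSup₂_le fun Q hQ => le_of_forall_le_add_pos fun κ hκ => ?_
    have h1 : (⨅ (F : Finset (InvSemigroup G μ)) (_ : (F : Set (InvSemigroup G μ)) ⊆ Set.univ),
        sLocal μ lim (E.image (unitary μ)) F) ≤ sSet (G := G) μ lim Set.univ :=
      le_iSup₂_of_le (f := fun (E : Finset (InvSemigroup G μ))
        (_ : (E : Set (InvSemigroup G μ)) ⊆ Set.univ) => _) (E.image (unitary μ))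
        (Set.subset_univ _) le_rfl
    refine le_trans ?_ (add_le_add_left h1 _)
    refine le_iInf_add_coe fun F₀ => le_iInf_add_coe fun _ => le_iInf_add_coe fun n₀ =>
      le_iInf_add_coe fun _ => le_iInf_add_coe fun δ₀ => le_iInf_add_coe fun hδ₀ => ?_
    obtain ⟨K, R, hR, h2⟩ := exists_sAct_le_of_refines hlim (fun p hp => hp.2.isIdempotentElem) hgen
      E (Q := Q) (fun q hq => hQ.1.idem hq) F₀ n₀ hδ₀ hκ
    obtain ⟨F, hF, hKF⟩ := exists_finset_subset_closure hΩ K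
    have hRp : ∀ r ∈ R, IsStarProjection r := fun r hr => (hR hr).2
    have hP := isProjPartition_generatedPartition hRp
    refine le_trans ?_ (h2 F (generatedPartition R) hKF hP ?_)
    · exact iInf₂_le_of_le F hF (iInf₂_le _ ⟨hP, fun p hp =>
        generatedPartition_mem (fun r hr => (hR hr).1) hp⟩)
    · rintro ε J T ⟨B, hB, hTB, hdet⟩
      exact ⟨B, hB, hTB, hdet.generatedPartition fun r hr => (hRp r hr).isIdempotentElem⟩

/-- The same two comparisons with `F` and `P` in all roles: `F` generates every finite set at once,
and the finite set `R` of projections needed is already contained in `P`. -/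
theorem sSet_eq_sAct {lim : (ℕ → EReal) → EReal} (hlim : IsLimLike lim) (F : Finset G)
    (P : Finset (Linfty μ)) (hF : Subgroup.closure (F : Set G) = ⊤) (hP : IsProjPartition P)
    (hgen : DynGenerating G (P : Set (Linfty μ))) :
    sSet (G := G) μ lim Set.univ = sAct lim F P F P := by
  classical
  have hsub : ∀ K : Finset G, (K : Set G) ⊆ Subgroup.closure (F : Set G) := fun K g _ => by
    rw [hF]; exact Subgroup.mem_top g
  apply le_antisymm
  · refine iSup₂_le fun E₀ _ => le_of_forall_le_add_pos fun κ hκ => ?_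
    obtain ⟨K, hK⟩ := exists_cardSA_rate_le (μ := μ) hlim E₀ hκ
    refine le_iInf_add_coe fun n => le_iInf_add_coe fun _ =>
      le_iInf_add_coe fun δ => le_iInf_add_coe fun hδ => ?_
    obtain ⟨F₀, δ₀, hδ₀, h2⟩ := hK F (hsub K) P F P hP n δ hδ
    exact (iInf₂_le_of_le F₀ (Set.subset_univ _)
      (iInf₂_le_of_le 2 (by norm_num) (iInf₂_le δ₀ hδ₀))).trans h2
  · refine le_of_forall_le_add_pos fun κ hκ => ?_
    have h1 : (⨅ (F₀ : Finset (InvSemigroup G μ)) (_ : (F₀ : Set (InvSemigroup G μ)) ⊆ Set.univ),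
        sLocal μ lim (F.image (unitary μ)) F₀) ≤ sSet (G := G) μ lim Set.univ :=
      le_iSup₂_of_le (f := fun (E : Finset (InvSemigroup G μ))
        (_ : (E : Set (InvSemigroup G μ)) ⊆ Set.univ) => _) (F.image (unitary μ))
        (Set.subset_univ _) le_rfl
    refine le_trans ?_ (add_le_add_left h1 _)
    refine le_iInf_add_coe fun F₀ => le_iInf_add_coe fun _ => le_iInf_add_coe fun n₀ =>
      le_iInf_add_coe fun _ => le_iInf_add_coe fun δ₀ => le_iInf_add_coe fun hδ₀ => ?_
    obtain ⟨K, R, hR, h2⟩ := exists_sAct_le_of_refines hlim (fun p hp => hP.idem hp) hgen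
      F (Q := P) (fun q hq => hP.idem hq) F₀ n₀ hδ₀ hκ
    exact h2 F P (hsub K) hP fun ε J T h => h.mono (Finset.Subset.refl _) hR

end Formulas

end SoficDim

theorem mainTheorem12 {G X : Type*} [Group G] [Countable G] [MeasurableSpace G]
    [DiscreteMeasurableSpace G] [MeasurableSpace X] [StandardBorelSpace X]
    (μ : Measure X) [IsProbabilityMeasure μ]
    [MulAction G X] [MeasurableConstSMul G X] [SMulInvariantMeasure G X μ] :
    (∀ (Ω : Set G) (M : StarSubalgebra ℂ (SoficDim.Linfty μ)),
      Subgroup.closure Ω = ⊤ →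
      SoficDim.DynGenerating G {p : SoficDim.Linfty μ | p ∈ M ∧ IsStarProjection p} →
        SoficDim.soficDim G μ = SoficDim.supInf SoficDim.upperLim Ω M ∧
        SoficDim.lowerSoficDim G μ = SoficDim.supInf SoficDim.lowerLim Ω M) ∧
    (∀ (F : Finset G) (P : Finset (SoficDim.Linfty μ)),
      Subgroup.closure (F : Set G) = ⊤ →
      SoficDim.IsProjPartition P →
      SoficDim.DynGenerating G (P : Set (SoficDim.Linfty μ)) →
        SoficDim.soficDim G μ = SoficDim.sAct SoficDim.upperLim F P F P ∧
        SoficDim.lowerSoficDim G μ = SoficDim.sAct SoficDim.lowerLim F P F P) := by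
  refine ⟨fun Ω M hΩ hgen => ⟨?_, ?_⟩, fun F P hF hP hgen => ⟨?_, ?_⟩⟩
  · exact SoficDim.sSet_eq_supInf SoficDim.isLimLike_upperLim Ω M hΩ hgen
  · exact SoficDim.sSet_eq_supInf SoficDim.isLimLike_lowerLim Ω M hΩ hgen
  · exact SoficDim.sSet_eq_sAct SoficDim.isLimLike_upperLim F P hF hP hgen
  · exact SoficDim.sSet_eq_sAct SoficDim.isLimLike_lowerLim F P hF hP hgen
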